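/- Let $G=\operatorname{Spec}A$ be a smooth connected affine algebraic group over $\mathbb C$, let $\mathfrak g\subset T:=\operatorname{Der}_{\mathbb C}(A)$ be its Lie algebra of left invariant vector fields, and put $\Omega:=\Omega^1_{A/\mathbb C}$. For $x\in\mathfrak g$ let $i_R(x)\in T$ be the right invariant vector field whose value at the unit is $-x$ (the vector field generated by $x$ through left translations), so that $i_R$ is a Lie algebra embedding whose image commutes with $\mathfrak g$. Let $(\,,)$ be a symmetric ad-invariant bilinear form on $\mathfrak g$, let $(x,y)_{(K)}=\operatorname{tr}_{\mathfrak g}(\operatorname{ad}_x\operatorname{ad}_y)$ be the Killing form, and let $(\,,)^o=-(\,,)_{(K)}-(\,,)$ be the dual level. For a symmetric ad-invariant form $\kappa$ on $\mathfrak g$ let $\mathcal V_{\mathfrak g;\kappa}$ be the vacuum module of the Kac–Moody algebra $\widehat{\mathfrak g}$ at level $\kappa$ as a vertex algebra, i.e. the universal $\mathbb Z_{\ge0}$-graded vertex algebra generated by $\mathfrak g$ in weight $1$ (linearly in $x\in\mathfrak g$) with $x_{(0)}y=[x,y]$ and $x_{(1)}y=\kappa(x,y)\mathbf 1$. Let $\mathcal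 D^{ch}_{G;(,)}$ be the algebra of chiral differential operators on $G$ (global sections) at level $(\,,)$, i.e. the universal $\mathbb Z_{\ge0}$-graded vertex algebra generated by $A$ in weight $0$ and by $T$ and $\Omega$ in weight $1$ (linearly), with $1_A=\mathbf 1$, $ab=a_{(-1)}b$, $a\omega=a_{(-1)}\omega$, $da=a_{(-2)}\mathbf 1$ for $a,b\in A$, $\omega\in\Omega$, and, for $x,y\in\mathfrak g$, $ax=a_{(-1)}x$, $x_{(0)}a=x(a)$, $x_{(0)}y=[x,y]$, $x_{(1)}y=(x,y)\mathbf 1$. Its component of weight $1$ is $T\oplus\Omega$. Let $j_L:\mathcal V_{\mathfrak g;(,)}\to\mathcal D^{ch}_{G;(,)}$ be the morphism of vertex algebras with $j_L(x)=(x,0)\in T\oplus\Omega$ for $x\in\mathfrak g$. There is a unique linear embedding $j_R:\mathfrak g\hookrightarrow T\oplus\Omega$ whose composition with the projection to $T$ is $i_R$ and which satisfies $j_L(x)_{(n)}j_R(y)=0$ in $\mathcal D^{ch}_{G;(,)}$ for all $x,y\in\mathfrak g$, $n\ge0$. **Corollary 2.6.** The map $j_R$ extends uniquely to a morphism of vertex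 algebras $$j_R:\ \mathcal V_{\mathfrak g;(,)^o}\longrightarrow\mathcal D^{ch}_{G;(,)},$$ and this morphism is injective. Moreover $j_L(x)_{(n)}j_R(y)=0$ for all $x\in\mathcal V_{\mathfrak g;(,)}$, $y\in\mathcal V_{\mathfrak g;(,)^o}$ and $n\ge0$. -/

import Mathlib

open scoped TensorProduct KaehlerDifferential

noncomputable section

/-! ### Vertex algebras -/

/-- The difference of the two sides of the Borcherds identity for `a, b, c` and `m, n, k`,
both sums being cut off at `j < N`. Here `p n a b` stands for the product `a_(n) b`:
`∑_j C(m,j) (a_(n+j) b)_(m+k-j) c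
  = ∑_j (-1)^j C(n,j) (a_(m+n-j) (b_(k+j) c) - (-1)^n b_(n+k-j) (a_(m+j) c))`. -/
def borcherdsDefect {V : Type*} [AddCommGroup V] [Module ℂ V] (p : ℤ → V →ₗ[ℂ] V →ₗ[ℂ] V)
    (m n k : ℤ) (N : ℕ) (a b c : V) : V :=
  (∑ j ∈ Finset.range N,
      ((Ring.choose m j : ℤ) : ℂ) • p (m + k - j) (p (n + j) a b) c) -
    ∑ j ∈ Finset.range N,
      ((-1 : ℂ) ^ j * ((Ring.choose n j : ℤ) : ℂ)) •
        (p (m + n - j) a (p (k + j) b c) - (-1 : ℂ) ^ n • p (n + k - j) b (p (m + j) a c))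

/-- A vertex algebra over `ℂ`: a vector space with bilinear products `a_(n) b` (`n ∈ ℤ`) and a
vacuum vector, such that `a_(n) b = 0` for `n` large, the vacuum axioms hold, and the Borcherds
identity holds. All but finitely many terms of the two sums in the identity vanish; it is
stated for every cut-off `N` beyond which they all do. -/
class VertexAlgebra (V : Type*) [AddCommGroup V] [Module ℂ V] where
  /-- `nprod n a b` is the product `a_(n) b`. -/
  nprod : ℤ → V →ₗ[ℂ] V →ₗ[ℂ] V
  /-- the vacuum vector -/
  vac : V
  truncation : ∀ a b, ∃ N : ℤ, ∀ n, N ≤ n → nprod n a b = 0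
  vac_nprod : ∀ n a, nprod n vac a = if n = -1 then a else 0
  nprod_vac : ∀ a, nprod (-1) a vac = a
  nprod_vac_of_nonneg : ∀ n a, 0 ≤ n → nprod n a vac = 0
  borcherds : ∀ (a b c : V) (m n k : ℤ) (N : ℕ),
    (∀ j : ℤ, N ≤ j → nprod (n + j) a b = 0) →
    (∀ j : ℤ, N ≤ j → nprod (k + j) b c = 0) →
    (∀ j : ℤ, N ≤ j → nprod (m + j) a c = 0) →
    borcherdsDefect nprod m n k N a b c = 0

open VertexAlgebra (nprod vac)

/-- Morphisms of vertex algebras. -/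
@[ext]
structure VertexAlgebraHom (V W : Type*) [AddCommGroup V] [Module ℂ V] [VertexAlgebra V]
    [AddCommGroup W] [Module ℂ W] [VertexAlgebra W] where
  toFun : V →ₗ[ℂ] W
  map_vac : toFun vac = vac
  map_nprod : ∀ (n : ℤ) (a b : V), toFun (nprod n a b) = nprod n (toFun a) (toFun b)

/-! ### Graded vertex algebras given by generators and relations -/

namespace VertexPresentation

/-- Formal expressions in generators `X`, the vacuum, and the products `_(n)`. -/
inductive FormalExpr (X : Type*)
  | vac : FormalExpr X
  | gen : X → FormalExpr X
  | node : ℤ → FormalExpr X → FormalExpr X → FormalExpr X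

/-- The conformal weight of an expression: the vacuum has weight `0`, and `a_(n) b` has weight
`wt a + wt b - n - 1`. -/
def FormalExpr.deg {X : Type*} (wt : X → ℕ) : FormalExpr X → ℤ
  | .vac => 0
  | .gen x => wt x
  | .node n s t => s.deg wt + t.deg wt - n - 1

/-- Linear combinations of formal expressions. -/
abbrev Free (X : Type*) := FormalExpr X →₀ ℂ

variable {X : Type*}

/-- An expression as an element of `Free X`. -/
def tree (t : FormalExpr X) : Free X := Finsupp.single t 1

/-- A generator as an element of `Free X`. -/
def gen (x : X) : Free X := tree (.gen x)

/-- The formal vacuum. -/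
def one : Free X := tree .vac

/-- The formal bilinear product `_(n)`. -/
def mul (n : ℤ) : Free X →ₗ[ℂ] Free X →ₗ[ℂ] Free X :=
  Finsupp.lift (Free X →ₗ[ℂ] Free X) ℂ (FormalExpr X) fun s =>
    Finsupp.lift (Free X) ℂ (FormalExpr X) fun t => tree (.node n s t)

/-- The relations of the graded vertex algebra with generators `X` of weights `wt` and
relations `R`: the relations in `R`; the vanishing of everything of negative weight; the axioms
of a vertex algebra; and all consequences of these under multiplication on either side. -/
inductive Rel (wt : X → ℕ) (R : Free X → Prop) : Free X → Prop
  | base (r : Free X) : R r → Rel wt R r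
  | neg (t : FormalExpr X) : t.deg wt < 0 → Rel wt R (tree t)
  | vac_mul (n : ℤ) (t : FormalExpr X) :
      Rel wt R (mul n one (tree t) - if n = -1 then tree t else 0)
  | mul_vac (t : FormalExpr X) : Rel wt R (mul (-1) (tree t) one - tree t)
  | mul_vac_of_nonneg (n : ℤ) (t : FormalExpr X) : 0 ≤ n → Rel wt R (mul n (tree t) one)
  | borcherds (s t u : FormalExpr X) (m n k : ℤ) (N : ℕ) :
      s.deg wt + t.deg wt ≤ n + N → t.deg wt + u.deg wt ≤ k + N →
      s.deg wt + u.deg wt ≤ m + N →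
      Rel wt R (borcherdsDefect mul m n k N (tree s) (tree t) (tree u))
  | mul_left (n : ℤ) (t : FormalExpr X) (r : Free X) : Rel wt R r → Rel wt R (mul n (tree t) r)
  | mul_right (n : ℤ) (t : FormalExpr X) (r : Free X) : Rel wt R r → Rel wt R (mul n r (tree t))

/-- The span of all relations. -/
def ideal (wt : X → ℕ) (R : Free X → Prop) : Submodule ℂ (Free X) :=
  Submodule.span ℂ {r | Rel wt R r}

/-- The graded vertex algebra with generators `X` of weights `wt` and relations `R`: the
universal `ℤ_{≥ 0}`-graded vertex algebra with elements of weight `wt x`, `x ∈ X`, that satisfy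
`R`. -/
abbrev Envelope (wt : X → ℕ) (R : Free X → Prop) : Type _ := Free X ⧸ ideal wt R

variable {wt : X → ℕ} {R : Free X → Prop}

/-- The projection. -/
def mk (wt : X → ℕ) (R : Free X → Prop) : Free X →ₗ[ℂ] Envelope wt R := (ideal wt R).mkQ

theorem mk_surjective : Function.Surjective (mk wt R) := (ideal wt R).mkQ_surjective

theorem mk_eq_zero {r : Free X} : mk wt R r = 0 ↔ r ∈ ideal wt R :=
  Submodule.Quotient.mk_eq_zero _

theorem rel_mem {r : Free X} (h : Rel wt R r) : r ∈ ideal wt R := Submodule.subset_span h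

theorem mk_rel {r : Free X} (h : Rel wt R r) : mk wt R r = 0 :=
  mk_eq_zero.2 (Submodule.subset_span h)

@[simp] theorem mul_tree (n : ℤ) (s t : FormalExpr X) :
    mul n (tree s) (tree t) = tree (.node n s t) := by
  simp [mul, tree]

theorem induct {P : Free X → Prop} (h0 : P 0) (hadd : ∀ u v, P u → P v → P (u + v))
    (hs : ∀ (c : ℂ) t, P (c • tree t)) (u : Free X) : P u := by
  induction u using Finsupp.induction_linear with
  | zero => exact h0
  | add f g hf hg => exact hadd _ _ hf hg
  | single t c => simpa [tree] using hs c t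

theorem mul_mem_left (n : ℤ) (u : Free X) {r : Free X} (hr : r ∈ ideal wt R) :
    mul n u r ∈ ideal wt R := by
  induction u using induct with
  | h0 => simp
  | hadd u v hu hv => simpa using add_mem hu hv
  | hs c t =>
    rw [map_smul, LinearMap.smul_apply]
    refine Submodule.smul_mem _ _ ?_
    refine (Submodule.span_le (p := (ideal wt R).comap (mul n (tree t)))).2 ?_ hr
    intro r hr
    exact Submodule.subset_span (Rel.mul_left n t r hr)

theorem mul_mem_right (n : ℤ) (u : Free X) {r : Free X} (hr : r ∈ ideal wt R) :
    mul n r u ∈ ideal wt R := by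
  induction u using induct with
  | h0 => simp
  | hadd u v hu hv => simpa using add_mem hu hv
  | hs c t =>
    rw [map_smul]
    refine Submodule.smul_mem _ _ ?_
    refine (Submodule.span_le (p := (ideal wt R).comap ((mul n).flip (tree t)))).2 ?_ hr
    intro r hr
    exact Submodule.subset_span (Rel.mul_right n t r hr)

/-- The product `_(n)` on the quotient. -/
def qmul (n : ℤ) : Envelope wt R →ₗ[ℂ] Envelope wt R →ₗ[ℂ] Envelope wt R :=
  (ideal wt R).liftQ
    (LinearMap.mk₂ ℂ (fun u (v : Envelope wt R) =>
        ((ideal wt R).mapQ (ideal wt R) (mul n u) fun _ hr => mul_mem_left n u hr) v)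
      (fun u u' v => by
        obtain ⟨v, rfl⟩ := (ideal wt R).mkQ_surjective v
        simp only [Submodule.mkQ_apply, Submodule.mapQ_apply, map_add, LinearMap.add_apply,
          Submodule.Quotient.mk_add])
      (fun c u v => by
        obtain ⟨v, rfl⟩ := (ideal wt R).mkQ_surjective v
        simp only [Submodule.mkQ_apply, Submodule.mapQ_apply, map_smul, LinearMap.smul_apply,
          Submodule.Quotient.mk_smul])
      (fun u v v' => map_add _ v v') (fun c u v => map_smul _ c v))
    (fun r hr => by
      ext v
      exact mk_eq_zero.2 (mul_mem_right n _ hr))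

@[simp] theorem qmul_mk (n : ℤ) (u v : Free X) :
    qmul n (mk wt R u) (mk wt R v) = mk wt R (mul n u v) := rfl

theorem defect_mk (m n k : ℤ) (N : ℕ) (u v w : Free X) :
    borcherdsDefect qmul m n k N (mk wt R u) (mk wt R v) (mk wt R w) =
      mk wt R (borcherdsDefect mul m n k N u v w) := by
  simp [borcherdsDefect]

theorem qmul_truncation (a b : Envelope wt R) : ∃ N : ℤ, ∀ n, N ≤ n → qmul n a b = 0 := by
  obtain ⟨u, rfl⟩ := mk_surjective a
  obtain ⟨v, rfl⟩ := mk_surjective b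
  induction u using induct with
  | h0 => exact ⟨0, by simp⟩
  | hadd u u' hu hu' =>
    obtain ⟨N, hN⟩ := hu
    obtain ⟨N', hN'⟩ := hu'
    refine ⟨max N N', fun n hn => ?_⟩
    rw [map_add, map_add, LinearMap.add_apply, hN n (by omega), hN' n (by omega), add_zero]
  | hs c s =>
    induction v using induct with
    | h0 => exact ⟨0, by simp⟩
    | hadd u u' hu hu' =>
      obtain ⟨N, hN⟩ := hu
      obtain ⟨N', hN'⟩ := hu'
      refine ⟨max N N', fun n hn => ?_⟩
      rw [map_add, map_add, hN n (by omega), hN' n (by omega), add_zero]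
    | hs d t =>
      refine ⟨s.deg wt + t.deg wt, fun n hn => ?_⟩
      rw [map_smul, map_smul, map_smul, LinearMap.smul_apply, map_smul, qmul_mk, mul_tree,
        mk_rel (Rel.neg _ (by simp only [FormalExpr.deg]; omega)), smul_zero, smul_zero]

theorem defect_add₁ {V : Type*} [AddCommGroup V] [Module ℂ V] (p : ℤ → V →ₗ[ℂ] V →ₗ[ℂ] V)
    (m n k : ℤ) (N : ℕ) (a a' b c : V) :
    borcherdsDefect p m n k N (a + a') b c =
      borcherdsDefect p m n k N a b c + borcherdsDefect p m n k N a' b c := by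
  simp only [borcherdsDefect, map_add, LinearMap.add_apply, smul_add, smul_sub,
    Finset.sum_add_distrib, Finset.sum_sub_distrib]
  abel

theorem defect_add₂ {V : Type*} [AddCommGroup V] [Module ℂ V] (p : ℤ → V →ₗ[ℂ] V →ₗ[ℂ] V)
    (m n k : ℤ) (N : ℕ) (a b b' c : V) :
    borcherdsDefect p m n k N a (b + b') c =
      borcherdsDefect p m n k N a b c + borcherdsDefect p m n k N a b' c := by
  simp only [borcherdsDefect, map_add, LinearMap.add_apply, smul_add, smul_sub,
    Finset.sum_add_distrib, Finset.sum_sub_distrib]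
  abel

theorem defect_add₃ {V : Type*} [AddCommGroup V] [Module ℂ V] (p : ℤ → V →ₗ[ℂ] V →ₗ[ℂ] V)
    (m n k : ℤ) (N : ℕ) (a b c c' : V) :
    borcherdsDefect p m n k N a b (c + c') =
      borcherdsDefect p m n k N a b c + borcherdsDefect p m n k N a b c' := by
  simp only [borcherdsDefect, map_add, smul_add, smul_sub,
    Finset.sum_add_distrib, Finset.sum_sub_distrib]
  abel

theorem defect_smul {V : Type*} [AddCommGroup V] [Module ℂ V] (p : ℤ → V →ₗ[ℂ] V →ₗ[ℂ] V)
    (m n k : ℤ) (N : ℕ) (x y z : ℂ) (a b c : V) :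
    borcherdsDefect p m n k N (x • a) (y • b) (z • c) =
      (x * y * z) • borcherdsDefect p m n k N a b c := by
  simp only [borcherdsDefect, map_smul, LinearMap.smul_apply, smul_sub, Finset.smul_sum,
    smul_smul]
  refine congrArg₂ _ ?_ (Finset.sum_congr rfl fun j _ => ?_)
  · exact Finset.sum_congr rfl fun j _ => by ring_nf
  · ring_nf

theorem defect_large (a b c : Envelope wt R) (m n k : ℤ) :
    ∃ N₀ : ℕ, ∀ N, N₀ ≤ N → borcherdsDefect qmul m n k N a b c = 0 := by
  obtain ⟨u, rfl⟩ := mk_surjective a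
  obtain ⟨v, rfl⟩ := mk_surjective b
  obtain ⟨w, rfl⟩ := mk_surjective c
  induction u using induct with
  | h0 => exact ⟨0, by simp [borcherdsDefect]⟩
  | hadd u u' hu hu' =>
    obtain ⟨N, hN⟩ := hu
    obtain ⟨N', hN'⟩ := hu'
    refine ⟨max N N', fun n hn => ?_⟩
    rw [map_add, defect_add₁, hN n (by omega), hN' n (by omega), add_zero]
  | hs x s =>
    induction v using induct with
    | h0 => exact ⟨0, by simp [borcherdsDefect]⟩
    | hadd u u' hu hu' =>
      obtain ⟨N, hN⟩ := hu
      obtain ⟨N', hN'⟩ := hu'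
      refine ⟨max N N', fun n hn => ?_⟩
      rw [map_add, defect_add₂, hN n (by omega), hN' n (by omega), add_zero]
    | hs y t =>
      induction w using induct with
      | h0 => exact ⟨0, by simp [borcherdsDefect]⟩
      | hadd u u' hu hu' =>
        obtain ⟨N, hN⟩ := hu
        obtain ⟨N', hN'⟩ := hu'
        refine ⟨max N N', fun n hn => ?_⟩
        rw [map_add, defect_add₃, hN n (by omega), hN' n (by omega), add_zero]
      | hs z u =>
        refine ⟨(s.deg wt + t.deg wt - n).toNat + (t.deg wt + u.deg wt - k).toNat +
          (s.deg wt + u.deg wt - m).toNat, fun N hN => ?_⟩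
        rw [map_smul, map_smul, map_smul, defect_smul, defect_mk,
          mk_rel (Rel.borcherds s t u m n k N (by omega) (by omega) (by omega)), smul_zero]

theorem defect_cutoff {V : Type*} [AddCommGroup V] [Module ℂ V] (p : ℤ → V →ₗ[ℂ] V →ₗ[ℂ] V)
    (a b c : V) (m n k : ℤ) (N N' : ℕ) (h : N ≤ N')
    (h₁ : ∀ j : ℤ, N ≤ j → p (n + j) a b = 0) (h₂ : ∀ j : ℤ, N ≤ j → p (k + j) b c = 0)
    (h₃ : ∀ j : ℤ, N ≤ j → p (m + j) a c = 0) :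
    borcherdsDefect p m n k N a b c = borcherdsDefect p m n k N' a b c := by
  have hsub : Finset.range N ⊆ Finset.range N' := Finset.range_mono h
  refine congrArg₂ _ (Finset.sum_subset hsub fun j _ hj => ?_)
    (Finset.sum_subset hsub fun j _ hj => ?_)
  all_goals
    have hj' : (N : ℤ) ≤ j := by
      have := Finset.mem_range.not.1 hj
      omega
  · rw [h₁ j hj']; simp
  · rw [h₂ j hj', h₃ j hj']; simp

instance : VertexAlgebra (Envelope wt R) where
  nprod := qmul
  vac := mk wt R one
  truncation := qmul_truncation
  vac_nprod n a := by
    obtain ⟨u, rfl⟩ := mk_surjective a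
    induction u using induct with
    | h0 => simp
    | hadd u v hu hv =>
      rw [map_add, map_add, hu, hv]
      split_ifs <;> simp
    | hs c t =>
      have h := mk_rel (Rel.vac_mul (wt := wt) (R := R) n t)
      rw [map_sub, sub_eq_zero] at h
      rw [map_smul, map_smul, qmul_mk, h]
      split_ifs <;> simp
  nprod_vac a := by
    obtain ⟨u, rfl⟩ := mk_surjective a
    induction u using induct with
    | h0 => simp
    | hadd u v hu hv => rw [map_add, map_add, LinearMap.add_apply, hu, hv]
    | hs c t =>
      have h := mk_rel (Rel.mul_vac (wt := wt) (R := R) t)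
      rw [map_sub, sub_eq_zero] at h
      rw [map_smul, map_smul, LinearMap.smul_apply, qmul_mk, h]
  nprod_vac_of_nonneg n a hn := by
    obtain ⟨u, rfl⟩ := mk_surjective a
    induction u using induct with
    | h0 => simp
    | hadd u v hu hv => rw [map_add, map_add, LinearMap.add_apply, hu, hv, add_zero]
    | hs c t =>
      rw [map_smul, map_smul, LinearMap.smul_apply, qmul_mk,
        mk_rel (Rel.mul_vac_of_nonneg n t hn), smul_zero]
  borcherds a b c m n k N h₁ h₂ h₃ := by
    obtain ⟨N₀, hN₀⟩ := defect_large a b c m n k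
    rw [defect_cutoff _ a b c m n k N (max N N₀) (le_max_left _ _) h₁ h₂ h₃]
    exact hN₀ _ (le_max_right _ _)

/-- The image of a generator. -/
def of (wt : X → ℕ) (R : Free X → Prop) (x : X) : Envelope wt R := mk wt R (gen x)

/-! Functoriality: a weight preserving map of generators that respects the relations. -/

section Map

variable {Y : Type*} (f : X → Y)

/-- Substitution of generators in an expression. -/
def FormalExpr.map : FormalExpr X → FormalExpr Y
  | .vac => .vac
  | .gen x => .gen (f x)
  | .node n s t => .node n s.map t.map

/-- Substitution of generators in a linear combination of expressions. -/
def freeMap : Free X →ₗ[ℂ] Free Y := Finsupp.lmapDomain ℂ ℂ (FormalExpr.map f)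

@[simp] theorem freeMap_tree (t : FormalExpr X) : freeMap f (tree t) = tree (t.map f) := by
  simp [freeMap, tree]

@[simp] theorem freeMap_mul (n : ℤ) (u v : Free X) :
    freeMap f (mul n u v) = mul n (freeMap f u) (freeMap f v) := by
  induction u using induct with
  | h0 => simp
  | hadd u u' hu hu' => simp [hu, hu']
  | hs c s =>
    induction v using induct with
    | h0 => simp
    | hadd u u' hu hu' => rw [map_add, map_add, map_add, map_add, hu, hu']
    | hs d t => simp [FormalExpr.map]

theorem freeMap_defect (m n k : ℤ) (N : ℕ) (a b c : Free X) :
    freeMap f (borcherdsDefect mul m n k N a b c) =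
      borcherdsDefect mul m n k N (freeMap f a) (freeMap f b) (freeMap f c) := by
  simp [borcherdsDefect]

variable {f} {wt' : Y → ℕ} {R' : Free Y → Prop}

theorem deg_map (hwt : ∀ x, wt' (f x) = wt x) (t : FormalExpr X) : (t.map f).deg wt' = t.deg wt := by
  induction t with
  | vac => rfl
  | gen x => simp [FormalExpr.map, FormalExpr.deg, hwt]
  | node n s t hs ht => simp [FormalExpr.map, FormalExpr.deg, hs, ht]

theorem rel_map (hwt : ∀ x, wt' (f x) = wt x)
    (hR : ∀ r, R r → freeMap f r ∈ ideal wt' R') {r : Free X} (hr : Rel wt R r) :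
    freeMap f r ∈ ideal wt' R' := by
  induction hr with
  | base r h => exact hR r h
  | neg t h =>
    rw [freeMap_tree]
    exact Submodule.subset_span (Rel.neg _ (by rwa [deg_map hwt]))
  | vac_mul n t =>
    have h : freeMap f (if n = -1 then tree t else 0) =
        if n = -1 then tree (t.map f) else 0 := by split_ifs <;> simp
    rw [map_sub, freeMap_mul, h, freeMap_tree]
    simpa [one, FormalExpr.map] using
      rel_mem (Rel.vac_mul (wt := wt') (R := R') n (t.map f))
  | mul_vac t =>
    simpa [one, FormalExpr.map] using rel_mem (Rel.mul_vac (wt := wt') (R := R') (t.map f))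
  | mul_vac_of_nonneg n t h =>
    simpa [one, FormalExpr.map] using
      rel_mem (Rel.mul_vac_of_nonneg (wt := wt') (R := R') n (t.map f) h)
  | borcherds s t u m n k N h₁ h₂ h₃ =>
    rw [freeMap_defect, freeMap_tree, freeMap_tree, freeMap_tree]
    refine Submodule.subset_span (Rel.borcherds _ _ _ m n k N ?_ ?_ ?_) <;>
      simpa only [deg_map hwt]
  | mul_left n t r _ ih => rw [freeMap_mul]; exact mul_mem_left n _ ih
  | mul_right n t r _ ih => rw [freeMap_mul]; exact mul_mem_right n _ ih

/-- The morphism of vertex algebras induced by a map of generators. -/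
def map (f : X → Y) (hwt : ∀ x, wt' (f x) = wt x)
    (hR : ∀ r, R r → freeMap f r ∈ ideal wt' R') :
    VertexAlgebraHom (Envelope wt R) (Envelope wt' R') where
  toFun := (ideal wt R).mapQ (ideal wt' R') (freeMap f)
    (Submodule.span_le.2 fun _ hr => rel_map hwt hR hr)
  map_vac := by
    change mk wt' R' (freeMap f one) = mk wt' R' one
    simp [one, FormalExpr.map]
  map_nprod n a b := by
    obtain ⟨u, rfl⟩ := mk_surjective a
    obtain ⟨v, rfl⟩ := mk_surjective b
    change mk wt' R' (freeMap f (mul n u v)) = mk wt' R' (mul n (freeMap f u) (freeMap f v))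
    rw [freeMap_mul]

end Map

end VertexPresentation

/-! ### The vacuum module of an affine Lie algebra -/

section Affine

open VertexPresentation

variable {𝔤 : Type*} [LieRing 𝔤] [LieAlgebra ℂ 𝔤]

/-- The relations `x_(0) y = [x, y]`, `x_(1) y = κ(x, y)` (and `x_(n) y = 0` for `n ≥ 2`, by
weight), and linearity of `x ↦ x(z)`. -/
inductive AffineRel (κ : LinearMap.BilinForm ℂ 𝔤) : Free 𝔤 → Prop
  | add (x y : 𝔤) : AffineRel κ (gen (x + y) - (gen x + gen y))
  | smul (c : ℂ) (x : 𝔤) : AffineRel κ (gen (c • x) - c • gen x)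
  | bracket (x y : 𝔤) : AffineRel κ (mul 0 (gen x) (gen y) - gen ⁅x, y⁆)
  | form (x y : 𝔤) : AffineRel κ (mul 1 (gen x) (gen y) - κ x y • one)

/-- The vertex algebra `V_{𝔤; κ}` of the vacuum module at level `κ`: the vertex envelope of the
vertex algebroid `(ℂ, 𝔤, 0, 0, 0, κ, 0)`, generated by fields `x(z)`, `x ∈ 𝔤`, of weight `1` with
`x(z) y(w) ∼ κ(x, y) / (z - w)² + [x, y](w) / (z - w)`. -/
abbrev AffineVertexAlgebra (κ : LinearMap.BilinForm ℂ 𝔤) : Type _ :=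
  Envelope (fun _ : 𝔤 => 1) (AffineRel κ)

/-- The element `x_(-1) 1` of weight `1` in `V_{𝔤; κ}`, for `x ∈ 𝔤`. -/
def affineOf (κ : LinearMap.BilinForm ℂ 𝔤) (x : 𝔤) : AffineVertexAlgebra κ := of _ _ x

/-- The dual level: minus the Killing form minus `κ`. -/
def dualLevel (κ : LinearMap.BilinForm ℂ 𝔤) : LinearMap.BilinForm ℂ 𝔤 := -killingForm ℂ 𝔤 - κ

end Affine

/-! ### Invariant vector fields on an affine algebraic group `G = Spec A` -/

section Group

variable (A : Type*) [CommRing A] [HopfAlgebra ℂ A]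

open Coalgebra

/-- The Lie algebra `𝔤` of `G = Spec A`: left invariant vector fields, i.e. derivations `x` of `A`
with `Δ ∘ x = (id ⊗ x) ∘ Δ`, where `(Δ f)(g, h) = f(gh)`. -/
def leftInvariantFields : LieSubalgebra ℂ (Derivation ℂ A A) where
  carrier := {x | ∀ f : A, comul (R := ℂ) (x f) =
    (x : A →ₗ[ℂ] A).lTensor A (comul (R := ℂ) f)}
  add_mem' := by
    intro x y hx hy f
    simp only [Derivation.add_apply, map_add, hx f, hy f, Derivation.coe_add_linearMap,
      LinearMap.lTensor_add, LinearMap.add_apply]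
  zero_mem' := by intro f; simp
  smul_mem' := by
    intro c x hx f
    simp only [Derivation.smul_apply, map_smul, hx f, Derivation.coe_smul_linearMap,
      LinearMap.lTensor_smul, LinearMap.smul_apply]
  lie_mem' := by
    intro x y hx hy f
    have e : ∀ z w : Derivation ℂ A A, ∀ t : A ⊗[ℂ] A,
        (z : A →ₗ[ℂ] A).lTensor A ((w : A →ₗ[ℂ] A).lTensor A t) =
          ((z : A →ₗ[ℂ] A) ∘ₗ (w : A →ₗ[ℂ] A)).lTensor A t := fun z w t => by
      rw [LinearMap.lTensor_comp]; rfl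
    rw [Derivation.commutator_apply, map_sub, hx (y f), hy (x f), hy f, hx f, e, e,
      Derivation.commutator_coe_linear_map, LieRing.of_associative_ring_bracket,
      LinearMap.lTensor_sub, LinearMap.sub_apply]
    rfl

/-- The linear map `a ⊗ b ↦ (x a)(e) b`. -/
def evalFst (x : Derivation ℂ A A) : A ⊗[ℂ] A →ₗ[ℂ] A :=
  (TensorProduct.lid ℂ A).toLinearMap ∘ₗ
    (counit (R := ℂ) (A := A) ∘ₗ (x : A →ₗ[ℂ] A)).rTensor A

theorem evalFst_mul (x : Derivation ℂ A A) (s t : A ⊗[ℂ] A) :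
    evalFst A x (s * t) =
      TensorProduct.lid ℂ A ((counit (R := ℂ) (A := A)).rTensor A s) * evalFst A x t +
      TensorProduct.lid ℂ A ((counit (R := ℂ) (A := A)).rTensor A t) * evalFst A x s := by
  induction s with
  | zero => simp
  | add s s' hs hs' => simp only [add_mul, map_add, hs, hs', mul_add]; ring
  | tmul a b =>
    induction t with
    | zero => simp
    | add t t' ht ht' => simp only [mul_add, map_add, ht, ht', add_mul]; ring
    | tmul c d =>
      simp only [evalFst, Algebra.TensorProduct.tmul_mul_tmul, LinearMap.comp_apply,
        LinearEquiv.coe_coe, LinearMap.rTensor_tmul, TensorProduct.lid_tmul,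
        Derivation.coeFn_coe, Derivation.leibniz, smul_eq_mul, map_add, Bialgebra.counit_mul,
        Algebra.smul_def, map_mul]
      ring

/-- The vector field of the action of `x ∈ 𝔤` through left translations,
`(i_R(x) f)(g) = d/dt f(exp(-tx) g)` at `t = 0`, that is `i_R(x) f = - ∑ (x f₁)(e) f₂` where
`Δ f = ∑ f₁ ⊗ f₂`. It is right invariant, takes the value `-x` at the unit `e`, and
`x ↦ i_R(x)` is a homomorphism of Lie algebras. -/
def rightField (x : leftInvariantFields A) : Derivation ℂ A A :=
  Derivation.mk' (-(evalFst A x ∘ₗ comul (R := ℂ) (A := A))) fun f g => by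
    simp only [LinearMap.neg_apply, LinearMap.comp_apply, Bialgebra.comul_mul, evalFst_mul,
      Coalgebra.rTensor_counit_comul, TensorProduct.lid_tmul, one_smul, smul_eq_mul]
    ring

end Group

/-! ### Chiral differential operators on `G = Spec A` -/

section CDO

open VertexPresentation

variable {A : Type*} [CommRing A] [HopfAlgebra ℂ A]

/-- Generators of the algebra of chiral differential operators: functions (weight `0`), vector
fields and `1`-forms (weight `1`). -/
inductive CDOGen (A : Type*) [CommRing A] [HopfAlgebra ℂ A]
  | fn : A → CDOGen A
  | vf : Derivation ℂ A A → CDOGen A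
  | form : Ω[A⁄ℂ] → CDOGen A

/-- The conformal weights of the generators. -/
def CDOGen.wt : CDOGen A → ℕ
  | .fn _ => 0
  | .vf _ => 1
  | .form _ => 1

/-- The relations of the vertex envelope of the vertex algebroid
`(A, T, Ω, d, γ, ⟨,⟩, c)`, `T = Der A`, `Ω = Ω¹(A)`, obtained from `(ℂ, 𝔤, κ, c = 0)` by pushout
along `ℂ → A`, where `𝔤 ⊆ T` are the left invariant fields and `γ` is zero on `A × 𝔤`. As
`T = A ⊗ 𝔤`, the operations `γ, ⟨,⟩, c` are determined by their restrictions to `𝔤`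
(`γ = 0`, `⟨x, y⟩ = κ(x, y)`, `c = 0`), so they are imposed there: for `x, y ∈ 𝔤`,
`a ∈ A`, `f x = f_(-1) x`, `x_(0) a = x(a)`, `x_(0) y = [x, y]`, `x_(1) y = κ(x, y)`. The
remaining products of generators follow from these and
`a b = a_(-1) b`, `a ω = a_(-1) ω`, `d a = ∂ a = a_(-2) 1`. -/
inductive CDORel (κ : LinearMap.BilinForm ℂ (leftInvariantFields A)) : Free (CDOGen A) → Prop
  | fn_add (a b : A) : CDORel κ (gen (.fn (a + b)) - (gen (.fn a) + gen (.fn b)))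
  | fn_smul (c : ℂ) (a : A) : CDORel κ (gen (.fn (c • a)) - c • gen (.fn a))
  | vf_add (x y : Derivation ℂ A A) : CDORel κ (gen (.vf (x + y)) - (gen (.vf x) + gen (.vf y)))
  | vf_smul (c : ℂ) (x : Derivation ℂ A A) : CDORel κ (gen (.vf (c • x)) - c • gen (.vf x))
  | form_add (w v : Ω[A⁄ℂ]) : CDORel κ (gen (.form (w + v)) - (gen (.form w) + gen (.form v)))
  | fn_one : CDORel κ (gen (.fn 1) - one)
  | fn_mul (a b : A) : CDORel κ (gen (.fn (a * b)) - mul (-1) (gen (.fn a)) (gen (.fn b)))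
  | fn_form (a : A) (w : Ω[A⁄ℂ]) :
      CDORel κ (gen (.form (a • w)) - mul (-1) (gen (.fn a)) (gen (.form w)))
  | form_d (a : A) :
      CDORel κ (gen (.form (KaehlerDifferential.D ℂ A a)) - mul (-2) (gen (.fn a)) one)
  | fn_vf (a : A) (x : leftInvariantFields A) :
      CDORel κ (gen (.vf (a • (x : Derivation ℂ A A))) -
        mul (-1) (gen (.fn a)) (gen (.vf x)))
  | vf_fn (x : leftInvariantFields A) (a : A) :
      CDORel κ (mul 0 (gen (.vf x)) (gen (.fn a)) -
        gen (.fn ((x : Derivation ℂ A A) a)))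
  | bracket (x y : leftInvariantFields A) :
      CDORel κ (mul 0 (gen (.vf x)) (gen (.vf y)) -
        gen (.vf (⁅x, y⁆ : leftInvariantFields A)))
  | pairing (x y : leftInvariantFields A) :
      CDORel κ (mul 1 (gen (.vf x)) (gen (.vf y)) - κ x y • one)

/-- The vertex algebra `D^ch_{G; κ}` of (global) chiral differential operators on `G = Spec A`
at level `κ`. -/
abbrev ChiralDiffOps (κ : LinearMap.BilinForm ℂ (leftInvariantFields A)) : Type _ :=
  Envelope (CDOGen.wt (A := A)) (CDORel κ)

theorem of_smul_form (κ : LinearMap.BilinForm ℂ (leftInvariantFields A)) (c : ℂ) (w : Ω[A⁄ℂ]) :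
    of _ (CDORel κ) (.form (c • w)) = c • of CDOGen.wt _ (.form w) := by
  have h := mk_rel (wt := CDOGen.wt) (Rel.base _ (CDORel.fn_form (κ := κ) (c • 1) w))
  have h₁ := mk_rel (wt := CDOGen.wt) (Rel.base _ (CDORel.fn_smul (κ := κ) c 1))
  have h₂ := mk_rel (wt := CDOGen.wt) (Rel.base _ (CDORel.fn_one (κ := κ)))
  rw [map_sub, sub_eq_zero] at h h₁ h₂
  rw [smul_assoc, one_smul, ← qmul_mk, h₁, map_smul, h₂, map_smul, LinearMap.smul_apply] at h
  exact h.trans (congrArg _ ((VertexAlgebra.vac_nprod (-1) _).trans (if_pos rfl)))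

/-- The component of conformal weight `1`, `T ⊕ Ω → D^ch_{G; κ}`. -/
def weightOne (κ : LinearMap.BilinForm ℂ (leftInvariantFields A)) :
    (Derivation ℂ A A × Ω[A⁄ℂ]) →ₗ[ℂ] ChiralDiffOps κ where
  toFun p := of _ _ (.vf p.1) + of _ _ (.form p.2)
  map_add' p q := by
    have h₁ := mk_rel (wt := CDOGen.wt) (Rel.base _ (CDORel.vf_add (κ := κ) p.1 q.1))
    have h₂ := mk_rel (wt := CDOGen.wt) (Rel.base _ (CDORel.form_add (κ := κ) p.2 q.2))
    rw [map_sub, sub_eq_zero, map_add] at h₁ h₂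
    exact (congrArg₂ _ h₁ h₂).trans (add_add_add_comm _ _ _ _)
  map_smul' c p := by
    have h₁ := mk_rel (wt := CDOGen.wt) (Rel.base _ (CDORel.vf_smul (κ := κ) c p.1))
    rw [map_sub, sub_eq_zero, map_smul] at h₁
    exact (congrArg₂ _ h₁ (of_smul_form κ c p.2)).trans (smul_add _ _ _).symm

/-- The map `j_L : 𝔤 → T ⊕ Ω`, `x ↦ (x, 0)`. -/
def leftMap (A : Type*) [CommRing A] [HopfAlgebra ℂ A] :
    leftInvariantFields A →ₗ[ℂ] Derivation ℂ A A × Ω[A⁄ℂ] :=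
  LinearMap.inl ℂ _ _ ∘ₗ (leftInvariantFields A).toSubmodule.subtype

/-- The morphism of vertex algebras `j_L : V_{𝔤; κ} → D^ch_{G; κ}` that sends `x ∈ 𝔤` to the left
invariant vector field `x`. -/
def leftHom (κ : LinearMap.BilinForm ℂ (leftInvariantFields A)) :
    VertexAlgebraHom (AffineVertexAlgebra κ) (ChiralDiffOps κ) :=
  VertexPresentation.map (fun x => CDOGen.vf (x : Derivation ℂ A A)) (fun _ => rfl) (by
    intro r hr
    refine rel_mem (Rel.base _ ?_)
    cases hr with
    | add x y => simpa [gen, FormalExpr.map] using CDORel.vf_add (κ := κ) x.1 y.1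
    | smul c x => simpa [gen, FormalExpr.map] using CDORel.vf_smul (κ := κ) c x.1
    | bracket x y => simpa [gen, FormalExpr.map] using CDORel.bracket (κ := κ) x y
    | form x y => simpa [gen, one, FormalExpr.map] using CDORel.pairing (κ := κ) x y)

theorem leftHom_affineOf (κ : LinearMap.BilinForm ℂ (leftInvariantFields A))
    (x : leftInvariantFields A) :
    (leftHom κ).toFun (affineOf κ x) = weightOne κ (leftMap A x) := by
  have h : of CDOGen.wt (CDORel κ) (.form 0) = 0 := by
    simpa using of_smul_form κ 0 0
  have h' : (leftHom κ).toFun (affineOf κ x) = of CDOGen.wt (CDORel κ) (.vf x) :=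
    congrArg (mk _ _) (freeMap_tree _ _)
  change _ = of CDOGen.wt (CDORel κ) (.vf x) + of CDOGen.wt (CDORel κ) (.form 0)
  rw [h, add_zero, h']

/-- The characterization of the dual embedding `j_R : 𝔤 → D^ch_{G; κ, 1} = T ⊕ Ω`: it is
injective, its composition with the projection to `T` is `i_R`, and `j_L(x)_(n) j_R(y) = 0` in
`D^ch_{G; κ}` for all `n ≥ 0`. -/
structure IsDualEmbedding (κ : LinearMap.BilinForm ℂ (leftInvariantFields A))
    (j : leftInvariantFields A →ₗ[ℂ] Derivation ℂ A A × Ω[A⁄ℂ]) : Prop where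
  injective : Function.Injective j
  proj : ∀ x, (j x).1 = rightField A x
  commute : ∀ (x y : leftInvariantFields A) (n : ℤ), 0 ≤ n →
    nprod n (weightOne κ (leftMap A x)) (weightOne κ (j y)) = 0

end CDO

end

/-! The difficulty is that `ChiralDiffOps κ` is given only by generators and relations, so a priori
it could collapse. Two facts are enough. The first is that its vacuum is nonzero. The second is that
A embeds in it: the kernel of A → `ChiralDiffOps κ` is an ideal stable under the left invariant
fields, and on a connected G such an ideal is 0 or A (`InvariantFrame.eq_bot_or_eq_top`). No further
structure theory of chiral differential operators, and no PBW theorem, is used.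

Nonvanishing comes from a model. The semidirect product of 𝔤 with A, with the form κ, has an affine
Lie algebra. It acts on the module induced from its nonnegative modes, which is divided by the
relations saying that the field of fg is the product of the fields of f and g and that the field of
1 is the identity. The counit shows that the vacuum survives. The fields on this module are mutually
local, so by Dong's lemma and uniqueness of fields their residue products form a vertex algebra. It
satisfies the defining relations because vector fields are A-combinations of an invariant basis, and
the universal property maps `ChiralDiffOps κ` to it, vacuum to vacuum.

The geometry is carried by an invariant frame: a basis x_i of 𝔤, functions t_i with dual
differentials at the unit, and the Maurer–Cartan forms ω_i built from them. Then df = ∑ x_i(f) ω_i,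
so vector fields and forms are expanded in x_i and ω_i with explicit coefficients.

For a vector field D, the condition x_(1)(D, ω) = 0 for all x in 𝔤 prescribes the functions ⟨x, ω⟩,
hence determines ω (`CDO.eq_of_commute`). With D = i_R(y) this defines j_R(y). The remaining product
x_(0) j_R(y) is a form, because i_R(y) commutes with x, and it has zero pairings with 𝔤, so it
vanishes. The same principle gives j_R(y)_(0) j_R(z) = j_R([y, z]), as both sides have the same
vector field and commute with j_L. The product j_R(y)_(1) j_R(z) is a function killed by 𝔤, hence
constant; at the unit it equals -(y, z)_(K) - κ(y, z). The Killing form arises from the term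
-z(x(a)) in x_(1)(a_(-1) z). The universal property of the vacuum module then extends j_R.

For injectivity, words in creation modes of a basis of 𝔤, one for each multiset of letters, span the
vacuum module. Their images are linearly independent: nonnegative modes of functions act on a word
by contracting its letters, up to shorter words, and contracting a leading word with the modes of
the t_i leaves a function whose value at the unit counts matchings. Commutation of the two images
passes from generators to all elements, since the vectors commuting with a given one are closed
under products. -/

noncomputable section

open VertexAlgebra (nprod vac)

/-! ### Binomial sums -/

section BinomialSums

variable {V : Type*} [AddCommGroup V] [Module ℂ V]

/-- `∑_j C(m,j) X_j`, for `X` with finitely many nonzero terms. -/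
def binSum (m : ℤ) (X : ℕ → V) : V := ∑ᶠ j, ((Ring.choose m j : ℤ) : ℂ) • X j

/-- `∑_j (-1)^j C(n,j) X_j`, for `X` with finitely many nonzero terms. -/
def altSum (n : ℤ) (X : ℕ → V) : V :=
  ∑ᶠ j, ((-1 : ℂ) ^ j * ((Ring.choose n j : ℤ) : ℂ)) • X j

/-- Sequences with finitely many nonzero terms. -/
def EventuallyZero (X : ℕ → V) : Prop := ∃ N, ∀ j, N ≤ j → X j = 0

theorem finsum_smul_eq_sum {c : ℕ → ℂ} {X : ℕ → V} {N : ℕ} (h : ∀ j, N ≤ j → X j = 0) :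
    ∑ᶠ j, c j • X j = ∑ j ∈ Finset.range N, c j • X j := by
  refine finsum_eq_sum_of_support_subset _ fun j hj => ?_
  by_contra hj'
  exact hj (by simp [h j (by simpa using hj')])

theorem binSum_eq_sum (m : ℤ) {X : ℕ → V} {N : ℕ} (h : ∀ j, N ≤ j → X j = 0) :
    binSum m X = ∑ j ∈ Finset.range N, ((Ring.choose m j : ℤ) : ℂ) • X j :=
  finsum_smul_eq_sum h

theorem altSum_eq_sum (n : ℤ) {X : ℕ → V} {N : ℕ} (h : ∀ j, N ≤ j → X j = 0) :
    altSum n X =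
      ∑ j ∈ Finset.range N, ((-1 : ℂ) ^ j * ((Ring.choose n j : ℤ) : ℂ)) • X j :=
  finsum_smul_eq_sum h

/-- No finiteness of X is needed, since C(m, j) = 0 for j > m. -/
theorem binSum_of_nonneg (m : ℕ) (X : ℕ → V) :
    binSum (m : ℤ) X = ∑ j ∈ Finset.range (m + 1), ((m.choose j : ℕ) : ℂ) • X j := by
  refine (finsum_eq_sum_of_support_subset _ fun j hj => ?_).trans
    (Finset.sum_congr rfl fun j _ => by rw [Ring.choose_natCast]; simp)
  by_contra hj'
  refine hj ?_
  have : m.choose j = 0 := Nat.choose_eq_zero_of_lt (by simpa [Nat.lt_succ_iff] using hj')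
  simp [Ring.choose_natCast, this]

theorem binSum_zero (X : ℕ → V) : binSum 0 X = X 0 := by
  simpa using binSum_of_nonneg 0 X

theorem binSum_one (X : ℕ → V) : binSum 1 X = X 0 + X 1 := by
  simpa [Finset.sum_range_succ] using binSum_of_nonneg 1 X

theorem altSum_eq_binSum (n : ℤ) (X : ℕ → V) :
    altSum n X = binSum n fun j => (-1 : ℂ) ^ j • X j :=
  finsum_congr fun j => by rw [smul_smul, mul_comm]

theorem altSum_zero (X : ℕ → V) : altSum 0 X = X 0 := by
  simp [altSum_eq_binSum, binSum_zero]

theorem choose_neg_one (j : ℕ) : (Ring.choose (-1 : ℤ) j : ℤ) = (-1) ^ j := by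
  have h := Ring.choose_neg (R := ℤ) 1 j
  rw [h]
  have : (1 + (j : ℤ) - 1) = (j : ℕ) := by ring
  rw [this, Ring.choose_natCast]
  simp [Int.negOnePow_def, Units.smul_def]

/-- (-1)^j C(-1, j) = 1: the expansion of (z - w)^(-1) is the geometric series. -/
theorem altSum_neg_one (X : ℕ → V) : altSum (-1) X = ∑ᶠ j, X j :=
  finsum_congr fun j => by
    rw [choose_neg_one]; push_cast; rw [← mul_pow]; simp

omit [Module ℂ V] in
theorem EventuallyZero.succ {X : ℕ → V} (h : EventuallyZero X) :
    EventuallyZero fun j => X (j + 1) :=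
  h.imp fun _ hN j hj => hN _ (by omega)

omit [Module ℂ V] in
theorem EventuallyZero.of_int {X : ℤ → V} (h : ∃ N : ℤ, ∀ n, N ≤ n → X n = 0) (k : ℤ) :
    EventuallyZero fun j : ℕ => X (k + j) := by
  obtain ⟨N, hN⟩ := h
  exact ⟨(N - k).toNat, fun j hj => hN _ (by omega)⟩

/-- Pascal's rule, which also holds for negative m; finiteness is needed to reindex. This and
`altSum_succ` are the recursions behind the later inductions on exponents. -/
theorem binSum_succ (m : ℤ) {X : ℕ → V} (h : EventuallyZero X) :
    binSum (m + 1) X = binSum m X + binSum m fun j => X (j + 1) := by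
  obtain ⟨N, hN⟩ := h
  rw [binSum_eq_sum _ (N := N + 1) fun j hj => hN j (by omega),
    binSum_eq_sum _ (N := N + 1) fun j hj => hN j (by omega),
    binSum_eq_sum (X := fun j => X (j + 1)) _ (N := N) fun j hj => hN _ (by omega),
    Finset.sum_range_succ', Finset.sum_range_succ' (n := N), add_right_comm,
    ← Finset.sum_add_distrib]
  refine congrArg₂ _ (Finset.sum_congr rfl fun j _ => ?_) (by simp)
  rw [Ring.choose_succ_succ, ← add_smul]
  push_cast
  rw [add_comm]

theorem EventuallyZero.sign {X : ℕ → V} (h : EventuallyZero X) :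
    EventuallyZero fun j => (-1 : ℂ) ^ j • X j :=
  h.imp fun _ hN j hj => by simp [hN j hj]

theorem binSum_smul (m : ℤ) (c : ℂ) (X : ℕ → V) :
    binSum m (fun j => c • X j) = c • binSum m X := by
  rw [binSum, binSum, smul_finsum]
  exact finsum_congr fun j => smul_comm _ _ _

theorem altSum_smul (n : ℤ) (c : ℂ) (X : ℕ → V) :
    altSum n (fun j => c • X j) = c • altSum n X := by
  rw [altSum, altSum, smul_finsum]
  exact finsum_congr fun j => smul_comm _ _ _

theorem altSum_succ (n : ℤ) {X : ℕ → V} (h : EventuallyZero X) :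
    altSum (n + 1) X = altSum n X - altSum n fun j => X (j + 1) := by
  have e : (fun j => (-1 : ℂ) ^ (j + 1) • X (j + 1)) =
      fun j => (-1 : ℂ) • (-1 : ℂ) ^ j • X (j + 1) := by
    ext j; rw [smul_smul, pow_succ']
  rw [altSum_eq_binSum, binSum_succ _ h.sign, e, binSum_smul, altSum_eq_binSum, altSum_eq_binSum]
  module

theorem altSum_add (n : ℤ) {X Y : ℕ → V} (h : EventuallyZero X) (h' : EventuallyZero Y) :
    altSum n (fun j => X j + Y j) = altSum n X + altSum n Y := by
  obtain ⟨N, hN⟩ := h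
  obtain ⟨N', hN'⟩ := h'
  rw [altSum_eq_sum _ (N := max N N') fun j hj => by
      rw [hN j (by omega), hN' j (by omega), add_zero],
    altSum_eq_sum _ (N := max N N') fun j hj => hN j (by omega),
    altSum_eq_sum _ (N := max N N') fun j hj => hN' j (by omega), ← Finset.sum_add_distrib]
  simp

theorem altSum_map {W : Type*} [AddCommGroup W] [Module ℂ W] (f : V →ₗ[ℂ] W) (n : ℤ) {X : ℕ → V}
    (h : EventuallyZero X) : f (altSum n X) = altSum n fun j => f (X j) := by
  obtain ⟨N, hN⟩ := h
  rw [altSum_eq_sum _ hN, altSum_eq_sum _ (N := N) fun j hj => by rw [hN j hj, map_zero]]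
  simp

theorem altSum_mem (S : Submodule ℂ V) (n : ℤ) {X : ℕ → V} (h : ∀ j, X j ∈ S) :
    altSum n X ∈ S :=
  finsum_induction (· ∈ S) S.zero_mem (fun _ _ => S.add_mem) fun j => S.smul_mem _ (h j)

theorem binSum_mem (S : Submodule ℂ V) (n : ℤ) {X : ℕ → V} (h : ∀ j, X j ∈ S) :
    binSum n X ∈ S :=
  finsum_induction (· ∈ S) S.zero_mem (fun _ _ => S.add_mem) fun j => S.smul_mem _ (h j)

theorem altSum_eq_zero (n : ℤ) {X : ℕ → V} (h : ∀ j, X j = 0) : altSum n X = 0 :=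
  (altSum_eq_sum n (N := 0) fun j _ => h j).trans (by simp)

theorem binSum_eq_zero (n : ℤ) {X : ℕ → V} (h : ∀ j, X j = 0) : binSum n X = 0 :=
  (binSum_eq_sum n (N := 0) fun j _ => h j).trans (by simp)

theorem altSum_eq_single (n : ℤ) {X : ℕ → V} (h : ∀ j, X (j + 1) = 0) : altSum n X = X 0 := by
  rw [altSum_eq_sum n (N := 1) fun j hj => by obtain ⟨i, rfl⟩ := Nat.exists_eq_add_of_le' hj; exact h i]
  simp

theorem binSum_eq_single (n : ℤ) {X : ℕ → V} (h : ∀ j, X (j + 1) = 0) : binSum n X = X 0 := by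
  rw [binSum_eq_sum n (N := 1) fun j hj => by obtain ⟨i, rfl⟩ := Nat.exists_eq_add_of_le' hj; exact h i]
  simp

end BinomialSums

/-! ### Consequences of the Borcherds identity -/

namespace VertexAlgebra

variable {V : Type*} [AddCommGroup V] [Module ℂ V] [VertexAlgebra V]

theorem eventuallyZero_nprod (k : ℤ) (a b : V) : EventuallyZero fun j : ℕ => nprod (k + j) a b :=
  EventuallyZero.of_int (X := fun n => nprod n a b) (truncation a b) k

/-- A cut-off beyond all three truncations turns the axiom into an identity of finitely supported
sums, so that consequences of it can be drawn without cut-offs. -/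
theorem borcherds_binSum (a b c : V) (m n k : ℤ) :
    binSum m (fun j => nprod (m + k - j) (nprod (n + j) a b) c) =
      altSum n (fun j => nprod (m + n - j) a (nprod (k + j) b c)) -
        (-1 : ℂ) ^ n • altSum n (fun j => nprod (n + k - j) b (nprod (m + j) a c)) := by
  obtain ⟨N₁, h₁⟩ := eventuallyZero_nprod n a b
  obtain ⟨N₂, h₂⟩ := eventuallyZero_nprod k b c
  obtain ⟨N₃, h₃⟩ := eventuallyZero_nprod m a c
  beta_reduce at h₁ h₂ h₃
  set N := max N₁ (max N₂ N₃)
  have key := borcherds a b c m n k N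
    (fun j hj => by obtain ⟨i, rfl⟩ := Int.eq_ofNat_of_zero_le (a := j) (by omega)
                    exact h₁ i (by omega))
    (fun j hj => by obtain ⟨i, rfl⟩ := Int.eq_ofNat_of_zero_le (a := j) (by omega)
                    exact h₂ i (by omega))
    (fun j hj => by obtain ⟨i, rfl⟩ := Int.eq_ofNat_of_zero_le (a := j) (by omega)
                    exact h₃ i (by omega))
  rw [borcherdsDefect, sub_eq_zero] at key
  rw [binSum_eq_sum _ (N := N) fun j hj => by rw [h₁ j (by omega)]; simp, key,
    altSum_eq_sum _ (N := N) fun j hj => by rw [h₂ j (by omega)]; simp,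
    altSum_eq_sum _ (N := N) fun j hj => by rw [h₃ j (by omega)]; simp,
    Finset.smul_sum, ← Finset.sum_sub_distrib]
  refine Finset.sum_congr rfl fun j _ => ?_
  rw [smul_sub, smul_comm]

/-- The commutator formula. -/
theorem nprod_comm (a b c : V) (m k : ℤ) :
    nprod m a (nprod k b c) = nprod k b (nprod m a c) +
      binSum m fun j => nprod (m + k - j) (nprod j a b) c := by
  have h := borcherds_binSum a b c m 0 k
  simp only [altSum_zero, zpow_zero, one_smul, zero_add, Nat.cast_zero, add_zero, sub_zero] at h
  rw [h]; abel

/-- The associativity formula. -/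
theorem nprod_nprod (a b c : V) (n k : ℤ) :
    nprod k (nprod n a b) c = altSum n (fun j => nprod (n - j) a (nprod (k + j) b c)) -
      (-1 : ℂ) ^ n • altSum n (fun j => nprod (n + k - j) b (nprod j a c)) := by
  simpa [binSum_zero] using borcherds_binSum a b c 0 n k

theorem neg_one_nprod_nprod (a b c : V) (k : ℤ) :
    nprod k (nprod (-1) a b) c = altSum (-1) (fun j => nprod (-1 - j) a (nprod (k + j) b c)) +
      altSum (-1) (fun j => nprod (k - 1 - j) b (nprod j a c)) := by
  rw [nprod_nprod]
  simp only [Int.reduceNeg, zpow_neg, zpow_one, inv_neg, inv_one, neg_smul, one_smul,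
    sub_neg_eq_add, neg_add_eq_sub]

/-- Skew symmetry. -/
theorem nprod_skew (a b : V) (n : ℤ) :
    (-1 : ℂ) ^ n • nprod n b a =
      - binSum (-1) fun j => nprod (-1 - j) (nprod (n + j) a b) vac := by
  -- With c = vac, m = -1, k = 0, the terms with b_(j) vac vanish, and of those with a_(-1+j) vac
  -- only j = 0 remains, which gives b_(n) a.
  have h := borcherds_binSum a b vac (-1) n 0
  rw [altSum_eq_zero, altSum_eq_single] at h
  · simp only [add_zero, CharP.cast_eq_zero, nprod_vac, sub_zero, zero_sub] at h
    rw [h, neg_neg]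
  · intro j
    rw [nprod_vac_of_nonneg _ _ (by push_cast; omega), map_zero]
  · intro j
    rw [nprod_vac_of_nonneg _ _ (by omega), map_zero]

theorem nprod_zero_skew (a b : V) :
    nprod 0 b a = - binSum (-1) fun j : ℕ => nprod (-1 - j) (nprod j a b) vac := by
  simpa using nprod_skew a b 0

end VertexAlgebra

/-! ### Commutants, and spans of creation monomials. -/

namespace VertexAlgebra

variable {V : Type*} [AddCommGroup V] [Module ℂ V] [VertexAlgebra V]

/-- If `u` and `v` commute with `a`, then so does `u_(k) v`. -/
theorem nprod_nprod_eq_zero {a u v : V} (hu : ∀ n : ℤ, 0 ≤ n → nprod n a u = 0)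
    (hv : ∀ n : ℤ, 0 ≤ n → nprod n a v = 0) (k n : ℤ) (hn : 0 ≤ n) :
    nprod n a (nprod k u v) = 0 := by
  rw [nprod_comm, hv n hn, map_zero, zero_add]
  exact binSum_eq_zero _ fun j => by rw [hu j (by omega)]; simp

/-- If `u` and `v` commute with `a`, then so does `u_(k) v`. -/
theorem nprod_nprod_left_eq_zero {a u v : V} (hu : ∀ n : ℤ, 0 ≤ n → nprod n u a = 0)
    (hv : ∀ n : ℤ, 0 ≤ n → nprod n v a = 0) (k n : ℤ) (hn : 0 ≤ n) :
    nprod n (nprod k u v) a = 0 := by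
  rw [nprod_nprod, altSum_eq_zero, altSum_eq_zero, smul_zero, sub_zero]
  · intro j; rw [hu j (by omega), map_zero]
  · intro j; rw [hv _ (by omega), map_zero]

section Monomials

variable {Y : Type*} (wt : Y → ℕ) (g : Y → V)

/-- The monomials `(y_1)_(-1-n_1) … (y_k)_(-1-n_k) 1` of weight `w` in a family of elements. -/
inductive CreationMonomial : ℤ → V → Prop
  | vac : CreationMonomial 0 vac
  | cons (y : Y) (n : ℕ) (w : ℤ) (v : V) : CreationMonomial w v →
      CreationMonomial (w + wt y + n) (nprod (-1 - n) (g y) v)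

/-- The span of the creation monomials of weight `w`. -/
def creationSpan (w : ℤ) : Submodule ℂ V := Submodule.span ℂ {v | CreationMonomial wt g w v}

/-- The span of the generators of weight `w`, and of the vacuum if `w = 0`. -/
def generatorSpan (w : ℤ) : Submodule ℂ V :=
  Submodule.span ℂ ({v | w = 0 ∧ v = vac} ∪ {v | ∃ y, (wt y : ℤ) = w ∧ g y = v})

variable {wt g}

theorem CreationMonomial.nonneg {w : ℤ} {v : V} (h : CreationMonomial wt g w v) : 0 ≤ w := by
  induction h with
  | vac => rfl
  | cons y n w v _ ih => omega

theorem creationSpan_eq_bot {w : ℤ} (h : w < 0) : creationSpan wt g w = ⊥ :=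
  (Submodule.span_eq_bot).2 fun _ hv => absurd hv.nonneg (not_le.2 h)

theorem nprod_neg_mem_creationSpan (y : Y) {w n : ℤ} {v : V} (hn : n < 0)
    (hv : v ∈ creationSpan wt g w) :
    nprod n (g y) v ∈ creationSpan wt g (w + wt y - n - 1) := by
  refine (Submodule.span_le (p := (creationSpan wt g (w + wt y - n - 1)).comap
    (nprod n (g y)))).2 (fun v hv => ?_) hv
  have h := CreationMonomial.cons y (-1 - n).toNat w v hv
  rw [Int.toNat_of_nonneg (by omega), sub_sub_cancel] at h
  rw [show w + wt y - n - 1 = w + wt y + (-1 - n) by ring]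
  exact Submodule.subset_span h

theorem vac_mem_creationSpan : (vac : V) ∈ creationSpan wt g 0 := Submodule.subset_span .vac

theorem generator_mem_creationSpan (y : Y) : g y ∈ creationSpan wt g (wt y) := by
  have h := nprod_neg_mem_creationSpan y (n := -1) (by omega)
    (vac_mem_creationSpan (wt := wt) (g := g))
  rwa [nprod_vac, zero_add, sub_neg_eq_add, add_sub_cancel_right] at h

variable (hg : ∀ y z (n : ℤ), 0 ≤ n →
  nprod n (g y) (g z) ∈ generatorSpan wt g (wt y + wt z - n - 1))

include hg

/-- A negative mode only lengthens the monomial. A nonnegative one is moved to the right; its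
commutator with the first letter involves only the products in `hg`, which are again generators or
the vacuum, so induction on the monomial applies. -/
theorem CreationMonomial.nprod_mem {w : ℤ} {v : V} (h : CreationMonomial wt g w v) (y : Y)
    (n : ℤ) : nprod n (g y) v ∈ creationSpan wt g (w + wt y - n - 1) := by
  induction h generalizing y n with
  | vac =>
    rcases lt_or_ge n 0 with hn | hn
    · exact nprod_neg_mem_creationSpan y hn vac_mem_creationSpan
    · rw [nprod_vac_of_nonneg _ _ hn]; exact zero_mem _
  | cons z k w v hv ih =>
    rcases lt_or_ge n 0 with hn | hn
    · exact nprod_neg_mem_creationSpan y hn (Submodule.subset_span (.cons z k w v hv))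
    · rw [nprod_comm]
      refine add_mem ?_ (binSum_mem _ _ fun j => ?_)
      · convert nprod_neg_mem_creationSpan z (n := -1 - k) (by omega) (ih y n) using 1
        congr 1; ring
      · refine (Submodule.span_le (p := (creationSpan wt g _).comap
          ((nprod (n + (-1 - k) - j)).flip v))).2 (fun u hu => ?_) (hg y z j (by omega))
        rcases hu with ⟨h0, rfl⟩ | ⟨y', hy', rfl⟩
        · change nprod _ VertexAlgebra.vac v ∈ creationSpan wt g _
          rw [vac_nprod]
          split_ifs with h1
          · refine Submodule.subset_span (?_ : CreationMonomial _ _ _ _)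
            convert hv using 1
            omega
          · exact zero_mem _
        · change nprod _ (g y') v ∈ creationSpan wt g _
          convert ih y' (n + (-1 - k) - j) using 1
          congr 1
          omega

theorem nprod_generator_mem_creationSpan (y : Y) (n : ℤ) {w : ℤ} {v : V}
    (hv : v ∈ creationSpan wt g w) : nprod n (g y) v ∈ creationSpan wt g (w + wt y - n - 1) :=
  (Submodule.span_le (p := (creationSpan wt g (w + wt y - n - 1)).comap
    (nprod n (g y)))).2 (fun _ hv => hv.nprod_mem hg y n) hv

/-- The associativity formula rewrites a mode of a monomial through modes of generators. Thus
weights add as they should in everything built from the generators, and by `creationSpan_eq_bot`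
nothing nonzero of negative weight arises. -/
theorem nprod_mem_creationSpan {w w' : ℤ} {u v : V} (n : ℤ) (hu : u ∈ creationSpan wt g w)
    (hv : v ∈ creationSpan wt g w') : nprod n u v ∈ creationSpan wt g (w + w' - n - 1) := by
  refine (Submodule.span_le (p := (creationSpan wt g (w + w' - n - 1)).comap
    ((nprod n).flip v))).2 (fun u₁ hu₁ => ?_) hu
  clear hu
  change nprod n u₁ v ∈ creationSpan wt g _
  induction hu₁ generalizing v w' n with
  | vac =>
    rw [vac_nprod]
    split_ifs with h
    · convert hv using 2; omega
    · exact zero_mem _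
  | cons z k w u₂ hu ih =>
    rw [nprod_nprod]
    refine sub_mem (altSum_mem _ _ fun j => ?_)
      (Submodule.smul_mem _ _ (altSum_mem _ _ fun j => ?_))
    · convert nprod_generator_mem_creationSpan hg z (-1 - k - j)
        (ih (n + j) hv) using 2
      ring
    · convert ih (-1 - k + n - j)
        (nprod_generator_mem_creationSpan hg z j hv) using 2
      ring

end Monomials

end VertexAlgebra

/-! ### The universal property -/

namespace VertexPresentation

variable {X V : Type*} [AddCommGroup V] [Module ℂ V] [VertexAlgebra V]

/-- The value of a formal expression in a vertex algebra. -/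
def FormalExpr.eval (g : X → V) : FormalExpr X → V
  | .vac => VertexAlgebra.vac
  | .gen x => g x
  | .node n s t => nprod n (s.eval g) (t.eval g)

/-- The value of a linear combination of formal expressions in a vertex algebra. -/
def freeEval (g : X → V) : Free X →ₗ[ℂ] V := Finsupp.lift V ℂ (FormalExpr X) (FormalExpr.eval g)

@[simp] theorem freeEval_tree (g : X → V) (t : FormalExpr X) : freeEval g (tree t) = t.eval g := by
  simp [freeEval, tree]

@[simp] theorem freeEval_gen (g : X → V) (x : X) : freeEval g (gen x) = g x := freeEval_tree g _

@[simp] theorem freeEval_one (g : X → V) : freeEval g one = vac := freeEval_tree g _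

@[simp] theorem freeEval_mul (g : X → V) (n : ℤ) (u v : Free X) :
    freeEval g (mul n u v) = nprod n (freeEval g u) (freeEval g v) := by
  induction u using induct with
  | h0 => simp
  | hadd u u' hu hu' => simp [hu, hu']
  | hs c s =>
    induction v using induct with
    | h0 => simp
    | hadd u u' hu hu' => rw [map_add, map_add, map_add, map_add, hu, hu']
    | hs d t => simp [FormalExpr.eval]

theorem freeEval_defect (g : X → V) (m n k : ℤ) (N : ℕ) (a b c : Free X) :
    freeEval g (borcherdsDefect mul m n k N a b c) =
      borcherdsDefect nprod m n k N (freeEval g a) (freeEval g b) (freeEval g c) := by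
  simp [borcherdsDefect]

variable {wt : X → ℕ} {R : Free X → Prop}

/-- The Borcherds relations are imposed with cut-offs computed from weights. It is `hneg` that makes
these cut-offs legitimate in V. -/
theorem freeEval_rel {g : X → V} (hR : ∀ r, R r → freeEval g r = 0)
    (hneg : ∀ t : FormalExpr X, t.deg wt < 0 → t.eval g = 0) {r : Free X} (hr : Rel wt R r) :
    freeEval g r = 0 := by
  induction hr with
  | base r h => exact hR r h
  | neg t h => simp [hneg t h]
  | vac_mul n t => split_ifs with h <;> simp [VertexAlgebra.vac_nprod, h]
  | mul_vac t => simp [VertexAlgebra.nprod_vac]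
  | mul_vac_of_nonneg n t h => simp [VertexAlgebra.nprod_vac_of_nonneg _ _ h]
  | borcherds s t u m n k N h₁ h₂ h₃ =>
    rw [freeEval_defect]
    refine VertexAlgebra.borcherds _ _ _ _ _ _ _ (fun j hj => ?_) (fun j hj => ?_)
      (fun j hj => ?_)
    · simpa [FormalExpr.eval] using hneg (.node (n + j) s t) (by simp only [FormalExpr.deg]; omega)
    · simpa [FormalExpr.eval] using hneg (.node (k + j) t u) (by simp only [FormalExpr.deg]; omega)
    · simpa [FormalExpr.eval] using hneg (.node (m + j) s u) (by simp only [FormalExpr.deg]; omega)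
  | mul_left n t r _ ih => simp [ih]
  | mul_right n t r _ ih => simp [ih]

/-- The universal property of the graded vertex algebra given by generators and relations. -/
def envelopeLift (g : X → V) (hR : ∀ r, R r → freeEval g r = 0)
    (hneg : ∀ t : FormalExpr X, t.deg wt < 0 → t.eval g = 0) :
    VertexAlgebraHom (Envelope wt R) V where
  toFun := (ideal wt R).liftQ (freeEval g) (Submodule.span_le.2 fun _ hr => freeEval_rel hR hneg hr)
  map_vac := freeEval_one g
  map_nprod n a b := by
    obtain ⟨u, rfl⟩ := mk_surjective a
    obtain ⟨v, rfl⟩ := mk_surjective b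
    exact freeEval_mul g n u v

theorem envelopeLift_of (g : X → V) (hR : ∀ r, R r → freeEval g r = 0)
    (hneg : ∀ t : FormalExpr X, t.deg wt < 0 → t.eval g = 0) (x : X) :
    (envelopeLift g hR hneg).toFun (of wt R x) = g x := freeEval_gen g x

/-- Expressions in elements of a graded span have no component of negative weight. -/
theorem eval_eq_zero_of_deg_neg {Y : Type*} {wt' : Y → ℕ} {g' : Y → V}
    (hg' : ∀ y z (n : ℤ), 0 ≤ n →
      nprod n (g' y) (g' z) ∈ VertexAlgebra.generatorSpan wt' g' (wt' y + wt' z - n - 1))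
    {g : X → V} (hg : ∀ x, g x ∈ VertexAlgebra.creationSpan wt' g' (wt x))
    (t : FormalExpr X) (ht : t.deg wt < 0) : t.eval g = 0 := by
  suffices h : ∀ t : FormalExpr X, t.eval g ∈ VertexAlgebra.creationSpan wt' g' (t.deg wt) by
    have := h t
    rwa [VertexAlgebra.creationSpan_eq_bot ht, Submodule.mem_bot] at this
  intro t
  induction t with
  | vac => exact VertexAlgebra.vac_mem_creationSpan
  | gen x => exact hg x
  | node n s t hs ht => exact VertexAlgebra.nprod_mem_creationSpan hg' n hs ht

/-- A subspace of the envelope that contains the vacuum and the generators and is closed under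
the products is everything. -/
theorem envelope_induction (S : Submodule ℂ (Envelope wt R)) (hvac : vac ∈ S)
    (hof : ∀ x, of wt R x ∈ S) (hmul : ∀ n u v, u ∈ S → v ∈ S → nprod n u v ∈ S)
    (u : Envelope wt R) : u ∈ S := by
  obtain ⟨u, rfl⟩ := mk_surjective u
  induction u using induct with
  | h0 => simp
  | hadd u v hu hv => rw [map_add]; exact add_mem hu hv
  | hs c t =>
    rw [map_smul]
    refine S.smul_mem c ?_
    induction t with
    | vac => exact hvac
    | gen x => exact hof x
    | node n s t hs ht =>
      rw [← mul_tree]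
      exact hmul n _ _ hs ht

theorem envelope_hom_ext {J J' : VertexAlgebraHom (Envelope wt R) V}
    (h : ∀ x, J.toFun (of wt R x) = J'.toFun (of wt R x)) : J = J' := by
  refine VertexAlgebraHom.ext (LinearMap.ext fun u => ?_)
  refine envelope_induction (LinearMap.eqLocus J.toFun J'.toFun) ?_ h (fun n u v hu hv => ?_) u
  · exact J.map_vac.trans J'.map_vac.symm
  · rw [LinearMap.mem_eqLocus] at hu hv ⊢
    rw [J.map_nprod, J'.map_nprod, hu, hv]

variable (wt R) in
/-- The component of weight `k` of the envelope. -/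
def weightSpace (k : ℤ) : Submodule ℂ (Envelope wt R) :=
  Submodule.span ℂ {u | ∃ t : FormalExpr X, t.deg wt = k ∧ mk wt R (tree t) = u}

theorem of_mem_weightSpace (x : X) : of wt R x ∈ weightSpace wt R (wt x) :=
  Submodule.subset_span ⟨.gen x, rfl, rfl⟩

theorem nprod_mem_weightSpace (n : ℤ) {k l : ℤ} {u v : Envelope wt R}
    (hu : u ∈ weightSpace wt R k) (hv : v ∈ weightSpace wt R l) :
    nprod n u v ∈ weightSpace wt R (k + l - n - 1) := by
  refine (Submodule.span_le (p := (weightSpace wt R (k + l - n - 1)).comap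
    ((nprod n).flip v))).2 ?_ hu
  rintro _ ⟨s, hs, rfl⟩
  refine (Submodule.span_le (p := (weightSpace wt R (k + l - n - 1)).comap
    (nprod n (mk wt R (tree s))))).2 ?_ hv
  rintro _ ⟨t, ht, rfl⟩
  exact Submodule.subset_span ⟨.node n s t, by rw [FormalExpr.deg, hs, ht],
    congrArg _ (mul_tree n s t).symm⟩

theorem weightSpace_eq_bot {k : ℤ} (h : k < 0) : weightSpace wt R k = ⊥ := by
  refine Submodule.span_eq_bot.2 ?_
  rintro _ ⟨t, ht, rfl⟩
  exact mk_rel (.neg t (by omega))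

/-- The product has weight k + l - n - 1 < 0. -/
theorem nprod_eq_zero_of_weight {n k l : ℤ} {u v : Envelope wt R}
    (hu : u ∈ weightSpace wt R k) (hv : v ∈ weightSpace wt R l) (h : k + l ≤ n) :
    nprod n u v = 0 := by
  have := nprod_mem_weightSpace n hu hv
  rwa [weightSpace_eq_bot (by omega), Submodule.mem_bot] at this

end VertexPresentation

/-! ### Expansions of two-variable distributions -/

section Expansion

variable {M : Type*} [AddCommGroup M] [Module ℂ M]

/-- The operator `X(p, q) ↦ X(p + 1, q) - X(p, q + 1)`, multiplication by the difference of the two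
formal variables. -/
def shiftDiff : Module.End ℂ (ℤ → ℤ → M) where
  toFun X p q := X (p + 1) q - X p (q + 1)
  map_add' X Y := by ext; simp only [Pi.add_apply]; abel
  map_smul' c X := by ext; simp only [Pi.smul_apply, RingHom.id_apply, smul_sub]

theorem shiftDiff_apply (X : ℤ → ℤ → M) (p q : ℤ) :
    shiftDiff X p q = X (p + 1) q - X p (q + 1) := rfl

/-- Finiteness needed to expand in the domain where the first variable is large. -/
def LeftExpandable (X : ℤ → ℤ → M) : Prop :=
  ∀ p q, EventuallyZero fun j : ℕ => X (p - j) (q + j)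

/-- Finiteness needed to expand in the domain where the second variable is large. -/
def RightExpandable (X : ℤ → ℤ → M) : Prop :=
  ∀ p q, EventuallyZero fun j : ℕ => X (p + j) (q - j)

/-- The residue in the first variable of the product with `(z - w)^n`, expanded for
`|z| > |w|`. -/
def leftExpand (n : ℤ) (X : ℤ → ℤ → M) (q : ℤ) : M := altSum n fun j => X (n - j) (q + j)

/-- The residue in the first variable of the product with `(z - w)^n`, expanded for
`|w| > |z|`. -/
def rightExpand (n : ℤ) (X : ℤ → ℤ → M) (q : ℤ) : M :=
  (-1 : ℂ) ^ n • altSum n fun j => X j (n + q - j)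

theorem altSum_sub (n : ℤ) {X Y : ℕ → M} (h : EventuallyZero X) (h' : EventuallyZero Y) :
    altSum n (fun j => X j - Y j) = altSum n X - altSum n Y := by
  have h'' : EventuallyZero fun j => (-1 : ℂ) • Y j := h'.imp fun _ hN j hj => by simp [hN j hj]
  have := altSum_add n h h''
  rw [altSum_smul] at this
  simpa [sub_eq_add_neg] using this

omit [Module ℂ M] in
theorem EventuallyZero.sub {X Y : ℕ → M} (h : EventuallyZero X) (h' : EventuallyZero Y) :
    EventuallyZero fun j => X j - Y j := by
  obtain ⟨N, hN⟩ := h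
  obtain ⟨N', hN'⟩ := h'
  exact ⟨max N N', fun j hj => by
    simp only [hN j (by omega), hN' j (by omega), sub_zero]⟩

theorem LeftExpandable.shiftDiff {X : ℤ → ℤ → M} (h : LeftExpandable X) :
    LeftExpandable (shiftDiff X) := fun p q => by
  convert (h (p + 1) q).sub (h p (q + 1)) using 2 with j
  rw [shiftDiff_apply, sub_add_eq_add_sub, add_right_comm]

theorem RightExpandable.shiftDiff {X : ℤ → ℤ → M} (h : RightExpandable X) :
    RightExpandable (shiftDiff X) := fun p q => by
  convert (h (p + 1) q).sub (h p (q + 1)) using 2 with j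
  rw [shiftDiff_apply, sub_add_eq_add_sub, add_right_comm]

/-- On series this is (z - w)^(n+1) = (z - w)^n (z - w); on coefficients it is `altSum_succ`. -/
theorem leftExpand_succ {X : ℤ → ℤ → M} (h : LeftExpandable X) (n q : ℤ) :
    leftExpand (n + 1) X q = leftExpand n (shiftDiff X) q := by
  rw [leftExpand, altSum_succ n (h (n + 1) q), ← altSum_sub n (h (n + 1) q) (h (n + 1) q).succ]
  refine congrArg _ (funext fun j => ?_)
  rw [shiftDiff_apply]
  congr 2 <;> push_cast <;> ring

theorem rightExpand_succ {X : ℤ → ℤ → M} (h : RightExpandable X) (n q : ℤ) :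
    rightExpand (n + 1) X q = rightExpand n (shiftDiff X) q := by
  have h₀ : EventuallyZero fun j : ℕ => X j (n + 1 + q - j) := by simpa using h 0 (n + 1 + q)
  rw [rightExpand, altSum_succ n h₀, ← altSum_sub n h₀ h₀.succ, zpow_add₀ (by norm_num), zpow_one,
    mul_neg_one, neg_smul, ← smul_neg, rightExpand, ← neg_one_smul ℂ (altSum _ _), ← altSum_smul]
  refine congrArg _ (congrArg _ (funext fun j => ?_))
  rw [shiftDiff_apply, neg_one_smul, neg_sub]
  congr 2 <;> push_cast <;> ring

theorem leftExpand_zero (X : ℤ → ℤ → M) (q : ℤ) : leftExpand 0 X q = X 0 q := by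
  simp [leftExpand, altSum_zero]

theorem rightExpand_zero (X : ℤ → ℤ → M) (q : ℤ) : rightExpand 0 X q = X 0 q := by
  simp [rightExpand, altSum_zero]

theorem LeftExpandable.shiftDiff_pow {X : ℤ → ℤ → M} (h : LeftExpandable X) (N : ℕ) :
    LeftExpandable ((_root_.shiftDiff ^ N) X) := by
  induction N with
  | zero => simpa
  | succ N ih => rw [pow_succ', Module.End.mul_apply]; exact ih.shiftDiff

theorem RightExpandable.shiftDiff_pow {X : ℤ → ℤ → M} (h : RightExpandable X) (N : ℕ) :
    RightExpandable ((_root_.shiftDiff ^ N) X) := by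
  induction N with
  | zero => simpa
  | succ N ih => rw [pow_succ', Module.End.mul_apply]; exact ih.shiftDiff

theorem leftExpand_add {X : ℤ → ℤ → M} (h : LeftExpandable X) (n : ℤ) (N : ℕ) (q : ℤ) :
    leftExpand (n + N) X q = leftExpand n ((shiftDiff ^ N) X) q := by
  induction N generalizing n with
  | zero => simp
  | succ N ih =>
    rw [pow_succ', Module.End.mul_apply, ← leftExpand_succ (h.shiftDiff_pow N), ← ih]
    push_cast
    congr 1
    ring

theorem rightExpand_add {X : ℤ → ℤ → M} (h : RightExpandable X) (n : ℤ) (N : ℕ) (q : ℤ) :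
    rightExpand (n + N) X q = rightExpand n ((shiftDiff ^ N) X) q := by
  induction N generalizing n with
  | zero => simp
  | succ N ih =>
    rw [pow_succ', Module.End.mul_apply, ← rightExpand_succ (h.shiftDiff_pow N), ← ih]
    push_cast
    congr 1
    ring

/-- For n ≥ N ≥ 0 the factor (z - w)^n is a polynomial, so both expansions are honest multiplication
by it, and it kills X - Y. -/
theorem leftExpand_sub_rightExpand_eq_zero {X Y : ℤ → ℤ → M} (hX : LeftExpandable X)
    (hY : RightExpandable Y) {N : ℕ} (h : (shiftDiff ^ N) (X - Y) = 0) {n : ℤ} (hn : N ≤ n)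
    (q : ℤ) : leftExpand n X q - rightExpand n Y q = 0 := by
  obtain ⟨i, rfl⟩ := Int.eq_ofNat_of_zero_le (a := n) (by omega)
  obtain ⟨i, rfl⟩ := Nat.exists_eq_add_of_le' (m := N) (n := i) (by omega)
  have h' : (shiftDiff ^ (i + N)) (X - Y) = 0 := by
    rw [pow_add, Module.End.mul_apply, h, map_zero]
  have e := congrFun (congrFun h' 0) q
  rw [map_sub, Pi.sub_apply, Pi.sub_apply] at e
  rw [← zero_add ((i + N : ℕ) : ℤ), leftExpand_add hX, rightExpand_add hY, leftExpand_zero,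
    rightExpand_zero, e]
  rfl

/-- Multiplication by a power of the difference of the variables is injective on series that are
bounded below in the second variable. -/
theorem eq_zero_of_shiftDiff_pow_eq_zero {X : ℤ → ℤ → M} {R : ℤ} (hX : ∀ p q, R ≤ q → X p q = 0)
    {N : ℕ} (h : (shiftDiff ^ N) X = 0) : X = 0 := by
  induction N generalizing X with
  | zero => simpa using h
  | succ N ih =>
    rw [pow_succ, Module.End.mul_apply] at h
    have h' := ih (fun p q hq => by
      rw [shiftDiff_apply, hX _ _ hq, hX _ _ (by omega), sub_zero]) h
    -- A series killed by z - w depends on p + q only, so each coefficient equals one whose second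
    -- index is at least R.
    have key : ∀ i : ℕ, ∀ p q, X p q = X (p - i) (q + i) := by
      intro i
      induction i with
      | zero => simp
      | succ i ih' =>
        intro p q
        have := congrFun (congrFun h' (p - i - 1)) (q + i)
        rw [shiftDiff_apply, Pi.zero_apply, Pi.zero_apply, sub_eq_zero, sub_add_cancel] at this
        rw [ih', this]
        push_cast
        congr 1 <;> ring
    ext p q
    rw [key (R - q).toNat, hX _ _ (by omega)]
    rfl

end Expansion

/-! ### Fields on a vector space -/

section Fields

variable (M : Type*) [AddCommGroup M] [Module ℂ M]

/-- The space of fields `a(z) = ∑ a_n z^(-n-1)` on `M`: for every `v` one has `a_n v = 0` for `n`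
large. -/
def quantumFields : Submodule ℂ (ℤ → M →ₗ[ℂ] M) where
  carrier := {a | ∀ v, ∃ N : ℤ, ∀ n, N ≤ n → a n v = 0}
  add_mem' := by
    intro a b ha hb v
    obtain ⟨N, hN⟩ := ha v
    obtain ⟨N', hN'⟩ := hb v
    refine ⟨max N N', fun n hn => ?_⟩
    rw [Pi.add_apply, LinearMap.add_apply, hN n (by omega), hN' n (by omega), add_zero]
  zero_mem' := fun v => ⟨0, fun n _ => rfl⟩
  smul_mem' := by
    intro c a ha v
    obtain ⟨N, hN⟩ := ha v
    exact ⟨N, fun n hn => by rw [Pi.smul_apply, LinearMap.smul_apply, hN n hn, smul_zero]⟩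

variable {M}

/-- The modes of a field. -/
instance : CoeFun (quantumFields M) fun _ => ℤ → M →ₗ[ℂ] M := ⟨Subtype.val⟩

namespace QuantumField

@[ext] theorem ext' {a b : quantumFields M} (h : ∀ n v, a n v = b n v) : a = b :=
  Subtype.ext (funext fun n => LinearMap.ext (h n))

@[simp] theorem add_apply (a b : quantumFields M) (n : ℤ) (v : M) :
    (a + b : quantumFields M) n v = a n v + b n v := rfl

@[simp] theorem sub_apply (a b : quantumFields M) (n : ℤ) (v : M) :
    (a - b : quantumFields M) n v = a n v - b n v := rfl

@[simp] theorem smul_apply (c : ℂ) (a : quantumFields M) (n : ℤ) (v : M) :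
    (c • a : quantumFields M) n v = c • a n v := rfl

/-- The distribution `a(z) b(w) v`. -/
def compose (a b : ℤ → M →ₗ[ℂ] M) (v : M) (p q : ℤ) : M := a p (b q v)

/-- The distribution `b(w) a(z) v`. -/
def composeRev (a b : ℤ → M →ₗ[ℂ] M) (v : M) (p q : ℤ) : M := b q (a p v)

theorem compose_leftExpandable (a : ℤ → M →ₗ[ℂ] M) (b : quantumFields M) (v : M) :
    LeftExpandable (compose a b v) := fun p q => by
  obtain ⟨N, hN⟩ := b.2 v
  exact ⟨(N - q).toNat, fun j hj => by simp only [compose, hN _ (show N ≤ q + j by omega), map_zero]⟩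

theorem composeRev_rightExpandable (a : quantumFields M) (b : ℤ → M →ₗ[ℂ] M) (v : M) :
    RightExpandable (composeRev a b v) := fun p q => by
  obtain ⟨N, hN⟩ := a.2 v
  exact ⟨(N - p).toNat, fun j hj => by simp only [composeRev, hN _ (show N ≤ p + j by omega), map_zero]⟩

theorem altSum_linear (n : ℤ) {X : ℕ → M →ₗ[ℂ] M} (h : ∀ v, EventuallyZero fun j => X j v) :
    ∃ f : M →ₗ[ℂ] M, ∀ v, f v = altSum n fun j => X j v :=
  ⟨{ toFun v := altSum n fun j => X j v
     map_add' v w := by simp only [map_add]; exact altSum_add n (h v) (h w)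
     map_smul' c v := by simp only [map_smul]; exact altSum_smul n c _ }, fun _ => rfl⟩

/-- The residue product `a_(n) b` of two fields. -/
def prod (n : ℤ) (a b : quantumFields M) : quantumFields M :=
  ⟨fun k =>
    { toFun v := leftExpand n (compose a b v) k - rightExpand n (composeRev a b v) k
      map_add' v w := by
        obtain ⟨f, hf⟩ := altSum_linear n (X := fun j => a (n - j) ∘ₗ b (k + j)) fun v =>
          compose_leftExpandable a b v n k
        obtain ⟨g, hg⟩ := altSum_linear n (X := fun j => b (n + k - j) ∘ₗ a j) fun v => by
          simpa [composeRev] using composeRev_rightExpandable a b v 0 (n + k)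
        have e : ∀ v, leftExpand n (compose a b v) k - rightExpand n (composeRev a b v) k =
            f v - (-1 : ℂ) ^ n • g v := fun v => by rw [hf, hg]; rfl
        rw [e, e, e, map_add, map_add, smul_add]
        abel
      map_smul' c v := by
        have e : ∀ X : ℕ → M →ₗ[ℂ] M, altSum n (fun j => X j (c • v)) =
            c • altSum n fun j => X j v := fun X => by simp only [map_smul, altSum_smul]
        have e₁ := e fun j => a (n - j) ∘ₗ b (k + j)
        have e₂ := e fun j => b (n + k - j) ∘ₗ a j
        simp only [LinearMap.comp_apply] at e₁ e₂
        simp only [leftExpand, rightExpand, compose, composeRev, RingHom.id_apply, smul_sub, e₁,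
          e₂]
        rw [smul_comm c] },
  fun v => by
    obtain ⟨N, hN⟩ := b.2 v
    obtain ⟨N', hN'⟩ := a.2 v
    have : ∀ j : ℕ, ∃ K : ℤ, ∀ i, K ≤ i → b i (a j v) = 0 := fun j => b.2 _
    choose K hK using this
    -- Only the finitely many j with 0 ≤ j < N' have a_j v ≠ 0, so the bounds K j that matter have a
    -- common upper bound.
    obtain ⟨B, hB⟩ : ∃ B : ℤ, ∀ j ∈ Finset.range N'.toNat, K j ≤ B := by
      obtain ⟨B, hB⟩ := ((Finset.range N'.toNat).image K).bddAbove
      exact ⟨B, fun j hj => hB (by simpa using ⟨j, by simpa using hj, rfl⟩)⟩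
    refine ⟨max N (B + N' - n), fun k hk => ?_⟩
    change leftExpand n (compose a b v) k - rightExpand n (composeRev a b v) k = 0
    rw [leftExpand, rightExpand, altSum_eq_zero, altSum_eq_zero, smul_zero, sub_zero]
    · intro j
      rcases lt_or_ge (j : ℤ) N' with hj | hj
      · exact hK _ _ (by have := hB j (by simp; omega); omega)
      · rw [composeRev, hN' _ hj, map_zero]
    · intro j
      rw [compose, hN _ (by omega), map_zero]⟩

theorem prod_apply (n : ℤ) (a b : quantumFields M) (k : ℤ) (v : M) :
    prod n a b k v = leftExpand n (compose a b v) k - rightExpand n (composeRev a b v) k := rfl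

theorem prod_add_left (n : ℤ) (a a' b : quantumFields M) :
    prod n (a + a') b = prod n a b + prod n a' b := by
  ext k v
  rw [add_apply, prod_apply, prod_apply, prod_apply]
  have e₁ := altSum_add n (compose_leftExpandable a b v n k) (compose_leftExpandable a' b v n k)
  have e₂ := altSum_add n (composeRev_rightExpandable a b v 0 (n + k))
    (composeRev_rightExpandable a' b v 0 (n + k))
  simp only [leftExpand, rightExpand, compose, composeRev, add_apply, map_add, zero_add] at e₁ e₂ ⊢
  rw [e₁, e₂, smul_add]
  abel

theorem prod_add_right (n : ℤ) (a b b' : quantumFields M) :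
    prod n a (b + b') = prod n a b + prod n a b' := by
  ext k v
  rw [add_apply, prod_apply, prod_apply, prod_apply]
  have e₁ := altSum_add n (compose_leftExpandable a b v n k) (compose_leftExpandable a b' v n k)
  have e₂ := altSum_add n (composeRev_rightExpandable a b v 0 (n + k))
    (composeRev_rightExpandable a b' v 0 (n + k))
  simp only [leftExpand, rightExpand, compose, composeRev, add_apply, map_add, zero_add] at e₁ e₂ ⊢
  rw [e₁, e₂, smul_add]
  abel

theorem prod_smul_left (n : ℤ) (c : ℂ) (a b : quantumFields M) :
    prod n (c • a) b = c • prod n a b := by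
  ext k v
  rw [smul_apply, prod_apply, prod_apply]
  simp only [leftExpand, rightExpand, compose, composeRev, smul_apply, map_smul, altSum_smul,
    smul_sub]
  rw [smul_comm c]

theorem prod_smul_right (n : ℤ) (c : ℂ) (a b : quantumFields M) :
    prod n a (c • b) = c • prod n a b := by
  ext k v
  rw [smul_apply, prod_apply, prod_apply]
  simp only [leftExpand, rightExpand, compose, composeRev, smul_apply, map_smul, altSum_smul,
    smul_sub]
  rw [smul_comm c]

/-- The residue product as a bilinear map. -/
def prodₗ (n : ℤ) : quantumFields M →ₗ[ℂ] quantumFields M →ₗ[ℂ] quantumFields M :=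
  LinearMap.mk₂ ℂ (prod n) (prod_add_left n) (prod_smul_left n) (prod_add_right n)
    (fun c a b => prod_smul_right n c a b)

/-! ### Locality -/

/-- Mutual locality of `a` and `b`. -/
def IsLocal (a b : ℤ → M →ₗ[ℂ] M) : Prop :=
  ∃ N : ℕ, ∀ v, (shiftDiff ^ N) (compose a b v - composeRev a b v) = 0

theorem shiftDiff_pow_swap (N : ℕ) (X : ℤ → ℤ → M) :
    (shiftDiff ^ N) (fun p q => X q p) = fun p q => (-1 : ℂ) ^ N • (shiftDiff ^ N) X q p := by
  induction N generalizing X with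
  | zero => simp
  | succ N ih =>
    have e : shiftDiff (fun p q => X q p) = -(fun p q => (shiftDiff X) q p) := by
      ext p q; simp only [shiftDiff_apply, Pi.neg_apply]; abel
    rw [pow_succ, Module.End.mul_apply, e, map_neg, ih]
    ext p q
    simp only [Pi.neg_apply, Module.End.mul_apply, pow_succ, mul_neg_one, neg_smul]

theorem IsLocal.symm {a b : ℤ → M →ₗ[ℂ] M} (h : IsLocal a b) : IsLocal b a := by
  refine h.imp fun N hN v => ?_
  have e : compose b a v - composeRev b a v =
      -(fun p q => (compose a b v - composeRev a b v) q p) := by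
    ext p q; simp [compose, composeRev]
  rw [e, map_neg, shiftDiff_pow_swap, hN]
  ext p q; simp

theorem shiftDiff_pow_eq_zero_of_le {N N' : ℕ} (h : N ≤ N') {X : ℤ → ℤ → M}
    (hX : (shiftDiff ^ N) X = 0) : (shiftDiff ^ N') X = 0 := by
  obtain ⟨i, rfl⟩ := Nat.exists_eq_add_of_le' h
  rw [pow_add, Module.End.mul_apply, hX, map_zero]

theorem IsLocal.add {a a' b : quantumFields M} (h : IsLocal a b) (h' : IsLocal a' b) :
    IsLocal (a + a' : quantumFields M) b := by
  obtain ⟨N, hN⟩ := h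
  obtain ⟨N', hN'⟩ := h'
  refine ⟨max N N', fun v => ?_⟩
  have e : compose (a + a' : quantumFields M) b v - composeRev (a + a' : quantumFields M) b v =
      (compose a b v - composeRev a b v) + (compose a' b v - composeRev a' b v) := by
    ext p q; simp only [compose, composeRev, Pi.sub_apply, Pi.add_apply, add_apply, map_add]; abel
  rw [e, map_add, shiftDiff_pow_eq_zero_of_le (le_max_left _ _) (hN v),
    shiftDiff_pow_eq_zero_of_le (le_max_right _ _) (hN' v), add_zero]

theorem IsLocal.smul {a b : quantumFields M} (c : ℂ) (h : IsLocal a b) :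
    IsLocal (c • a : quantumFields M) b := by
  refine h.imp fun N hN v => ?_
  have e : compose (c • a : quantumFields M) b v - composeRev (c • a : quantumFields M) b v =
      c • (compose a b v - composeRev a b v) := by
    ext p q
    simp only [compose, composeRev, Pi.sub_apply, Pi.smul_apply, smul_apply, map_smul, smul_sub]
  rw [e, map_smul, hN, smul_zero]

theorem IsLocal.zero (b : quantumFields M) : IsLocal (0 : quantumFields M) b :=
  ⟨0, fun v => by ext p q; simp [compose, composeRev]⟩

/-! ### The Borcherds identity for a local pair -/

/-- The distribution `X(p, q)` with the first index shifted by `m`. -/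
def shiftFst (m : ℤ) (X : ℤ → ℤ → M) (p q : ℤ) : M := X (m + p) q

theorem shiftDiff_pow_shiftFst (m : ℤ) (N : ℕ) (X : ℤ → ℤ → M) :
    (shiftDiff ^ N) (shiftFst m X) = shiftFst m ((shiftDiff ^ N) X) := by
  induction N generalizing X with
  | zero => rfl
  | succ N ih =>
    have e : shiftDiff (shiftFst m X) = shiftFst m (shiftDiff X) := by
      ext p q; simp only [shiftDiff_apply, shiftFst, add_assoc]
    rw [pow_succ, Module.End.mul_apply, e, ih]
    rfl

/-- The right hand side of the Borcherds identity for fields. -/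
def borcherdsRight (a b : ℤ → M →ₗ[ℂ] M) (v : M) (m n k : ℤ) : M :=
  altSum n (fun j => a (m + n - j) (b (k + j) v)) -
    (-1 : ℂ) ^ n • altSum n (fun j => b (n + k - j) (a (m + j) v))

theorem borcherdsRight_eq (a b : ℤ → M →ₗ[ℂ] M) (v : M) (m n k : ℤ) :
    borcherdsRight a b v m n k = leftExpand n (shiftFst m (compose a b v)) k -
      rightExpand n (shiftFst m (composeRev a b v)) k := by
  simp only [borcherdsRight, leftExpand, rightExpand, shiftFst, compose, composeRev, add_sub_assoc]

omit [Module ℂ M] in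
theorem _root_.LeftExpandable.shiftFst {X : ℤ → ℤ → M} (h : LeftExpandable X) (m : ℤ) :
    LeftExpandable (shiftFst m X) := fun p q => by
  simpa only [QuantumField.shiftFst, add_sub_assoc] using h (m + p) q

omit [Module ℂ M] in
theorem _root_.RightExpandable.shiftFst {X : ℤ → ℤ → M} (h : RightExpandable X) (m : ℤ) :
    RightExpandable (shiftFst m X) := fun p q => by
  simpa only [QuantumField.shiftFst, add_assoc] using h (m + p) q

/-- The coefficient form of (z - w)^(n+1) = (z - w)^n (z - w). The left side of the Borcherds
identity obeys the same recursion, which lets the identity spread from m = 0, where it is the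
definition of `prod`, to all m. -/
theorem borcherdsRight_succ (a b : quantumFields M) (v : M) (m n k : ℤ) :
    borcherdsRight a b v m (n + 1) k =
      borcherdsRight a b v (m + 1) n k - borcherdsRight a b v m n (k + 1) := by
  have hX := (compose_leftExpandable a b v).shiftFst m n k
  have hX' := ((compose_leftExpandable a b v).shiftFst m) (n + 1) k
  have h₀ : EventuallyZero fun j : ℕ => b (n + 1 + k - j) (a (m + j) v) := by
    simpa [composeRev] using (composeRev_rightExpandable a b v) m (n + 1 + k)
  have h₁ : EventuallyZero fun j : ℕ => a (m + (n + 1) - j) (b (k + j) v) := by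
    simpa [shiftFst, compose, add_sub_assoc] using hX'
  have e₁ : (fun j : ℕ => a (m + (n + 1) - ((j + 1 : ℕ) : ℤ)) (b (k + ((j + 1 : ℕ) : ℤ)) v)) =
      fun j : ℕ => a (m + n - j) (b (k + 1 + j) v) := by
    ext j
    rw [show m + (n + 1) - ((j + 1 : ℕ) : ℤ) = m + n - j by push_cast; ring,
      show k + ((j + 1 : ℕ) : ℤ) = k + 1 + j by push_cast; ring]
  have e₂ : (fun j : ℕ => b (n + 1 + k - ((j + 1 : ℕ) : ℤ)) (a (m + ((j + 1 : ℕ) : ℤ)) v)) =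
      fun j : ℕ => b (n + k - j) (a (m + 1 + j) v) := by
    ext j
    rw [show n + 1 + k - ((j + 1 : ℕ) : ℤ) = n + k - j by push_cast; ring,
      show m + ((j + 1 : ℕ) : ℤ) = m + 1 + j by push_cast; ring]
  simp only [borcherdsRight]
  rw [altSum_succ n h₁, altSum_succ n h₀, e₁, e₂, zpow_add₀ (by norm_num), zpow_one,
    show m + 1 + n = m + (n + 1) by ring, show n + (k + 1) = n + 1 + k by ring]
  module

theorem borcherdsRight_eq_zero {a b : quantumFields M} {N : ℕ}
    (h : ∀ v, (shiftDiff ^ N) (compose a b v - composeRev a b v) = 0) (v : M) (m : ℤ) {n : ℤ}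
    (hn : N ≤ n) (k : ℤ) : borcherdsRight a b v m n k = 0 := by
  rw [borcherdsRight_eq]
  refine leftExpand_sub_rightExpand_eq_zero ((compose_leftExpandable a b v).shiftFst m)
    ((composeRev_rightExpandable a b v).shiftFst m) (N := N) ?_ hn k
  change (shiftDiff ^ N) (shiftFst m (compose a b v - composeRev a b v)) = 0
  rw [shiftDiff_pow_shiftFst, h]
  rfl

theorem prod_eq_borcherdsRight (a b : quantumFields M) (v : M) (n k : ℤ) :
    prod n a b k v = borcherdsRight a b v 0 n k := by
  rw [borcherdsRight_eq, prod_apply]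
  have : ∀ X : ℤ → ℤ → M, shiftFst 0 X = X := fun X => by ext p q; simp [shiftFst]
  rw [this, this]

theorem exists_prod_eq_zero {a b : quantumFields M} (h : IsLocal a b) :
    ∃ N : ℕ, ∀ n : ℤ, N ≤ n → prod n a b = 0 := by
  obtain ⟨N, hN⟩ := h
  refine ⟨N, fun n hn => ?_⟩
  ext k v
  rw [prod_eq_borcherdsRight, borcherdsRight_eq_zero hN v 0 hn]
  rfl

/-- The Borcherds identity for the residue products of two mutually local fields, applied to a
vector. -/
theorem borcherds_of_isLocal {a b : quantumFields M} (h : IsLocal a b) (v : M) (m n k : ℤ) :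
    binSum m (fun j => prod (n + j) a b (m + k - j) v) = borcherdsRight a b v m n k := by
  obtain ⟨N, hN⟩ := h
  have hzero : ∀ n : ℤ, N ≤ n → prod n a b = 0 := fun n hn => by
    ext k v
    rw [prod_eq_borcherdsRight, borcherdsRight_eq_zero hN v 0 hn]
    rfl
  have hev : ∀ n l : ℤ, EventuallyZero fun j : ℕ => prod (n + j) a b (l - j) v := fun n l =>
    ⟨(N - n).toNat, fun j hj => by
      beta_reduce; rw [hzero _ (by omega)]; rfl⟩
  set L : ℤ → ℤ → ℤ → M := fun m n k => binSum m fun j : ℕ => prod (n + j) a b (m + k - j) v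
  have hL : ∀ m n k, L (m + 1) n k = L m (n + 1) k + L m n (k + 1) := by
    intro m n k
    simp only [L]
    rw [binSum_succ m (hev n (m + 1 + k)), add_comm]
    refine congrArg₂ _ (congrArg _ (funext fun j => ?_)) (congrArg _ (funext fun j => ?_))
    · push_cast
      rw [show n + ((j : ℤ) + 1) = n + 1 + j by ring,
        show m + 1 + k - ((j : ℤ) + 1) = m + k - j by ring]
    · rw [show m + 1 + k = m + (k + 1) by ring]
  change L m n k = _
  induction m using Int.induction_on generalizing n k with
  | zero => simp only [L, binSum_zero]; simp [prod_eq_borcherdsRight]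
  | succ m ih =>
    rw [hL, ih, ih, borcherdsRight_succ]
    abel
  | pred m ih =>
    -- Downwards in m the recursion reads L(m, n, k) = L(m + 1, n, k - 1) - L(m, n + 1, k - 1), so a
    -- second, descending induction on n is needed. It starts at n ≥ N, where both sides vanish by
    -- locality.
    have hlarge : ∀ n : ℤ, N ≤ n → ∀ k, L (-m - 1) n k = borcherdsRight a b v (-m - 1) n k := by
      intro n hn k
      rw [borcherdsRight_eq_zero hN v _ hn]
      exact binSum_eq_zero _ fun j => by rw [hzero _ (by omega)]; rfl
    have hdown : ∀ i : ℕ, ∀ n : ℤ, N - i ≤ n → ∀ k,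
        L (-m - 1) n k = borcherdsRight a b v (-m - 1) n k := by
      intro i
      induction i with
      | zero => exact fun n hn k => hlarge n (by simpa using hn) k
      | succ i ihi =>
        intro n hn k
        have e₁ := hL (-m - 1) n (k - 1)
        have e₂ := borcherdsRight_succ a b v (-m - 1) n (k - 1)
        rw [sub_add_cancel, sub_add_cancel] at e₁ e₂
        rw [ih, ihi (n + 1) (by push_cast at hn; omega)] at e₁
        rw [e₂] at e₁
        rw [eq_comm, ← sub_eq_zero]
        rw [← sub_eq_zero] at e₁
        rw [← e₁]
        abel
    exact hdown (N - n).toNat n (by omega) k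

end QuantumField

end Fields

namespace QuantumField

/-! ### Dong's lemma -/

section Dong

variable {M : Type*} [AddCommGroup M] [Module ℂ M]

/-- Multiplication of a three-variable distribution by `z₁ - z₂`. -/
def shiftDiff₁₂ : Module.End ℂ (ℤ → ℤ → ℤ → M) where
  toFun X p q r := X (p + 1) q r - X p (q + 1) r
  map_add' X Y := by ext; simp only [Pi.add_apply]; abel
  map_smul' c X := by ext; simp only [Pi.smul_apply, RingHom.id_apply, smul_sub]

/-- Multiplication of a three-variable distribution by `z₁ - z₃`. -/
def shiftDiff₁₃ : Module.End ℂ (ℤ → ℤ → ℤ → M) where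
  toFun X p q r := X (p + 1) q r - X p q (r + 1)
  map_add' X Y := by ext; simp only [Pi.add_apply]; abel
  map_smul' c X := by ext; simp only [Pi.smul_apply, RingHom.id_apply, smul_sub]

/-- Multiplication of a three-variable distribution by `z₂ - z₃`. -/
def shiftDiff₂₃ : Module.End ℂ (ℤ → ℤ → ℤ → M) where
  toFun X p q r := X p (q + 1) r - X p q (r + 1)
  map_add' X Y := by ext; simp only [Pi.add_apply]; abel
  map_smul' c X := by ext; simp only [Pi.smul_apply, RingHom.id_apply, smul_sub]

theorem shiftDiff₂₃_eq : (shiftDiff₂₃ : Module.End ℂ (ℤ → ℤ → ℤ → M)) =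
    shiftDiff₁₃ - shiftDiff₁₂ := by
  ext X p q r
  simp [shiftDiff₂₃, shiftDiff₁₃, shiftDiff₁₂]

theorem commute_shiftDiff₁₂_shiftDiff₁₃ :
    Commute (shiftDiff₁₂ : Module.End ℂ (ℤ → ℤ → ℤ → M)) shiftDiff₁₃ := by
  ext X p q r
  simp only [shiftDiff₁₃, shiftDiff₁₂, Module.End.mul_apply, LinearMap.coe_mk, AddHom.coe_mk]
  abel

theorem commute_shiftDiff₁₃_shiftDiff₂₃ :
    Commute (shiftDiff₁₃ : Module.End ℂ (ℤ → ℤ → ℤ → M)) shiftDiff₂₃ := by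
  rw [shiftDiff₂₃_eq]
  exact (Commute.refl _).sub_right commute_shiftDiff₁₂_shiftDiff₁₃.symm

theorem commute_shiftDiff₁₂_shiftDiff₂₃ :
    Commute (shiftDiff₁₂ : Module.End ℂ (ℤ → ℤ → ℤ → M)) shiftDiff₂₃ := by
  rw [shiftDiff₂₃_eq]
  exact commute_shiftDiff₁₂_shiftDiff₁₃.sub_right (Commute.refl _)

theorem shiftDiff₁₂_pow_apply (N : ℕ) (X : ℤ → ℤ → ℤ → M) (p q r : ℤ) :
    (shiftDiff₁₂ ^ N) X p q r = (shiftDiff ^ N) (fun p q => X p q r) p q := by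
  induction N generalizing X with
  | zero => rfl
  | succ N ih => rw [pow_succ, Module.End.mul_apply, ih]; rfl

theorem shiftDiff₁₃_pow_apply (N : ℕ) (X : ℤ → ℤ → ℤ → M) (p q r : ℤ) :
    (shiftDiff₁₃ ^ N) X p q r = (shiftDiff ^ N) (fun p r => X p q r) p r := by
  induction N generalizing X with
  | zero => rfl
  | succ N ih => rw [pow_succ, Module.End.mul_apply, ih]; rfl

theorem shiftDiff₂₃_pow_apply (N : ℕ) (X : ℤ → ℤ → ℤ → M) (p q r : ℤ) :
    (shiftDiff₂₃ ^ N) X p q r = (shiftDiff ^ N) (fun q r => X p q r) q r := by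
  induction N generalizing X with
  | zero => rfl
  | succ N ih => rw [pow_succ, Module.End.mul_apply, ih]; rfl

theorem shiftDiff_pow_map {M' : Type*} [AddCommGroup M'] [Module ℂ M'] (f : M →ₗ[ℂ] M') (N : ℕ)
    (X : ℤ → ℤ → M) :
    (shiftDiff ^ N) (fun p q => f (X p q)) = fun p q => f ((shiftDiff ^ N) X p q) := by
  induction N generalizing X with
  | zero => rfl
  | succ N ih =>
    have : shiftDiff (fun p q => f (X p q)) = fun p q => f (shiftDiff X p q) := by
      ext p q; simp only [shiftDiff_apply, map_sub]
    rw [pow_succ, Module.End.mul_apply, this, ih]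
    rfl

/-- Pairs of three-variable distributions whose residue product in the first two variables is
defined. -/
def Expandable (Z : ℤ → ℤ → ℤ → M × M) : Prop :=
  ∀ r, LeftExpandable (fun p q => (Z p q r).1) ∧ RightExpandable (fun p q => (Z p q r).2)

/-- The residue product in the first two variables. -/
def residue (n : ℤ) (Z : ℤ → ℤ → ℤ → M × M) (q r : ℤ) : M :=
  leftExpand n (fun p q => (Z p q r).1) q - rightExpand n (fun p q => (Z p q r).2) q

omit [Module ℂ M] in
theorem _root_.LeftExpandable.sub {X Y : ℤ → ℤ → M} (h : LeftExpandable X)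
    (h' : LeftExpandable Y) : LeftExpandable fun p q => X p q - Y p q :=
  fun p q => (h p q).sub (h' p q)

omit [Module ℂ M] in
theorem _root_.RightExpandable.sub {X Y : ℤ → ℤ → M} (h : RightExpandable X)
    (h' : RightExpandable Y) : RightExpandable fun p q => X p q - Y p q :=
  fun p q => (h p q).sub (h' p q)

theorem Expandable.shiftDiff₁₂ {Z : ℤ → ℤ → ℤ → M × M} (h : Expandable Z) :
    Expandable (shiftDiff₁₂ Z) := fun r => ⟨(h r).1.shiftDiff, (h r).2.shiftDiff⟩

theorem Expandable.shiftDiff₁₃ {Z : ℤ → ℤ → ℤ → M × M} (h : Expandable Z) :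
    Expandable (shiftDiff₁₃ Z) := fun r =>
  ⟨LeftExpandable.sub (fun p q => by simpa [sub_add_eq_add_sub] using (h r).1 (p + 1) q)
      (h (r + 1)).1,
    RightExpandable.sub (fun p q => by simpa [add_right_comm] using (h r).2 (p + 1) q)
      (h (r + 1)).2⟩

omit [Module ℂ M] in
theorem Expandable.sub {Z Z' : ℤ → ℤ → ℤ → M × M} (h : Expandable Z) (h' : Expandable Z') :
    Expandable (Z - Z') := fun r => ⟨(h r).1.sub (h' r).1, (h r).2.sub (h' r).2⟩

theorem Expandable.shiftDiff₂₃ {Z : ℤ → ℤ → ℤ → M × M} (h : Expandable Z) :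
    Expandable (shiftDiff₂₃ Z) := by
  rw [shiftDiff₂₃_eq]
  exact h.shiftDiff₁₃.sub h.shiftDiff₁₂

theorem Expandable.pow {Z : ℤ → ℤ → ℤ → M × M} (h : Expandable Z)
    {T : Module.End ℂ (ℤ → ℤ → ℤ → M × M)} (hT : ∀ Z, Expandable Z → Expandable (T Z)) (N : ℕ) :
    Expandable ((T ^ N) Z) := by
  induction N with
  | zero => exact h
  | succ N ih => rw [pow_succ', Module.End.mul_apply]; exact hT _ ih

theorem residue_sub (n : ℤ) {Z Z' : ℤ → ℤ → ℤ → M × M} (h : Expandable Z) (h' : Expandable Z') :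
    residue n (Z - Z') = residue n Z - residue n Z' := by
  ext q r
  simp only [residue, leftExpand, rightExpand, Pi.sub_apply, Prod.fst_sub, Prod.snd_sub]
  rw [altSum_sub n ((h r).1 n q) ((h' r).1 n q), altSum_sub n (X := fun j : ℕ => (Z j (n + q - j) r).2)
    (by simpa using (h r).2 0 (n + q)) (by simpa using (h' r).2 0 (n + q)), smul_sub]
  abel

theorem shiftDiff_residue (n : ℤ) {Z : ℤ → ℤ → ℤ → M × M} (h : Expandable Z) :
    shiftDiff (residue n Z) = residue n (shiftDiff₂₃ Z) := by
  have e : shiftDiff₂₃ Z = (fun p q r => Z p (q + 1) r) - fun p q r => Z p q (r + 1) := rfl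
  rw [e, residue_sub]
  · ext q r
    simp only [shiftDiff_apply, Pi.sub_apply, residue, leftExpand, rightExpand]
    simp only [add_right_comm q 1, ← add_sub_right_comm, ← add_assoc]
  · refine fun r => ⟨fun p q => ?_, fun p q => ?_⟩
    · simpa [add_right_comm] using (h r).1 p (q + 1)
    · simpa [sub_add_eq_add_sub] using (h r).2 p (q + 1)
  · exact fun r => h (r + 1)

theorem shiftDiff_pow_residue (n : ℤ) {Z : ℤ → ℤ → ℤ → M × M} (h : Expandable Z) (K : ℕ) :
    (shiftDiff ^ K) (residue n Z) = residue n ((shiftDiff₂₃ ^ K) Z) := by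
  induction K with
  | zero => rfl
  | succ K ih =>
    rw [pow_succ', Module.End.mul_apply, ih,
      shiftDiff_residue n (h.pow (fun _ h => h.shiftDiff₂₃) K), ← Module.End.mul_apply, ← pow_succ']

/-- Multiplication by (z₁ - z₂)^i raises the exponent n of the residue product to n + i. Once this
reaches the order N of locality, the two expansions cancel. -/
theorem residue_shiftDiff₁₂_eq_zero {n : ℤ} {Z : ℤ → ℤ → ℤ → M × M} (h : Expandable Z) {N i : ℕ}
    (hN : (shiftDiff₁₂ ^ N) (fun p q r => (Z p q r).1 - (Z p q r).2) = 0) (hi : N ≤ n + i) :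
    residue n ((shiftDiff₁₂ ^ i) Z) = 0 := by
  ext q r
  have e₁ : (fun p q => ((shiftDiff₁₂ ^ i) Z p q r).1) =
      (shiftDiff ^ i) fun p q => (Z p q r).1 := by
    ext p q
    rw [shiftDiff₁₂_pow_apply]
    exact (congrFun (congrFun (shiftDiff_pow_map (LinearMap.fst ℂ M M) i
      fun p q => Z p q r) p) q).symm
  have e₂ : (fun p q => ((shiftDiff₁₂ ^ i) Z p q r).2) =
      (shiftDiff ^ i) fun p q => (Z p q r).2 := by
    ext p q
    rw [shiftDiff₁₂_pow_apply]
    exact (congrFun (congrFun (shiftDiff_pow_map (LinearMap.snd ℂ M M) i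
      fun p q => Z p q r) p) q).symm
  rw [residue, e₁, e₂, ← leftExpand_add (h r).1, ← rightExpand_add (h r).2]
  refine leftExpand_sub_rightExpand_eq_zero (h r).1 (h r).2 (N := N) ?_ hi q
  ext p q
  exact (shiftDiff₁₂_pow_apply N _ p q r).symm.trans (by rw [hN])

/-- The heart of Dong's lemma. Keep N factors z₂ - z₃ aside and expand the other N + (N - n) of them
by z₂ - z₃ = (z₁ - z₃) - (z₁ - z₂). In each term either z₁ - z₃ occurs at least N times, and `h₁₃`
applies together with the factors kept aside, or z₁ - z₂ occurs often enough to push the exponent of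
the residue product past N. -/
theorem shiftDiff_pow_residue_eq_zero (n : ℤ) {Z : ℤ → ℤ → ℤ → M × M} (h : Expandable Z) {N : ℕ}
    (h₁₂ : (shiftDiff₁₂ ^ N) (fun p q r => (Z p q r).1 - (Z p q r).2) = 0)
    (h₁₃ : (shiftDiff₁₃ ^ N) ((shiftDiff₂₃ ^ N) Z) = 0) :
    (shiftDiff ^ (2 * N + (N - n).toNat)) (residue n Z) = 0 := by
  -- Here t counts the factors z₂ - z₃ still to be expanded, while s and i count the factors z₁ - z₃
  -- and z₁ - z₂ already produced.
  have claim : ∀ t s i : ℕ, N + (N - n).toNat ≤ t + s + i →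
      residue n ((shiftDiff₂₃ ^ t) ((shiftDiff₁₃ ^ s) ((shiftDiff₁₂ ^ i)
        ((shiftDiff₂₃ ^ N) Z)))) = 0 := by
    intro t
    induction t with
    | zero =>
      intro s i hsi
      rw [pow_zero, Module.End.one_apply]
      rcases le_or_gt N s with hs | hs
      · obtain ⟨s, rfl⟩ := Nat.exists_eq_add_of_le' hs
        have : (shiftDiff₁₃ ^ (s + N)) ((shiftDiff₁₂ ^ i) ((shiftDiff₂₃ ^ N) Z)) = 0 := by
          rw [← Module.End.mul_apply, ← (commute_shiftDiff₁₂_shiftDiff₁₃.pow_pow i (s + N)).eq,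
            Module.End.mul_apply, pow_add, Module.End.mul_apply, h₁₃, map_zero, map_zero]
        rw [this]
        ext q r
        simp only [residue, leftExpand, rightExpand, Pi.zero_apply, Prod.fst_zero, Prod.snd_zero]
        rw [altSum_eq_zero _ fun _ => rfl, smul_zero, sub_zero]
      · rw [← Module.End.mul_apply, ← (commute_shiftDiff₁₂_shiftDiff₁₃.pow_pow i s).eq,
          Module.End.mul_apply]
        refine residue_shiftDiff₁₂_eq_zero (N := N) ((h.pow (fun _ h => h.shiftDiff₂₃) N).pow
          (fun _ h => h.shiftDiff₁₃) s) ?_ (by omega)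
        set D : M × M →ₗ[ℂ] M := LinearMap.fst ℂ M M - LinearMap.snd ℂ M M
        have eD : ∀ Z : ℤ → ℤ → ℤ → M × M, (fun p q r => (Z p q r).1 - (Z p q r).2) =
          fun p q r => D (Z p q r) := fun _ => rfl
        have e₁ : ∀ Z : ℤ → ℤ → ℤ → M × M, (fun p q r => D ((shiftDiff₁₃ ^ s) Z p q r)) =
            (shiftDiff₁₃ ^ s) fun p q r => D (Z p q r) := by
          intro Z; ext p q r
          rw [shiftDiff₁₃_pow_apply, shiftDiff₁₃_pow_apply, shiftDiff_pow_map]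
        have e₂ : ∀ Z : ℤ → ℤ → ℤ → M × M, (fun p q r => D ((shiftDiff₂₃ ^ N) Z p q r)) =
            (shiftDiff₂₃ ^ N) fun p q r => D (Z p q r) := by
          intro Z; ext p q r
          rw [shiftDiff₂₃_pow_apply, shiftDiff₂₃_pow_apply, shiftDiff_pow_map]
        rw [eD, e₁, e₂, ← Module.End.mul_apply,
          (commute_shiftDiff₁₂_shiftDiff₁₃.pow_pow N s).eq, Module.End.mul_apply,
          ← Module.End.mul_apply (shiftDiff₁₂ ^ N),
          (commute_shiftDiff₁₂_shiftDiff₂₃.pow_pow N N).eq, Module.End.mul_apply, ← eD, h₁₂,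
          map_zero, map_zero]
    | succ t ih =>
      intro s i hsi
      have h' := h.pow (fun _ h => h.shiftDiff₂₃) N
      have good : ∀ s i : ℕ, Expandable ((shiftDiff₂₃ ^ t) ((shiftDiff₁₃ ^ s) ((shiftDiff₁₂ ^ i)
          ((shiftDiff₂₃ ^ N) Z)))) := fun s i =>
        ((h'.pow (fun _ h => h.shiftDiff₁₂) i).pow (fun _ h => h.shiftDiff₁₃) s).pow
          (fun _ h => h.shiftDiff₂₃) t
      rw [pow_succ, Module.End.mul_apply, shiftDiff₂₃_eq, LinearMap.sub_apply, ← shiftDiff₂₃_eq,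
        map_sub, ← Module.End.mul_apply shiftDiff₁₃, ← pow_succ',
        ← Module.End.mul_apply shiftDiff₁₂, (commute_shiftDiff₁₂_shiftDiff₁₃.pow_right s).eq,
        Module.End.mul_apply, ← Module.End.mul_apply shiftDiff₁₂, ← pow_succ',
        residue_sub n (good _ _) (good _ _), ih _ _ (by omega), ih _ _ (by omega), sub_zero]
  rw [shiftDiff_pow_residue n h, show 2 * N + (N - n).toNat = (N + (N - n).toNat) + N by ring,
    pow_add, Module.End.mul_apply]
  exact claim _ 0 0 (by omega)

/-- Dong's lemma. -/
theorem IsLocal.prod {a b c : quantumFields M} (hab : IsLocal a b) (hac : IsLocal a c)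
    (hbc : IsLocal b c) (n : ℤ) : IsLocal (prod n a b) c := by
  obtain ⟨N₁, h₁⟩ := hab
  obtain ⟨N₂, h₂⟩ := hac
  obtain ⟨N₃, h₃⟩ := hbc
  set N := max N₁ (max N₂ N₃)
  replace h₁ : ∀ v, (shiftDiff ^ N) (fun p q => a p (b q v) - b q (a p v)) = 0 := fun v =>
    shiftDiff_pow_eq_zero_of_le (by omega) (h₁ v)
  replace h₂ : ∀ v, (shiftDiff ^ N) (fun p q => a p (c q v) - c q (a p v)) = 0 := fun v =>
    shiftDiff_pow_eq_zero_of_le (by omega) (h₂ v)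
  replace h₃ : ∀ v, (shiftDiff ^ N) (fun p q => b p (c q v) - c q (b p v)) = 0 := fun v =>
    shiftDiff_pow_eq_zero_of_le (by omega) (h₃ v)
  refine ⟨2 * N + (N - n).toNat, fun v => ?_⟩
  -- The commutator with c(z₃) of the two orderings a(z₁) b(z₂) and b(z₂) a(z₁), kept as a pair
  -- because the residue product expands them in different domains.
  set Z : ℤ → ℤ → ℤ → M × M := fun p q r =>
    (a p (b q (c r v)) - c r (a p (b q v)), b q (a p (c r v)) - c r (b q (a p v)))
  have hl : ∀ r, LeftExpandable fun p q => c r (a p (b q v)) := fun r p q =>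
    (compose_leftExpandable a b v p q).imp fun N hN j hj => by
      have := hN j hj
      simp only [compose] at this
      simp only [this, map_zero]
  have hr : ∀ r, RightExpandable fun p q => c r (b q (a p v)) := fun r p q =>
    (composeRev_rightExpandable a b v p q).imp fun N hN j hj => by
      have := hN j hj
      simp only [composeRev] at this
      simp only [this, map_zero]
  have hZ : Expandable Z := fun r =>
    ⟨(compose_leftExpandable a b (c r v)).sub (hl r),
      (composeRev_rightExpandable a b (c r v)).sub (hr r)⟩
  have hres : compose (QuantumField.prod n a b) c v - composeRev (QuantumField.prod n a b) c v =
      residue n Z := by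
    ext q r
    have e₁ := altSum_map (c r) n (compose_leftExpandable a b v n q)
    have e₂ := altSum_map (c r) n (X := fun j : ℕ => b (n + q - j) (a j v))
      (by simpa [composeRev] using composeRev_rightExpandable a b v 0 (n + q))
    simp only [compose] at e₁
    simp only [Pi.sub_apply, compose, composeRev, prod_apply, residue, leftExpand, rightExpand, Z,
      map_sub, map_smul, e₁, e₂]
    have e₃ := altSum_sub n (compose_leftExpandable a b (c r v) n q) (hl r n q)
    have e₄ := altSum_sub n (X := fun j : ℕ => b (n + q - j) (a j (c r v)))
      (by simpa [composeRev] using composeRev_rightExpandable a b (c r v) 0 (n + q))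
      (by simpa using hr r 0 (n + q))
    simp only [compose] at e₃
    rw [e₃, e₄, smul_sub]
    abel
  rw [hres]
  refine shiftDiff_pow_residue_eq_zero n hZ ?_ ?_
  · ext p q r
    have e : (fun p q => (Z p q r).1 - (Z p q r).2) =
        (fun p q => a p (b q (c r v)) - b q (a p (c r v))) -
          fun p q => c r (a p (b q v) - b q (a p v)) := by
      ext p q; simp only [Z, Pi.sub_apply, map_sub]; abel
    rw [shiftDiff₁₂_pow_apply, e, map_sub, h₁, shiftDiff_pow_map, h₁]
    simp
  -- Pass c through one factor at a time: the first summand contains only commutators of b and c,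
  -- hence is killed by (z₂ - z₃)^N, and the second only commutators of a and c, killed by (z₁ -
  -- z₃)^N.
  · have e : Z = (fun p q r => LinearMap.inl ℂ M M (a p (b q (c r v) - c r (b q v))) +
          LinearMap.inr ℂ M M (b q (c r (a p v)) - c r (b q (a p v)))) +
        fun p q r => LinearMap.inl ℂ M M (a p (c r (b q v)) - c r (a p (b q v))) +
          LinearMap.inr ℂ M M (b q (a p (c r v) - c r (a p v))) := by
      ext p q r <;> simp [Z]
    have z₁ : (shiftDiff₂₃ ^ N) (fun p q r =>
        LinearMap.inl ℂ M M (a p (b q (c r v) - c r (b q v))) +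
          LinearMap.inr ℂ M M (b q (c r (a p v)) - c r (b q (a p v)))) = 0 := by
      funext p q r
      rw [shiftDiff₂₃_pow_apply]
      change (shiftDiff ^ N) ((fun q r => (LinearMap.inl ℂ M M ∘ₗ a p)
        (b q (c r v) - c r (b q v))) + fun q r => LinearMap.inr ℂ M M
          (b q (c r (a p v)) - c r (b q (a p v)))) q r = 0
      rw [map_add, shiftDiff_pow_map, shiftDiff_pow_map, h₃, h₃]
      simp
    have z₂ : (shiftDiff₁₃ ^ N) (fun p q r =>
        LinearMap.inl ℂ M M (a p (c r (b q v)) - c r (a p (b q v))) +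
          LinearMap.inr ℂ M M (b q (a p (c r v) - c r (a p v)))) = 0 := by
      funext p q r
      rw [shiftDiff₁₃_pow_apply]
      change (shiftDiff ^ N) ((fun p r => LinearMap.inl ℂ M M
        (a p (c r (b q v)) - c r (a p (b q v)))) + fun p r => (LinearMap.inr ℂ M M ∘ₗ b q)
          (a p (c r v) - c r (a p v))) p r = 0
      rw [map_add, shiftDiff_pow_map, shiftDiff_pow_map, h₂, h₂]
      simp
    rw [e, map_add, z₁, zero_add, ← Module.End.mul_apply,
      (commute_shiftDiff₁₃_shiftDiff₂₃.pow_pow N N).eq, Module.End.mul_apply, z₂, map_zero]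

end Dong

end QuantumField

namespace QuantumField

variable {M : Type*} [AddCommGroup M] [Module ℂ M]

/-! ### The identity field and derivatives of fields -/

variable (M) in
/-- The identity field. -/
def identity : quantumFields M :=
  ⟨fun n => if n = -1 then LinearMap.id else 0,
    fun v => ⟨0, fun n hn => by simp only [if_neg (show n ≠ -1 by omega), LinearMap.zero_apply]⟩⟩

theorem identity_apply (n : ℤ) (v : M) : identity M n v = if n = -1 then v else 0 := by
  change (if n = -1 then LinearMap.id else 0 : M →ₗ[ℂ] M) v = _
  split_ifs <;> rfl

theorem isLocal_identity (a : quantumFields M) : IsLocal (identity M) a :=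
  ⟨0, fun v => by
    ext p q
    simp only [pow_zero, Module.End.one_apply, Pi.sub_apply, compose, composeRev, identity_apply]
    split_ifs <;> simp⟩

/-- The derivative `∂_z a(z)`. -/
def deriv : quantumFields M →ₗ[ℂ] quantumFields M where
  toFun a := ⟨fun n => (-n : ℂ) • a (n - 1), fun v => by
    obtain ⟨N, hN⟩ := a.2 v
    exact ⟨N + 1, fun n hn => by rw [LinearMap.smul_apply, hN _ (by omega), smul_zero]⟩⟩
  map_add' a b := by ext n v; exact smul_add _ _ _
  map_smul' c a := by ext n v; exact smul_comm _ _ _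

theorem deriv_apply (a : quantumFields M) (n : ℤ) (v : M) :
    deriv a n v = (-n : ℂ) • a (n - 1) v := rfl

theorem succ_mul_choose (n : ℤ) (j : ℕ) :
    ((j : ℤ) + 1) * Ring.choose n (j + 1) = (n - j) * Ring.choose n j := by
  have h := Ring.choose_smul_choose n (n := j + 1) (k := j) (Nat.le_succ j)
  rw [Nat.choose_succ_self_right, Nat.add_sub_cancel_left, Ring.choose_one_right] at h
  simpa [mul_comm] using h

/-- Summation by parts, from (j + 1) C(n, j + 1) = (n - j) C(n, j). -/
theorem altSum_deriv (n : ℤ) {X : ℕ → M} (h : EventuallyZero X) :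
    altSum n (fun j => ((n : ℂ) - j) • X (j + 1)) = - altSum n fun j => (j : ℂ) • X j := by
  obtain ⟨N, hN⟩ := h
  rw [altSum_eq_sum n (N := N) fun j hj => by rw [hN _ (by omega), smul_zero],
    altSum_eq_sum n (N := N + 1) fun j hj => by rw [hN _ (by omega), smul_zero],
    Finset.sum_range_succ', Nat.cast_zero, zero_smul, smul_zero, add_zero,
    ← Finset.sum_neg_distrib]
  refine Finset.sum_congr rfl fun j _ => ?_
  have e : ((j : ℂ) + 1) * (Ring.choose n (j + 1) : ℤ) = ((n : ℂ) - j) * (Ring.choose n j : ℤ) := by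
    exact_mod_cast succ_mul_choose n j
  rw [smul_smul, smul_smul, ← neg_smul]
  congr 1
  push_cast
  rw [pow_succ]
  linear_combination -(-1 : ℂ) ^ j * e

theorem _root_.EventuallyZero.smul {X : ℕ → M} (h : EventuallyZero X) (c : ℕ → ℂ) :
    EventuallyZero fun j => c j • X j :=
  h.imp fun _ hN j hj => by simp only [hN j hj, smul_zero]

/-- The residue of a total z-derivative vanishes and (∂_z + ∂_w)(z - w)^n = 0, so ∂_w distributes
over the two factors. On coefficients this is `altSum_deriv`, applied once to each expansion. -/
theorem deriv_prod (n : ℤ) (a b : quantumFields M) :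
    deriv (prod n a b) = prod n (deriv a) b + prod n a (deriv b) := by
  ext k v
  rw [deriv_apply, add_apply, prod_apply, prod_apply, prod_apply]
  simp only [leftExpand, rightExpand, compose, composeRev, deriv_apply, map_smul]
  have hX : EventuallyZero fun j : ℕ => a (n - j) (b (k - 1 + j) v) :=
    compose_leftExpandable a b v n (k - 1)
  have hX' : EventuallyZero fun j : ℕ => a (n - j - 1) (b (k + j) v) := by
    have := compose_leftExpandable a b v (n - 1) k
    simpa only [compose, sub_right_comm] using this
  have hZ : EventuallyZero fun j : ℕ => b (n + k - j) (a (j - 1) v) := by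
    have := composeRev_rightExpandable a b v (-1) (n + k)
    simpa only [composeRev, neg_add_eq_sub] using this
  have e₁ := altSum_deriv n hX
  have e₂ := altSum_deriv n hZ
  have s₁ : ∀ j : ℕ, a (n - ((j + 1 : ℕ) : ℤ)) (b (k - 1 + ((j + 1 : ℕ) : ℤ)) v) =
      a (n - j - 1) (b (k + j) v) := fun j => by
    rw [show n - ((j + 1 : ℕ) : ℤ) = n - j - 1 by push_cast; ring,
      show k - 1 + ((j + 1 : ℕ) : ℤ) = k + j by push_cast; ring]
  have s₂ : ∀ j : ℕ, b (n + k - ((j + 1 : ℕ) : ℤ)) (a (((j + 1 : ℕ) : ℤ) - 1) v) =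
      b (n + k - j - 1) (a j v) := fun j => by
    rw [show n + k - ((j + 1 : ℕ) : ℤ) = n + k - j - 1 by push_cast; ring,
      show ((j + 1 : ℕ) : ℤ) - 1 = j by push_cast; ring]
  simp only [s₁, s₂] at e₁ e₂
  have t₁ : altSum n (fun j : ℕ => (-((n - j : ℤ) : ℂ)) • a (n - j - 1) (b (k + j) v)) =
      altSum n fun j : ℕ => (j : ℂ) • a (n - j) (b (k - 1 + j) v) := by
    rw [← neg_inj, ← e₁, ← neg_one_smul ℂ (altSum _ _), ← altSum_smul]
    refine congrArg _ (funext fun j => ?_)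
    rw [smul_smul]; congr 1; push_cast; ring
  have t₂ : altSum n (fun j : ℕ => (-(j : ℤ) : ℂ) • b (n + k - j) (a (j - 1) v)) =
      altSum n fun j : ℕ => ((n : ℂ) - j) • b (n + k - j - 1) (a j v) := by
    rw [e₂, ← neg_one_smul ℂ (altSum _ _), ← altSum_smul]
    refine congrArg _ (funext fun j => ?_)
    rw [smul_smul]; congr 1; push_cast; ring
  have hY : EventuallyZero fun j : ℕ => b (n + k - j - 1) (a j v) := by
    have := hZ.succ
    simpa only [s₂] using this
  rw [t₁, t₂]
  have u₁ : altSum n (fun j : ℕ => (-((k + j : ℤ) : ℂ)) • a (n - j) (b (k + j - 1) v)) =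
      (-k : ℂ) • altSum n (fun j : ℕ => a (n - j) (b (k - 1 + j) v)) -
        altSum n fun j : ℕ => (j : ℂ) • a (n - j) (b (k - 1 + j) v) := by
    rw [← altSum_smul, ← altSum_sub n (hX.smul _) (hX.smul _)]
    refine congrArg _ (funext fun j => ?_)
    rw [← sub_smul, add_sub_right_comm]; congr 1; push_cast; ring
  have u₂ : altSum n (fun j : ℕ => (-((n + k - j : ℤ) : ℂ)) • b (n + k - j - 1) (a j v)) =
      (-k : ℂ) • altSum n (fun j : ℕ => b (n + k - j - 1) (a j v)) -
        altSum n fun j : ℕ => ((n : ℂ) - j) • b (n + k - j - 1) (a j v) := by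
    rw [← altSum_smul, ← altSum_sub n (hY.smul _) (hY.smul _)]
    refine congrArg _ (funext fun j => ?_)
    rw [← sub_smul]; congr 1; push_cast; ring
  rw [u₁, u₂]
  have w : (fun j : ℕ => b (n + (k - 1) - j) (a j v)) = fun j : ℕ => b (n + k - j - 1) (a j v) := by
    funext j
    rw [show n + (k - 1) - (j : ℤ) = n + k - j - 1 by ring]
  rw [w]
  module

/-- Cauchy's formula: (z - w)^(-2) has expansion coefficients j + 1, one domain contributing for k <
0 and the other for k > 0. Hence a space of fields closed under residue products and containing the
identity is closed under `deriv`. -/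
theorem prod_neg_two_identity (a : quantumFields M) : prod (-2) a (identity M) = deriv a := by
  have hc : ∀ j : ℕ, (-1 : ℂ) ^ j * ((Ring.choose (-2 : ℤ) j : ℤ) : ℂ) = j + 1 := by
    intro j
    have h := Ring.choose_neg (R := ℤ) 2 j
    have e : (2 + (j : ℤ) - 1) = ((j + 1 : ℕ) : ℤ) := by push_cast; ring
    rw [h, e, Ring.choose_natCast, Nat.choose_succ_self_right]
    simp only [Int.negOnePow_def, Units.smul_def, zpow_natCast]
    push_cast
    rw [smul_eq_mul]
    push_cast
    rw [← mul_assoc, ← mul_pow]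
    simp
  ext k v
  rw [prod_apply, deriv_apply]
  simp only [leftExpand, rightExpand, compose, composeRev, identity_apply, altSum, hc]
  rcases lt_or_ge k 0 with hk | hk
  · obtain ⟨i, rfl⟩ : ∃ i : ℕ, k = -1 - i := ⟨(-1 - k).toNat, by omega⟩
    rw [finsum_eq_single _ i, finsum_eq_zero_of_forall_eq_zero, if_pos (by omega)]
    · rw [smul_zero, sub_zero]
      congr 1
      · push_cast; ring
      · rw [show (-2 : ℤ) - i = -1 - i - 1 by ring]
    · intro j
      rw [if_neg (by omega), smul_zero]
    · intro j hj
      rw [if_neg (by omega), map_zero, smul_zero]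
  · rw [finsum_eq_zero_of_forall_eq_zero fun j => by
      rw [if_neg (by omega), map_zero, smul_zero]]
    rcases eq_or_ne k 0 with rfl | hk0
    · rw [finsum_eq_zero_of_forall_eq_zero fun j => by rw [if_neg (by omega), smul_zero]]
      simp
    · obtain ⟨i, rfl⟩ : ∃ i : ℕ, k = i + 1 := ⟨(k - 1).toNat, by omega⟩
      rw [finsum_eq_single _ i, if_pos (by omega)]
      · rw [add_sub_cancel_right, zero_sub, smul_smul, ← neg_smul]
        congr 1
        norm_num
      · intro j hj
        rw [if_neg (by omega), smul_zero]

/-! ### The vertex algebra generated by local fields -/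

/-- Mutually local fields on a space generated by a vacuum vector. -/
structure GeneratingFields (M : Type*) [AddCommGroup M] [Module ℂ M] (Y : Type*) where
  field : Y → quantumFields M
  vacuum : M
  creative : ∀ y n, 0 ≤ n → field y n vacuum = 0
  isLocal : ∀ y z, IsLocal (field y) (field z)
  generates : ∀ S : Submodule ℂ M, vacuum ∈ S → (∀ y n v, v ∈ S → field y n v ∈ S) → S = ⊤

namespace GeneratingFields

variable {Y : Type*} (G : GeneratingFields M Y)

/-- The fields obtained from the generating fields and the identity by residue products. -/
inductive IsExpr : quantumFields M → Prop
  | one : IsExpr (identity M)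
  | gen (y : Y) : IsExpr (G.field y)
  | prod (n : ℤ) (a b : quantumFields M) : IsExpr a → IsExpr b → IsLocal a b →
      IsExpr (prod n a b)

/-- The span of the fields obtained from the generating fields by residue products. -/
def space : Submodule ℂ (quantumFields M) := Submodule.span ℂ {a | G.IsExpr a}

variable {G}

theorem identity_mem : identity M ∈ G.space := Submodule.subset_span .one

theorem field_mem (y : Y) : G.field y ∈ G.space := Submodule.subset_span (.gen y)

theorem IsExpr.isLocal_of_forall {c : quantumFields M} (hc : ∀ y, IsLocal (G.field y) c)
    {a : quantumFields M} (ha : G.IsExpr a) : IsLocal a c := by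
  induction ha with
  | one => exact isLocal_identity c
  | gen y => exact hc y
  | prod n a b _ _ hab iha ihb => exact hab.prod iha ihb n

theorem IsExpr.isLocal {a b : quantumFields M} (ha : G.IsExpr a) (hb : G.IsExpr b) :
    IsLocal a b :=
  ha.isLocal_of_forall fun y => (hb.isLocal_of_forall fun z => G.isLocal z y).symm

theorem isLocal_of_mem {a b : quantumFields M} (ha : a ∈ G.space) (hb : b ∈ G.space) :
    IsLocal a b := by
  have key : ∀ c : quantumFields M, (∀ a, G.IsExpr a → IsLocal a c) →
      ∀ a ∈ G.space, IsLocal a c := by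
    intro c hc a ha
    induction ha using Submodule.span_induction with
    | mem a ha => exact hc a ha
    | zero => exact IsLocal.zero c
    | add a b _ _ iha ihb => exact iha.add ihb
    | smul x a _ iha => exact iha.smul x
  exact key b (fun a ha => (key a (fun b hb => hb.isLocal ha) b hb).symm) a ha

theorem prod_mem (n : ℤ) {a b : quantumFields M} (ha : a ∈ G.space) (hb : b ∈ G.space) :
    prod n a b ∈ G.space := by
  refine (Submodule.span_le (p := G.space.comap ((prodₗ n).flip b))).2 (fun a ha => ?_) ha
  refine (Submodule.span_le (p := G.space.comap (prodₗ n a))).2 (fun b hb => ?_) hb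
  exact Submodule.subset_span (.prod n a b ha hb (ha.isLocal hb))

theorem deriv_mem {a : quantumFields M} (ha : a ∈ G.space) : deriv a ∈ G.space := by
  rw [← prod_neg_two_identity]
  exact prod_mem _ ha identity_mem

theorem creative_of_mem {a : quantumFields M} (ha : a ∈ G.space) {n : ℤ} (hn : 0 ≤ n) :
    a n G.vacuum = 0 := by
  refine (Submodule.span_le (p := LinearMap.ker ((LinearMap.applyₗ G.vacuum) ∘ₗ
    (LinearMap.proj n) ∘ₗ (quantumFields M).subtype))).2 (fun a ha => ?_) ha
  change a n G.vacuum = 0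
  induction ha generalizing n with
  | one => rw [identity_apply, if_neg (by omega)]
  | gen y => exact G.creative y n hn
  | prod m a b _ _ _ iha ihb =>
    rw [prod_apply, leftExpand, rightExpand, altSum_eq_zero, altSum_eq_zero, smul_zero, sub_zero]
    · intro j; rw [composeRev, iha (by omega), map_zero]
    · intro j; rw [compose, ihb (by omega), map_zero]

/-- The state of a field is its value a_(-1) on the vacuum. This says that passing to states turns
the residue product by a into the action of the mode a_n. -/
theorem prod_vacuum {a b : quantumFields M} (ha : a ∈ G.space) (hb : b ∈ G.space) (n : ℤ) :
    prod n a b (-1) G.vacuum = a n (b (-1) G.vacuum) := by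
  rw [prod_apply, leftExpand, rightExpand, altSum_eq_single, altSum_eq_zero, smul_zero, sub_zero]
  · simp [compose]
  · intro j; rw [composeRev, creative_of_mem ha (by omega), map_zero]
  · intro j; rw [compose, creative_of_mem hb (by push_cast; omega), map_zero]

/-- A field is determined by its values on the vacuum. -/
theorem eq_zero_of_vacuum {d : quantumFields M} (hd : d ∈ G.space)
    (h : ∀ n, d n G.vacuum = 0) : d = 0 := by
  let S : Submodule ℂ M :=
    { carrier := {v | ∀ n, d n v = 0}
      add_mem' := fun hu hv n => by rw [map_add, hu n, hv n, add_zero]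
      zero_mem' := fun n => map_zero _
      smul_mem' := fun c v hv n => by rw [map_smul, hv n, smul_zero] }
  have hS : S = ⊤ := by
    -- If d kills v, locality gives (z - w)^N d(z) y(w) v = 0. As y(w) v is bounded in its modes,
    -- the power of z - w can be cancelled, so d kills y(w) v as well.
    refine G.generates S h fun y r v hv q => ?_
    obtain ⟨N, hN⟩ := isLocal_of_mem hd (field_mem (G := G) y)
    have e : compose d (G.field y) v - composeRev d (G.field y) v = compose d (G.field y) v := by
      ext p q
      rw [Pi.sub_apply, Pi.sub_apply, composeRev, hv p, map_zero, sub_zero]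
    have hv' := hN v
    rw [e] at hv'
    obtain ⟨R, hR⟩ := (G.field y).2 v
    exact congrFun (congrFun (eq_zero_of_shiftDiff_pow_eq_zero (R := R)
      (fun p q hq => by rw [compose, hR q hq, map_zero]) hv') q) r
  ext n v
  exact (hS ▸ Submodule.mem_top : v ∈ S) n

variable (G) in
/-- The residue products on the space of fields. -/
def mulₗ (n : ℤ) : G.space →ₗ[ℂ] G.space →ₗ[ℂ] G.space :=
  LinearMap.mk₂ ℂ (fun a b => ⟨prod n a.1 b.1, prod_mem n a.2 b.2⟩)
    (fun _ _ _ => Subtype.ext (prod_add_left n _ _ _))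
    (fun _ _ _ => Subtype.ext (prod_smul_left n _ _ _))
    (fun _ _ _ => Subtype.ext (prod_add_right n _ _ _))
    (fun _ _ _ => Subtype.ext (prod_smul_right n _ _ _))

theorem mulₗ_coe (n : ℤ) (a b : G.space) : (G.mulₗ n a b).1 = prod n a.1 b.1 := rfl

variable (G) in
/-- The derivative on the space of fields. -/
def derivₗ : G.space →ₗ[ℂ] G.space := deriv.restrict fun _ => deriv_mem

theorem derivₗ_mulₗ (n : ℤ) (a b : G.space) :
    G.derivₗ (G.mulₗ n a b) = G.mulₗ n (G.derivₗ a) b + G.mulₗ n a (G.derivₗ b) :=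
  Subtype.ext (deriv_prod n a.1 b.1)

/-- The defect is trilinear and built from the products, so a derivation of all products acts on it
by the Leibniz rule. -/
theorem map_borcherdsDefect {V : Type*} [AddCommGroup V] [Module ℂ V]
    {p : ℤ → V →ₗ[ℂ] V →ₗ[ℂ] V} {T : V →ₗ[ℂ] V}
    (hT : ∀ n a b, T (p n a b) = p n (T a) b + p n a (T b)) (m n k : ℤ) (N : ℕ) (a b c : V) :
    T (borcherdsDefect p m n k N a b c) = borcherdsDefect p m n k N (T a) b c +
      borcherdsDefect p m n k N a (T b) c + borcherdsDefect p m n k N a b (T c) := by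
  simp only [borcherdsDefect, map_sub, map_sum, map_smul, hT, map_add, LinearMap.add_apply,
    smul_add, smul_sub, Finset.sum_add_distrib, Finset.sum_sub_distrib]
  abel

theorem mulₗ_eventually (a b : G.space) : ∃ N : ℕ, ∀ n : ℤ, N ≤ n → G.mulₗ n a b = 0 := by
  obtain ⟨N, hN⟩ := exists_prod_eq_zero (isLocal_of_mem a.2 b.2)
  exact ⟨N, fun n hn => Subtype.ext (hN n hn)⟩

theorem exists_cutoff (a b c : G.space) (m n k : ℤ) : ∃ N₀ : ℕ, ∀ N, N₀ ≤ N →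
    (∀ j : ℤ, N ≤ j → G.mulₗ (n + j) a b = 0) ∧ (∀ j : ℤ, N ≤ j → G.mulₗ (k + j) b c = 0) ∧
      ∀ j : ℤ, N ≤ j → G.mulₗ (m + j) a c = 0 := by
  obtain ⟨N₁, h₁⟩ := mulₗ_eventually a b
  obtain ⟨N₂, h₂⟩ := mulₗ_eventually b c
  obtain ⟨N₃, h₃⟩ := mulₗ_eventually a c
  exact ⟨(N₁ - n).toNat + (N₂ - k).toNat + (N₃ - m).toNat, fun N hN =>
    ⟨fun j hj => h₁ _ (by omega), fun j hj => h₂ _ (by omega), fun j hj => h₃ _ (by omega)⟩⟩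

/-- On states, the identity for a, b, c becomes `borcherds_of_isLocal` for the local pair a, b
applied to the state of c. The field c need not be treated as a field at all. -/
theorem borcherdsDefect_state (a b c : G.space) (m n k : ℤ) (N : ℕ)
    (h₁ : ∀ j : ℤ, N ≤ j → G.mulₗ (n + j) a b = 0) (h₂ : ∀ j : ℤ, N ≤ j → G.mulₗ (k + j) b c = 0)
    (h₃ : ∀ j : ℤ, N ≤ j → G.mulₗ (m + j) a c = 0) :
    (borcherdsDefect G.mulₗ m n k N a b c).1 (-1) G.vacuum = 0 := by
  let s : G.space →ₗ[ℂ] M :=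
    { toFun d := d.1 (-1) G.vacuum
      map_add' _ _ := rfl
      map_smul' _ _ := rfl }
  have hs : ∀ n (a b : G.space), s (G.mulₗ n a b) = a.1 n (s b) := fun n a b =>
    prod_vacuum a.2 b.2 n
  change s (borcherdsDefect G.mulₗ m n k N a b c) = 0
  have z : ∀ (n : ℤ) (a b : G.space), G.mulₗ n a b = 0 → a.1 n (s b) = 0 := fun n a b h => by
    rw [← hs, h, map_zero]
  have key := borcherds_of_isLocal (isLocal_of_mem a.2 b.2) (s c) m n k
  rw [borcherdsRight, binSum_eq_sum m (N := N) fun j hj => by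
      rw [show prod (n + j) a.1 b.1 = 0 from congrArg Subtype.val (h₁ j (by omega))]; rfl,
    altSum_eq_sum n (N := N) fun j hj => by rw [z _ _ _ (h₂ j (by omega)), map_zero],
    altSum_eq_sum n (N := N) fun j hj => by rw [z _ _ _ (h₃ j (by omega)), map_zero],
    Finset.smul_sum, ← Finset.sum_sub_distrib] at key
  rw [borcherdsDefect, map_sub, sub_eq_zero, map_sum, map_sum]
  simp only [map_smul, map_sub, hs, mulₗ_coe]
  rw [key]
  refine Finset.sum_congr rfl fun j _ => ?_
  rw [smul_sub, smul_comm]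

/-- The mode -2 - i of a field is, up to a nonzero scalar, the mode -1 - i of its derivative, and
the derivative of a defect is a sum of three defects. The cut-off depends on i because derivatives
may be truncated later. -/
theorem exists_borcherdsDefect_apply (i : ℕ) (a b c : G.space) (m n k : ℤ) :
    ∃ N₀ : ℕ, ∀ N, N₀ ≤ N →
      (borcherdsDefect G.mulₗ m n k N a b c).1 (-1 - i) G.vacuum = 0 := by
  induction i generalizing a b c with
  | zero =>
    obtain ⟨N₀, h⟩ := exists_cutoff a b c m n k
    refine ⟨N₀, fun N hN => ?_⟩
    rw [Nat.cast_zero, sub_zero]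
    exact borcherdsDefect_state a b c m n k N (h N hN).1 (h N hN).2.1 (h N hN).2.2
  | succ i ih =>
    obtain ⟨N₁, h₁⟩ := ih (G.derivₗ a) b c
    obtain ⟨N₂, h₂⟩ := ih a (G.derivₗ b) c
    obtain ⟨N₃, h₃⟩ := ih a b (G.derivₗ c)
    refine ⟨max N₁ (max N₂ N₃), fun N hN => ?_⟩
    have e : (-((-1 - i : ℤ) : ℂ)) •
        (borcherdsDefect G.mulₗ m n k N a b c).1 (-1 - i - 1) G.vacuum =
        (borcherdsDefect G.mulₗ m n k N (G.derivₗ a) b c).1 (-1 - i) G.vacuum +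
        (borcherdsDefect G.mulₗ m n k N a (G.derivₗ b) c).1 (-1 - i) G.vacuum +
        (borcherdsDefect G.mulₗ m n k N a b (G.derivₗ c)).1 (-1 - i) G.vacuum :=
      congrArg (fun d : G.space => d.1 (-1 - i) G.vacuum)
        (map_borcherdsDefect (derivₗ_mulₗ (G := G)) m n k N a b c)
    rw [h₁ N (by omega), h₂ N (by omega), h₃ N (by omega), add_zero, add_zero] at e
    have hne : (-((-1 - i : ℤ) : ℂ)) ≠ 0 := by
      have : ((-(-1 - i : ℤ) : ℤ) : ℂ) ≠ 0 := Int.cast_ne_zero.2 (by omega)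
      simpa using this
    have := (smul_eq_zero.1 e).resolve_left hne
    rwa [show (-1 - ((i + 1 : ℕ) : ℤ)) = -1 - i - 1 by push_cast; ring]

/-- Apart from truncation, each axiom is an equality of fields in `G.space`, so by
`eq_zero_of_vacuum` it only has to be checked on the vacuum. -/
instance : VertexAlgebra G.space where
  nprod := G.mulₗ
  vac := ⟨identity M, identity_mem⟩
  truncation a b := by
    obtain ⟨N, hN⟩ := mulₗ_eventually a b
    exact ⟨N, hN⟩
  vac_nprod n a := by
    refine Subtype.ext ?_
    have h : prod n (identity M) a.1 - (if n = -1 then a.1 else 0) = 0 := by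
      refine eq_zero_of_vacuum (G := G) (sub_mem (prod_mem n identity_mem a.2) ?_) fun k => ?_
      · split_ifs
        exacts [a.2, zero_mem _]
      · rw [sub_apply, prod_apply, leftExpand, rightExpand, altSum_eq_zero (X := fun j : ℕ =>
          composeRev (identity M) a.1 G.vacuum j (n + k - j)), smul_zero, sub_zero, sub_eq_zero]
        · simp only [compose, identity_apply]
          rcases lt_or_ge n (-1) with hn | hn
          · rw [altSum_eq_zero _ fun j => if_neg (by omega), if_neg (by omega)]
            rfl
          · rcases eq_or_ne n (-1) with rfl | hn'
            · rw [altSum_eq_single _ fun j => if_neg (by push_cast; omega)]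
              simp
            · obtain ⟨i, rfl⟩ := Int.eq_ofNat_of_zero_le (a := n) (by omega)
              rw [altSum_eq_binSum, binSum_of_nonneg, Finset.sum_eq_zero, if_neg hn']
              · rfl
              · intro j hj
                rw [if_neg (by have := Finset.mem_range.1 hj; omega), smul_zero, smul_zero]
        · intro j
          rw [composeRev, identity_apply, if_neg (by omega), map_zero]
    rw [mulₗ_coe, sub_eq_zero.1 h]
    split_ifs <;> rfl
  nprod_vac a := by
    refine Subtype.ext (sub_eq_zero.1 (eq_zero_of_vacuum (G := G)
      (sub_mem (prod_mem (-1) a.2 identity_mem) a.2) fun k => ?_))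
    rw [sub_apply, mulₗ_coe, prod_apply, leftExpand, rightExpand, altSum_eq_zero (X := fun j : ℕ =>
      composeRev a.1 (identity M) G.vacuum j (-1 + k - j)), smul_zero, sub_zero, altSum_neg_one]
    · simp only [compose, identity_apply]
      rcases lt_or_ge k 0 with hk | hk
      · rw [finsum_eq_single _ (-1 - k).toNat, if_pos (by omega), Int.toNat_of_nonneg (by omega),
          sub_sub_cancel, sub_self]
        intro j hj
        rw [if_neg (by omega), map_zero]
      · rw [finsum_eq_zero_of_forall_eq_zero, creative_of_mem a.2 hk, sub_zero]
        intro j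
        rw [if_neg (by omega), map_zero]
    · intro j
      rw [composeRev, creative_of_mem a.2 (by omega), map_zero]
  nprod_vac_of_nonneg n a hn := by
    refine Subtype.ext (eq_zero_of_vacuum (G := G) (prod_mem n a.2 identity_mem) fun k => ?_)
    obtain ⟨i, rfl⟩ := Int.eq_ofNat_of_zero_le hn
    rw [mulₗ_coe, prod_apply, leftExpand, rightExpand, altSum_eq_zero (X := fun j : ℕ =>
      composeRev a.1 (identity M) G.vacuum j (i + k - j)), smul_zero, sub_zero, altSum_eq_binSum,
      binSum_of_nonneg]
    · refine Finset.sum_eq_zero fun j hj => ?_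
      rw [compose, identity_apply]
      split_ifs
      · rw [creative_of_mem a.2 (by have := Finset.mem_range.1 hj; omega), smul_zero, smul_zero]
      · rw [map_zero, smul_zero, smul_zero]
    · intro j
      rw [composeRev, creative_of_mem a.2 (by omega), map_zero]
  borcherds a b c m n k N h₁ h₂ h₃ := by
    refine Subtype.ext (eq_zero_of_vacuum (G := G) (Subtype.prop _) fun l => ?_)
    rcases lt_or_ge l 0 with hl | hl
    · obtain ⟨i, rfl⟩ : ∃ i : ℕ, l = -1 - i := ⟨(-1 - l).toNat, by omega⟩
      obtain ⟨N₀, hN₀⟩ := exists_borcherdsDefect_apply i a b c m n k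
      -- The given cut-off may be too small for the derivatives that enter at the mode -1 - i, but
      -- the defect does not change when it is enlarged.
      rw [VertexPresentation.defect_cutoff _ a b c m n k N (max N N₀) (le_max_left _ _) h₁ h₂ h₃]
      exact hN₀ _ (le_max_right _ _)
    · exact creative_of_mem (Subtype.prop _) hl

end GeneratingFields

end QuantumField

/-! ### Induced modules of a Lie algebra with a complement to the inducing subalgebra -/

/-- A Lie algebra `L` with bracket `br`, decomposed as the sum of a subalgebra, the image of the
projection `neg`, and of the subalgebra `ker neg`, together with a functional `chr` that is a
character of `ker neg`. -/
structure SplitLieAlgebra (L : Type*) [AddCommGroup L] [Module ℂ L] where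
  br : L →ₗ[ℂ] L →ₗ[ℂ] L
  skew : ∀ x y, br x y = -br y x
  jacobi : ∀ x y z, br x (br y z) = br (br x y) z + br y (br x z)
  neg : L →ₗ[ℂ] L
  neg_neg : ∀ x, neg (neg x) = neg x
  neg_br : ∀ x y, neg (br (neg x) (neg y)) = br (neg x) (neg y)
  neg_br_pos : ∀ x y, neg (br (x - neg x) (y - neg y)) = 0
  chr : L →ₗ[ℂ] ℂ
  chr_br : ∀ x y, chr (br (x - neg x) (y - neg y)) = 0

namespace SplitLieAlgebra

variable {L : Type*} [AddCommGroup L] [Module ℂ L] (S : SplitLieAlgebra L)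

/-- The relations of the enveloping algebra of the image of `neg`. -/
inductive EnvRel : TensorAlgebra ℂ L → TensorAlgebra ℂ L → Prop
  | proj (x : L) : EnvRel (TensorAlgebra.ι ℂ x) (TensorAlgebra.ι ℂ (S.neg x))
  | lie (x y : L) : EnvRel
      (TensorAlgebra.ι ℂ (S.br (S.neg x) (S.neg y)) +
        TensorAlgebra.ι ℂ (S.neg y) * TensorAlgebra.ι ℂ (S.neg x))
      (TensorAlgebra.ι ℂ (S.neg x) * TensorAlgebra.ι ℂ (S.neg y))

/-- The enveloping algebra of the image of `neg`. -/
def NegEnvelope : Type _ := RingQuot S.EnvRel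

instance : Ring S.NegEnvelope := inferInstanceAs (Ring (RingQuot S.EnvRel))

instance : Algebra ℂ S.NegEnvelope := inferInstanceAs (Algebra ℂ (RingQuot S.EnvRel))

/-- The projection of the tensor algebra. -/
def mkEnvelope : TensorAlgebra ℂ L →ₐ[ℂ] S.NegEnvelope := RingQuot.mkAlgHom ℂ S.EnvRel

/-- The map of `L` to the enveloping algebra of the image of `neg`, through `neg`. -/
def ι : L →ₗ[ℂ] S.NegEnvelope :=
  S.mkEnvelope.toLinearMap ∘ₗ TensorAlgebra.ι ℂ

theorem ι_neg (x : L) : S.ι (S.neg x) = S.ι x :=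
  (RingQuot.mkAlgHom_rel ℂ (EnvRel.proj x)).symm

theorem ι_br (x y : L) :
    S.ι (S.br (S.neg x) (S.neg y)) = S.ι x * S.ι y - S.ι y * S.ι x := by
  have h : S.mkEnvelope _ = S.mkEnvelope _ :=
    RingQuot.mkAlgHom_rel ℂ (EnvRel.lie (S := S) x y)
  rw [map_add, map_mul, map_mul] at h
  rw [eq_sub_iff_add_eq, ← S.ι_neg x, ← S.ι_neg y]
  exact h

/-- The universal property of the enveloping algebra of the image of `neg`. -/
def lift {B : Type*} [Semiring B] [Algebra ℂ B] (f : L →ₗ[ℂ] B) (hf : ∀ x, f (S.neg x) = f x)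
    (hb : ∀ x y, f (S.br (S.neg x) (S.neg y)) + f y * f x = f x * f y) :
    S.NegEnvelope →ₐ[ℂ] B :=
  RingQuot.liftAlgHom ℂ ⟨TensorAlgebra.lift ℂ f, by
    intro u v h
    cases h with
    | proj x => simp [hf]
    | lie x y => simp [hf, hb]⟩

@[simp] theorem lift_ι {B : Type*} [Semiring B] [Algebra ℂ B] (f : L →ₗ[ℂ] B)
    (hf : ∀ x, f (S.neg x) = f x)
    (hb : ∀ x y, f (S.br (S.neg x) (S.neg y)) + f y * f x = f x * f y) (x : L) :
    S.lift f hf hb (S.ι x) = f x :=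
  (RingQuot.liftAlgHom_mkAlgHom_apply ℂ _ _ _).trans (TensorAlgebra.lift_ι_apply _ _)

theorem envelope_induction (T : Submodule ℂ S.NegEnvelope) (h1 : 1 ∈ T)
    (hι : ∀ x, ∀ u ∈ T, S.ι x * u ∈ T) (u : S.NegEnvelope) : u ∈ T := by
  have key : ∀ u : S.NegEnvelope, ∀ t ∈ T, u * t ∈ T := by
    intro u
    obtain ⟨u, rfl⟩ : ∃ v, S.mkEnvelope v = u := RingQuot.mkAlgHom_surjective ℂ S.EnvRel u
    induction u using TensorAlgebra.induction with
    | algebraMap r =>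
      intro t ht
      rw [AlgHom.commutes, ← Algebra.smul_def]
      exact T.smul_mem _ ht
    | ι x => exact hι x
    | mul a b ha hb =>
      intro t ht
      rw [map_mul, mul_assoc]
      exact ha _ (hb _ ht)
    | add a b ha hb =>
      intro t ht
      rw [map_add, add_mul]
      exact add_mem (ha _ ht) (hb _ ht)
  simpa using key u 1 h1

/-- The complementary projection. -/
def pos : L →ₗ[ℂ] L := LinearMap.id - S.neg

theorem pos_apply (x : L) : S.pos x = x - S.neg x := rfl

theorem neg_add_pos (x : L) : S.neg x + S.pos x = x := by simp [pos_apply]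

theorem pos_neg (x : L) : S.pos (S.neg x) = 0 := by simp [pos_apply, S.neg_neg]

theorem pos_pos (x : L) : S.pos (S.pos x) = S.pos x := by simp [pos_apply, S.neg_neg]

theorem pos_br_neg (x y : L) : S.pos (S.br (S.neg x) (S.neg y)) = 0 := by
  rw [pos_apply, S.neg_br, sub_self]

/-- The action of `x` on the extension of the enveloping algebra by possible actions of
`ker neg`. -/
def coinducedAct (x : L) : Module.End ℂ (S.NegEnvelope × (L →ₗ[ℂ] S.NegEnvelope)) :=
  LinearMap.prod (LinearMap.mulLeft ℂ (S.ι x) ∘ₗ LinearMap.fst ℂ _ _)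
    { toFun := fun p => LinearMap.mulLeft ℂ (S.ι x) ∘ₗ p.2 +
        LinearMap.mulRight ℂ p.1 ∘ₗ S.ι ∘ₗ S.br.flip (S.neg x) ∘ₗ S.pos +
        p.2 ∘ₗ S.pos ∘ₗ S.br.flip (S.neg x) ∘ₗ S.pos
      map_add' := fun p q => by
        ext l
        simp only [LinearMap.add_apply, LinearMap.comp_apply, Prod.fst_add, Prod.snd_add,
          LinearMap.mulLeft_apply, LinearMap.mulRight_apply, mul_add]
        abel
      map_smul' := fun c p => by
        ext l
        simp only [LinearMap.add_apply, LinearMap.comp_apply, Prod.smul_fst, Prod.smul_snd,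
          LinearMap.mulLeft_apply, LinearMap.mulRight_apply, LinearMap.smul_apply,
          mul_smul_comm, smul_add, RingHom.id_apply] }

theorem coinducedAct_fst (x : L) (p : S.NegEnvelope × (L →ₗ[ℂ] S.NegEnvelope)) :
    (S.coinducedAct x p).1 = S.ι x * p.1 := rfl

/-- A pair (u, φ) records a vector u together with prospective values φ(l) of l · u for l in `ker
neg`. The formula is the rule l(xu) = x(lu) + [l, x]u, with [l, x] split into its two components. -/
theorem coinducedAct_snd (x : L) (p : S.NegEnvelope × (L →ₗ[ℂ] S.NegEnvelope)) (l : L) :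
    (S.coinducedAct x p).2 l = S.ι x * p.2 l + S.ι (S.br (S.pos l) (S.neg x)) * p.1 +
      p.2 (S.pos (S.br (S.pos l) (S.neg x))) := rfl

/-- `coinducedAct` as a linear map. -/
def coinduced : L →ₗ[ℂ] Module.End ℂ (S.NegEnvelope × (L →ₗ[ℂ] S.NegEnvelope)) where
  toFun := S.coinducedAct
  map_add' x y := by
    refine LinearMap.ext fun p => Prod.ext ?_ (LinearMap.ext fun l => ?_)
    · simp only [coinducedAct_fst, LinearMap.add_apply, Prod.fst_add, map_add, add_mul]
    · simp only [coinducedAct_snd, LinearMap.add_apply, Prod.snd_add, map_add, add_mul]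
      abel
  map_smul' c x := by
    refine LinearMap.ext fun p => Prod.ext ?_ (LinearMap.ext fun l => ?_)
    · simp only [coinducedAct_fst, LinearMap.smul_apply, Prod.smul_fst, map_smul,
        smul_mul_assoc, RingHom.id_apply]
    · simp only [coinducedAct_snd, LinearMap.smul_apply, Prod.smul_snd, map_smul,
        smul_mul_assoc, smul_add, RingHom.id_apply]

theorem coinduced_neg (x : L) : S.coinduced (S.neg x) = S.coinduced x := by
  refine LinearMap.ext fun p => Prod.ext ?_ (LinearMap.ext fun l => ?_)
  · simp only [coinduced, LinearMap.coe_mk, AddHom.coe_mk, coinducedAct_fst, S.ι_neg]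
  · simp only [coinduced, LinearMap.coe_mk, AddHom.coe_mk, coinducedAct_snd, S.ι_neg, S.neg_neg]

theorem jacobi_right (l x y : L) :
    S.br l (S.br x y) = S.br (S.br l x) y - S.br (S.br l y) x := by
  rw [S.jacobi, S.skew x (S.br l y), sub_eq_add_neg]

theorem br_br_right (x y z : L) :
    S.br (S.br x y) z = S.br (S.br x z) y + S.br x (S.br y z) := by
  rw [S.jacobi x y z, S.skew y]
  abel

theorem ι_br_neg (x y : L) : S.ι (S.br x (S.neg y)) =
    S.ι x * S.ι y - S.ι y * S.ι x + S.ι (S.br (S.pos x) (S.neg y)) := by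
  conv_lhs => rw [← S.neg_add_pos x]
  rw [map_add, LinearMap.add_apply, map_add, S.ι_br]

theorem pos_br_right (x y : L) : S.pos (S.br x (S.neg y)) = S.pos (S.br (S.pos x) (S.neg y)) := by
  conv_lhs => rw [← S.neg_add_pos x]
  rw [map_add, LinearMap.add_apply, map_add, S.pos_br_neg, zero_add]

/-- By the Jacobi identity the rule for moving `ker neg` past a negative element is compatible with
the relations of the enveloping algebra. The action of `ker neg` on the induced module is thereby
well defined without knowing a basis of that algebra. -/
theorem coinduced_br (x y : L) : S.coinduced (S.br (S.neg x) (S.neg y)) +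
    S.coinduced y * S.coinduced x = S.coinduced x * S.coinduced y := by
  refine LinearMap.ext fun p => Prod.ext ?_ (LinearMap.ext fun l => ?_)
  · simp only [coinduced, LinearMap.coe_mk, AddHom.coe_mk, coinducedAct_fst, S.ι_br,
      LinearMap.add_apply, Module.End.mul_apply, Prod.fst_add, sub_mul, mul_assoc,
      sub_add_cancel]
  · simp only [coinduced, LinearMap.coe_mk, AddHom.coe_mk, coinducedAct_snd, coinducedAct_fst,
      S.ι_br, LinearMap.add_apply, Module.End.mul_apply, Prod.snd_add, S.neg_br, S.pos_pos]
    rw [S.jacobi_right, map_sub, map_sub, map_sub, S.ι_br_neg (S.br _ _),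
      S.ι_br_neg (S.br _ _), S.pos_br_right (S.br _ _), S.pos_br_right (S.br _ _)]
    noncomm_ring

/-- The action of the enveloping algebra through `coinduced`. -/
def coinducedHom : S.NegEnvelope →ₐ[ℂ] Module.End ℂ (S.NegEnvelope × (L →ₗ[ℂ] S.NegEnvelope)) :=
  S.lift S.coinduced S.coinduced_neg S.coinduced_br

/-- The vector that generates the induced module. -/
def coinducedVec : S.NegEnvelope × (L →ₗ[ℂ] S.NegEnvelope) :=
  (1, (LinearMap.toSpanSingleton ℂ S.NegEnvelope 1) ∘ₗ S.chr)

theorem coinducedHom_ι_mul (x : L) (u : S.NegEnvelope) :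
    S.coinducedHom (S.ι x * u) S.coinducedVec =
      S.coinducedAct x (S.coinducedHom u S.coinducedVec) := by
  rw [map_mul, coinducedHom, lift_ι]
  rfl

/-- The orbit of the generating vector is a graph over the enveloping algebra: u determines the
pair, so its second component can serve as the action of `ker neg` on u. -/
theorem coinducedHom_fst (u : S.NegEnvelope) : (S.coinducedHom u S.coinducedVec).1 = u := by
  let T : Submodule ℂ S.NegEnvelope :=
    LinearMap.eqLocus (LinearMap.fst ℂ _ _ ∘ₗ
      (LinearMap.applyₗ S.coinducedVec) ∘ₗ S.coinducedHom.toLinearMap) LinearMap.id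
  refine S.envelope_induction T ?_ (fun x u hu => ?_) u
  · change (S.coinducedHom 1 S.coinducedVec).1 = 1
    rw [map_one]
    rfl
  · change (S.coinducedHom u S.coinducedVec).1 = u at hu
    change (S.coinducedHom (S.ι x * u) S.coinducedVec).1 = S.ι x * u
    rw [coinducedHom_ι_mul, coinducedAct_fst, hu]

/-- The action of `L` on the module induced from the character `chr` of `ker neg`. -/
def act (l : L) : Module.End ℂ S.NegEnvelope :=
  LinearMap.mulLeft ℂ (S.ι l) + LinearMap.applyₗ (S.pos l) ∘ₗ LinearMap.snd ℂ _ _ ∘ₗ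
      (LinearMap.applyₗ S.coinducedVec) ∘ₗ S.coinducedHom.toLinearMap

theorem act_apply (l : L) (u : S.NegEnvelope) :
    S.act l u = S.ι l * u + (S.coinducedHom u S.coinducedVec).2 (S.pos l) := rfl

/-- The action as a linear map. -/
def actₗ : L →ₗ[ℂ] Module.End ℂ S.NegEnvelope where
  toFun := S.act
  map_add' x y := by
    ext u
    simp only [act_apply, map_add, add_mul, LinearMap.add_apply]
    abel
  map_smul' c x := by
    ext u
    simp only [act_apply, map_smul, smul_mul_assoc, LinearMap.smul_apply, RingHom.id_apply,
      smul_add]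

theorem actₗ_apply (l : L) (u : S.NegEnvelope) :
    S.actₗ l u = S.ι l * u + (S.coinducedHom u S.coinducedVec).2 (S.pos l) := rfl

theorem actₗ_neg (l : L) (u : S.NegEnvelope) : S.actₗ (S.neg l) u = S.ι l * u := by
  rw [actₗ_apply, S.ι_neg, S.pos_neg, map_zero, add_zero]

theorem ι_pos (l : L) : S.ι (S.pos l) = 0 := by
  rw [pos_apply, map_sub, S.ι_neg, sub_self]

theorem actₗ_one (l : L) : S.actₗ l 1 = S.ι l + S.chr (S.pos l) • 1 := by
  rw [actₗ_apply, map_one, mul_one]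
  rfl

theorem actₗ_ι_mul_of_pos (l x : L) (u : S.NegEnvelope) :
    S.actₗ (S.pos l) (S.ι x * u) =
      S.ι x * S.actₗ (S.pos l) u + S.actₗ (S.br (S.pos l) (S.neg x)) u := by
  simp only [actₗ_apply, coinducedHom_ι_mul, coinducedAct_snd, coinducedHom_fst, S.pos_pos,
    S.ι_pos, zero_mul, zero_add]
  abel

theorem actₗ_ι_mul (l x : L) (u : S.NegEnvelope) :
    S.actₗ l (S.ι x * u) = S.ι x * S.actₗ l u + S.actₗ (S.br l (S.neg x)) u := by
  have h : S.actₗ (S.br (S.neg l) (S.neg x)) u = S.ι l * (S.ι x * u) - S.ι x * (S.ι l * u) := by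
    rw [← S.neg_br, S.actₗ_neg, S.ι_br, sub_mul, mul_assoc, mul_assoc]
  rw [← S.neg_add_pos l, map_add, map_add, LinearMap.add_apply, LinearMap.add_apply,
    LinearMap.add_apply, map_add, LinearMap.add_apply, actₗ_ι_mul_of_pos, S.actₗ_neg, S.actₗ_neg,
    h]
  noncomm_ring

/-- Left multiplication by ι x propagates the identity, by `actₗ_ι_mul` and Jacobi. On the vector 1
it is checked on components: a negative element acts by multiplication, and two elements of `ker
neg` act by scalars, where `chr_br` is needed. -/
theorem actₗ_br (l l' : L) (u : S.NegEnvelope) :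
    S.actₗ l (S.actₗ l' u) - S.actₗ l' (S.actₗ l u) = S.actₗ (S.br l l') u := by
  let T : Submodule ℂ S.NegEnvelope :=
    ⨅ p : L × L, LinearMap.eqLocus
      (S.actₗ p.1 ∘ₗ S.actₗ p.2 - S.actₗ p.2 ∘ₗ S.actₗ p.1) (S.actₗ (S.br p.1 p.2))
  have hT : ∀ u, u ∈ T ↔ ∀ l l', S.actₗ l (S.actₗ l' u) - S.actₗ l' (S.actₗ l u) =
      S.actₗ (S.br l l') u := by
    intro u
    rw [Submodule.mem_iInf]
    exact ⟨fun h l l' => h (l, l'), fun h p => h p.1 p.2⟩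
  refine (hT u).1 (S.envelope_induction T ?_ (fun x u hu => ?_) u) l l'
  · rw [hT]
    have h1 : ∀ l l', S.actₗ (S.neg l) (S.actₗ l' 1) - S.actₗ l' (S.actₗ (S.neg l) 1) =
        S.actₗ (S.br (S.neg l) l') 1 := by
      intro l l'
      rw [S.actₗ_neg, S.actₗ_neg, S.actₗ_ι_mul, S.skew l', map_neg, LinearMap.neg_apply]
      abel
    have h2 : ∀ l l', S.actₗ (S.pos l) (S.actₗ (S.pos l') 1) -
        S.actₗ (S.pos l') (S.actₗ (S.pos l) 1) = S.actₗ (S.br (S.pos l) (S.pos l')) 1 := by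
      intro l l'
      have hn := S.neg_br_pos l l'
      rw [← pos_apply, ← pos_apply] at hn
      have h0 : S.ι (S.br (S.pos l) (S.pos l')) = 0 := by rw [← S.ι_neg, hn, map_zero]
      have h0' : S.pos (S.br (S.pos l) (S.pos l')) = S.br (S.pos l) (S.pos l') := by
        rw [pos_apply, hn, sub_zero]
      have hc := S.chr_br l l'
      rw [← pos_apply, ← pos_apply] at hc
      simp only [actₗ_one, S.ι_pos, S.pos_pos, zero_add, map_smul, h0, h0', hc]
      module
    intro l l'
    have e1 := h1 l l'
    have e2 := h2 l l'
    have e3 := h1 l' (S.pos l)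
    rw [S.skew _ (S.pos l), map_neg, LinearMap.neg_apply] at e3
    have e : S.br l l' = S.br (S.neg l) l' + (S.br (S.pos l) (S.neg l') +
        S.br (S.pos l) (S.pos l')) := by
      rw [← map_add, S.neg_add_pos, ← LinearMap.add_apply, ← map_add, S.neg_add_pos]
    have e' : ∀ v, S.actₗ l v = S.actₗ (S.neg l) v + S.actₗ (S.pos l) v := by
      intro v
      rw [← LinearMap.add_apply, ← map_add, S.neg_add_pos]
    have e'' : ∀ v, S.actₗ l' v = S.actₗ (S.neg l') v + S.actₗ (S.pos l') v := by
      intro v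
      rw [← LinearMap.add_apply, ← map_add, S.neg_add_pos]
    rw [e, map_add, map_add, LinearMap.add_apply, LinearMap.add_apply, ← e1, ← e2, ← neg_eq_iff_eq_neg.2 e3.symm.symm]
    simp only [e', e'', map_add]
    abel
  · rw [hT] at hu ⊢
    intro l l'
    rw [actₗ_ι_mul, actₗ_ι_mul, actₗ_ι_mul, map_add, map_add, actₗ_ι_mul, actₗ_ι_mul,
      S.br_br_right, map_add, LinearMap.add_apply, ← hu l l', ← hu (S.br l (S.neg x)) l',
      ← hu l (S.br l' (S.neg x))]
    simp only [mul_sub]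
    abel

end SplitLieAlgebra

/-! ### Affine Lie algebras -/

/-- A Lie algebra with bracket `br` and a symmetric invariant form. -/
structure QuadraticLie (E : Type*) [AddCommGroup E] [Module ℂ E] where
  br : E →ₗ[ℂ] E →ₗ[ℂ] E
  form : E →ₗ[ℂ] E →ₗ[ℂ] ℂ
  skew : ∀ x y, br x y = -br y x
  jacobi : ∀ x y z, br x (br y z) = br (br x y) z + br y (br x z)
  symm : ∀ x y, form x y = form y x
  inv : ∀ x y z, form (br x y) z = form x (br y z)

namespace QuadraticLie

variable {E : Type*} [AddCommGroup E] [Module ℂ E] (Q : QuadraticLie E)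

/-- The bracket of the modes `e_m` and `e'_n`. -/
def modeBr (m n : ℤ) : E →ₗ[ℂ] E →ₗ[ℂ] (ℤ →₀ E) × ℂ :=
  LinearMap.mk₂ ℂ (fun e e' =>
      (Finsupp.single (m + n) (Q.br e e'), if m + n = 0 then (m : ℂ) * Q.form e e' else 0))
    (fun x y z => by
      ext1
      · simp
      · simp only [map_add, LinearMap.add_apply, Prod.snd_add]
        split_ifs <;> ring)
    (fun c x y => by
      ext1
      · simp
      · simp only [map_smul, LinearMap.smul_apply, Prod.smul_snd, smul_eq_mul]
        split_ifs <;> ring)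
    (fun x y z => by
      ext1
      · simp
      · simp only [map_add, Prod.snd_add]
        split_ifs <;> ring)
    (fun c x y => by
      ext1
      · simp
      · simp only [map_smul, Prod.smul_snd, smul_eq_mul]
        split_ifs <;> ring)

/-- The bracket of the affine Lie algebra on the loops. -/
def loopBr : (ℤ →₀ E) →ₗ[ℂ] (ℤ →₀ E) →ₗ[ℂ] (ℤ →₀ E) × ℂ :=
  Finsupp.lsum ℂ fun m => LinearMap.flip (Finsupp.lsum ℂ fun n => (Q.modeBr m n).flip)

theorem loopBr_single (m n : ℤ) (e e' : E) :
    Q.loopBr (Finsupp.single m e) (Finsupp.single n e') =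
      (Finsupp.single (m + n) (Q.br e e'), if m + n = 0 then (m : ℂ) * Q.form e e' else 0) := by
  simp [loopBr, modeBr]

/-- The projection to the negative modes. -/
def loopNeg : (ℤ →₀ E) →ₗ[ℂ] (ℤ →₀ E) :=
  Finsupp.lsum ℂ fun m => if m < 0 then Finsupp.lsingle m else 0

theorem loopNeg_single (m : ℤ) (e : E) :
    loopNeg (Finsupp.single m e) = if m < 0 then Finsupp.single m e else 0 := by
  rw [loopNeg, Finsupp.lsum_single]
  split_ifs <;> rfl

theorem loopBr_skew (v w : ℤ →₀ E) : Q.loopBr v w = -Q.loopBr w v := by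
  induction v using Finsupp.induction_linear with
  | zero => simp
  | add v v' h h' => rw [map_add, map_add, LinearMap.add_apply, h, h', neg_add]
  | single m e =>
    induction w using Finsupp.induction_linear with
    | zero => simp
    | add v v' h h' => rw [map_add, map_add, LinearMap.add_apply, h, h', neg_add]
    | single n e' =>
      rw [loopBr_single, loopBr_single]
      ext1
      · rw [Q.skew, add_comm m n, Finsupp.single_neg]
        rfl
      · simp only [Prod.snd_neg, Q.symm e, add_comm m n]
        split_ifs with h
        · have : (m : ℂ) = -n := by exact_mod_cast (by omega : m = -n)
          rw [this]
          ring
        · simp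

/-- By invariance of the form, the three central terms are m, m + n and -n times the same number. -/
theorem loopBr_jacobi (u v w : ℤ →₀ E) :
    Q.loopBr u (Q.loopBr v w).1 =
      Q.loopBr (Q.loopBr u v).1 w + Q.loopBr v (Q.loopBr u w).1 := by
  induction u using Finsupp.induction_linear with
  | zero => simp
  | add v v' h h' =>
    simp only [map_add, LinearMap.add_apply, h, h', Prod.fst_add]
    abel
  | single m e =>
    induction v using Finsupp.induction_linear with
    | zero => simp
    | add v v' h h' =>
      simp only [map_add, LinearMap.add_apply, h, h', Prod.fst_add]
      abel
    | single n e' =>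
      induction w using Finsupp.induction_linear with
      | zero => simp
      | add v v' h h' =>
        simp only [map_add, h, h', Prod.fst_add]
        abel
      | single l e'' =>
        simp only [loopBr_single]
        ext1
        · rw [Prod.fst_add, Q.jacobi, Finsupp.single_add, add_assoc m, add_left_comm n]
        · have h1 : Q.form e (Q.br e' e'') = Q.form (Q.br e e') e'' := (Q.inv _ _ _).symm
          have h2 : Q.form e' (Q.br e e'') = -Q.form (Q.br e e') e'' := by
            rw [← Q.inv, Q.skew e', map_neg, LinearMap.neg_apply]
          simp only [Prod.snd_add, h1, h2, add_assoc m, add_left_comm n]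
          split_ifs
          · push_cast
            ring
          · simp

/-- The affine Lie algebra with its decomposition into negative and nonnegative modes. -/
def split : SplitLieAlgebra ((ℤ →₀ E) × ℂ) where
  br := (Q.loopBr).compl₁₂ (LinearMap.fst ℂ _ _) (LinearMap.fst ℂ _ _)
  skew x y := Q.loopBr_skew _ _
  jacobi x y z := Q.loopBr_jacobi _ _ _
  neg := LinearMap.inl ℂ _ _ ∘ₗ loopNeg ∘ₗ LinearMap.fst ℂ _ _
  neg_neg := by
    rintro ⟨x, c⟩
    ext1
    · change loopNeg (loopNeg x) = loopNeg x
      induction x using Finsupp.induction_linear with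
      | zero => simp
      | add v v' h h' => simp only [map_add, h, h']
      | single m e =>
        rw [loopNeg_single]
        split_ifs with h
        · rw [loopNeg_single, if_pos h]
        · rw [map_zero]
    · rfl
  neg_br := by
    rintro ⟨x, c⟩ ⟨y, d⟩
    change (loopNeg (Q.loopBr (loopNeg x) (loopNeg y)).1, (0 : ℂ)) =
      Q.loopBr (loopNeg x) (loopNeg y)
    induction x using Finsupp.induction_linear with
    | zero => simp
    | add v v' h h' =>
      refine Eq.trans ?_ ((congrArg₂ (· + ·) h h').trans (by simp only [map_add, LinearMap.add_apply]))
      simp only [map_add, LinearMap.add_apply, Prod.fst_add, Prod.mk_add_mk, add_zero]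
    | single m e =>
      induction y using Finsupp.induction_linear with
      | zero => simp
      | add v v' h h' =>
        refine Eq.trans ?_ ((congrArg₂ (· + ·) h h').trans (by simp only [map_add]))
        simp only [map_add, Prod.fst_add, Prod.mk_add_mk, add_zero]
      | single n e' =>
        rw [loopNeg_single, loopNeg_single]
        split_ifs
        · rw [loopBr_single, loopNeg_single, if_pos (by omega), if_neg (by omega)]
        all_goals simp
  neg_br_pos := by
    rintro ⟨x, c⟩ ⟨y, d⟩
    change (loopNeg (Q.loopBr (x - loopNeg x) (y - loopNeg y)).1, (0 : ℂ)) = 0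
    refine Prod.ext ?_ rfl
    change (loopNeg (Q.loopBr (x - loopNeg x) (y - loopNeg y)).1) = 0
    induction x using Finsupp.induction_linear with
    | zero => simp
    | add v v' h h' =>
      rw [map_add, add_sub_add_comm, map_add, LinearMap.add_apply, Prod.fst_add, map_add, h, h',
        add_zero]
    | single m e =>
      induction y using Finsupp.induction_linear with
      | zero => simp
      | add v v' h h' =>
        rw [map_add, add_sub_add_comm, map_add, Prod.fst_add, map_add, h, h', add_zero]
      | single n e' =>
        rw [loopNeg_single, loopNeg_single]
        split_ifs
        iterate 3 simp
        rw [sub_zero, sub_zero, loopBr_single, loopNeg_single, if_neg (by omega)]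
  chr := LinearMap.snd ℂ _ _
  chr_br := by
    rintro ⟨x, c⟩ ⟨y, d⟩
    change (Q.loopBr (x - loopNeg x) (y - loopNeg y)).2 = 0
    induction x using Finsupp.induction_linear with
    | zero => simp
    | add v v' h h' =>
      rw [map_add, add_sub_add_comm, map_add, LinearMap.add_apply, Prod.snd_add, h, h', add_zero]
    | single m e =>
      induction y using Finsupp.induction_linear with
      | zero => simp
      | add v v' h h' =>
        rw [map_add, add_sub_add_comm, map_add, Prod.snd_add, h, h', add_zero]
      | single n e' =>
        rw [loopNeg_single, loopNeg_single]
        split_ifs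
        iterate 3 simp
        rw [sub_zero, sub_zero, loopBr_single]
        dsimp only
        split_ifs
        · rw [show m = 0 by omega, Int.cast_zero, zero_mul]
        · rfl

end QuadraticLie

/-! ### Left ideals stable under the induced action. -/

namespace SplitLieAlgebra

variable {L : Type*} [AddCommGroup L] [Module ℂ L] (S : SplitLieAlgebra L)
  (N₀ : Set S.NegEnvelope)

/-- The left ideal generated by `N₀`. -/
def leftIdeal : Submodule ℂ S.NegEnvelope := (Ideal.span N₀).restrictScalars ℂ

theorem mul_mem_leftIdeal (u : S.NegEnvelope) {v : S.NegEnvelope} (h : v ∈ S.leftIdeal N₀) :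
    u * v ∈ S.leftIdeal N₀ := (Ideal.span N₀).mul_mem_left u h

theorem subset_leftIdeal {v : S.NegEnvelope} (h : v ∈ N₀) : v ∈ S.leftIdeal N₀ :=
  Ideal.subset_span h

/-- A left ideal is automatically stable under negative elements, and `actₗ_ι_mul` moves the action
past left factors. So only the action of `ker neg` on the generators needs to be tested. -/
theorem actₗ_mem_leftIdeal (h : ∀ d ∈ N₀, ∀ l, S.actₗ (S.pos l) d ∈ S.leftIdeal N₀) (l : L)
    {v : S.NegEnvelope} (hv : v ∈ S.leftIdeal N₀) : S.actₗ l v ∈ S.leftIdeal N₀ := by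
  have key : ∀ d ∈ N₀, ∀ u l, S.actₗ l (u * d) ∈ S.leftIdeal N₀ := by
    intro d hd u
    let T : Submodule ℂ S.NegEnvelope := ⨅ l, (S.leftIdeal N₀).comap
      (S.actₗ l ∘ₗ LinearMap.mulRight ℂ d)
    have hT : ∀ u, u ∈ T ↔ ∀ l, S.actₗ l (u * d) ∈ S.leftIdeal N₀ := by
      intro u
      rw [Submodule.mem_iInf]
      rfl
    refine (hT u).1 (S.envelope_induction T ?_ (fun x u hu => ?_) u)
    · rw [hT]
      intro l
      rw [one_mul, ← S.neg_add_pos l, map_add, LinearMap.add_apply, S.actₗ_neg]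
      exact add_mem (S.mul_mem_leftIdeal N₀ _ (S.subset_leftIdeal N₀ hd)) (h d hd l)
    · rw [hT] at hu ⊢
      intro l
      rw [mul_assoc, actₗ_ι_mul]
      exact add_mem (S.mul_mem_leftIdeal N₀ _ (hu l)) (hu _)
  refine Submodule.span_induction (p := fun v _ => ∀ u, S.actₗ l (u * v) ∈ S.leftIdeal N₀)
    (fun d hd u => key d hd u l) ?_ ?_ ?_ hv 1 |> fun h => by rwa [one_mul] at h
  · intro u
    rw [mul_zero, map_zero]
    exact zero_mem _
  · intro x y _ _ hx hy u
    rw [mul_add, map_add]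
    exact add_mem (hx u) (hy u)
  · intro a x _ hx u
    rw [smul_eq_mul, ← mul_assoc]
    exact hx _

end SplitLieAlgebra

/-! ### Modes on the induced module and fields on its quotients. -/

namespace QuadraticLie

variable {E : Type*} [AddCommGroup E] [Module ℂ E] (Q : QuadraticLie E)

/-- The mode `e_n` in the induced module. -/
def mode (e : E) (n : ℤ) : Module.End ℂ Q.split.NegEnvelope :=
  Q.split.actₗ (Finsupp.single n e, 0)

/-- The mode `e_n`, for `n < 0`, as an element of the enveloping algebra. -/
def ιmode (e : E) (n : ℤ) : Q.split.NegEnvelope := Q.split.ι (Finsupp.single n e, 0)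

theorem split_neg (v : ℤ →₀ E) (c : ℂ) : Q.split.neg (v, c) = (loopNeg v, 0) := rfl

theorem split_br (v w : ℤ →₀ E) (c d : ℂ) : Q.split.br (v, c) (w, d) = Q.loopBr v w := rfl

theorem split_neg_single_of_neg {n : ℤ} (h : n < 0) (e : E) :
    Q.split.neg (Finsupp.single n e, 0) = (Finsupp.single n e, 0) := by
  rw [split_neg, loopNeg_single, if_pos h]

theorem ιmode_of_nonneg (e : E) {n : ℤ} (h : 0 ≤ n) : Q.ιmode e n = 0 := by
  rw [ιmode, ← Q.split.ι_neg, split_neg, loopNeg_single, if_neg (by omega)]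
  exact map_zero _

theorem mode_one (e : E) (n : ℤ) : Q.mode e n 1 = Q.ιmode e n := by
  rw [mode, SplitLieAlgebra.actₗ_one]
  refine add_eq_left.2 ?_
  change (0 - 0 : ℂ) • (1 : Q.split.NegEnvelope) = 0
  rw [sub_zero, zero_smul]

theorem mode_of_neg (e : E) {n : ℤ} (h : n < 0) (u : Q.split.NegEnvelope) :
    Q.mode e n u = Q.ιmode e n * u := by
  rw [mode, ← Q.split_neg_single_of_neg h, Q.split.actₗ_neg]
  rfl

/-- The centre lies in `ker neg` and `chr` is the identity on it. Hence the given form is itself the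
level. -/
theorem act_central (c : ℂ) (u : Q.split.NegEnvelope) : Q.split.actₗ (0, c) u = c • u := by
  let T : Submodule ℂ Q.split.NegEnvelope :=
    LinearMap.eqLocus (Q.split.actₗ (0, c)) (c • LinearMap.id)
  refine Q.split.envelope_induction T ?_ (fun x u hu => ?_) u
  · change Q.split.actₗ (0, c) 1 = c • 1
    rw [SplitLieAlgebra.actₗ_one, ← Q.split.ι_neg, split_neg, map_zero]
    change Q.split.ι 0 + (c - 0) • _ = _
    rw [map_zero, zero_add, sub_zero]
  · change Q.split.actₗ (0, c) u = c • u at hu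
    change Q.split.actₗ (0, c) (Q.split.ι x * u) = c • (Q.split.ι x * u)
    rw [SplitLieAlgebra.actₗ_ι_mul, hu]
    obtain ⟨x, d⟩ := x
    rw [split_neg, split_br, map_zero, LinearMap.zero_apply, map_zero, LinearMap.zero_apply,
      add_zero, mul_smul_comm]

theorem act_pair (n : ℤ) (e : E) (c : ℂ) (u : Q.split.NegEnvelope) :
    Q.split.actₗ (Finsupp.single n e, c) u = Q.mode e n u + c • u := by
  rw [← Q.act_central, mode, ← LinearMap.add_apply, ← map_add, Prod.mk_add_mk, add_zero, zero_add]

theorem mode_comm (e e' : E) (m n : ℤ) (u : Q.split.NegEnvelope) :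
    Q.mode e m (Q.mode e' n u) - Q.mode e' n (Q.mode e m u) =
      Q.mode (Q.br e e') (m + n) u + (if m + n = 0 then (m : ℂ) * Q.form e e' else 0) • u := by
  rw [mode, mode, SplitLieAlgebra.actₗ_br, split_br, loopBr_single, act_pair]

theorem ι_mem_induction (T : Submodule ℂ Q.split.NegEnvelope) {u : Q.split.NegEnvelope}
    (h : ∀ e n, n < 0 → Q.ιmode e n * u ∈ T) (x : (ℤ →₀ E) × ℂ) : Q.split.ι x * u ∈ T := by
  obtain ⟨v, c⟩ := x
  rw [← Q.split.ι_neg, split_neg]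
  induction v using Finsupp.induction_linear with
  | zero =>
    rw [map_zero, Prod.mk_zero_zero, map_zero, zero_mul]
    exact zero_mem _
  | add v w hv hw =>
    rw [map_add, ← zero_add (0 : ℂ), ← Prod.mk_add_mk, map_add, add_mul]
    exact add_mem hv hw
  | single n e =>
    rw [loopNeg_single]
    split_ifs with hn
    · exact h e n hn
    · rw [Prod.mk_zero_zero, map_zero, zero_mul]
      exact zero_mem _

theorem mode_induction (T : Submodule ℂ Q.split.NegEnvelope) (h1 : 1 ∈ T)
    (h : ∀ e n, ∀ u ∈ T, n < 0 → Q.mode e n u ∈ T) (u : Q.split.NegEnvelope) : u ∈ T :=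
  Q.split.envelope_induction T h1 (fun x u hu => Q.ι_mem_induction T
    (fun e n hn => Q.mode_of_neg e hn u ▸ h e n u hu hn) x) u

theorem mode_truncation (u : Q.split.NegEnvelope) (e : E) :
    ∃ N : ℤ, ∀ n, N ≤ n → Q.mode e n u = 0 := by
  let T : Submodule ℂ Q.split.NegEnvelope :=
    { carrier := {u | ∀ e, ∃ N : ℤ, ∀ n, N ≤ n → Q.mode e n u = 0}
      add_mem' := by
        intro a b ha hb e
        obtain ⟨N, hN⟩ := ha e
        obtain ⟨N', hN'⟩ := hb e
        refine ⟨max N N', fun n hn => ?_⟩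
        rw [map_add, hN n (by omega), hN' n (by omega), add_zero]
      zero_mem' := fun e => ⟨0, fun n _ => map_zero _⟩
      smul_mem' := by
        intro c a ha e
        obtain ⟨N, hN⟩ := ha e
        exact ⟨N, fun n hn => by rw [map_smul, hN n hn, smul_zero]⟩ }
  refine Q.mode_induction T (fun e => ⟨0, fun n hn => ?_⟩) (fun e' m u hu _ e => ?_) u e
  · rw [mode_one, ιmode_of_nonneg _ _ hn]
  · obtain ⟨N, hN⟩ := hu e
    obtain ⟨N', hN'⟩ := hu (Q.br e e')
    -- The bound 1 - m avoids the central term, which is present only when n + m = 0.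
    refine ⟨max (max N (N' - m)) (1 - m), fun n hn => ?_⟩
    have h := Q.mode_comm e e' n m u
    rw [hN n (by omega), map_zero, sub_zero, hN' _ (by omega), if_neg (by omega), zero_smul,
      add_zero] at h
    exact h

theorem actₗ_pos_mem (T : Submodule ℂ Q.split.NegEnvelope) {d : Q.split.NegEnvelope} (hd : d ∈ T)
    (h : ∀ e (m : ℕ), Q.mode e m d ∈ T) (l : (ℤ →₀ E) × ℂ) :
    Q.split.actₗ (Q.split.pos l) d ∈ T := by
  obtain ⟨v, c⟩ := l
  have hv : Q.split.pos (v, c) = (v - loopNeg v, 0) + (0, c) :=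
    Prod.ext (add_zero _).symm ((sub_zero c).trans (zero_add c).symm)
  rw [hv, map_add, LinearMap.add_apply, act_central]
  refine add_mem ?_ (Submodule.smul_mem _ _ hd)
  clear hv
  induction v using Finsupp.induction_linear with
  | zero =>
    rw [map_zero, sub_zero, Prod.mk_zero_zero, map_zero]
    exact zero_mem _
  | add v w hv hw =>
    rw [map_add, add_sub_add_comm, ← zero_add (0 : ℂ), ← Prod.mk_add_mk, map_add]
    exact add_mem hv hw
  | single n e =>
    rw [loopNeg_single]
    split_ifs with hn
    · rw [sub_self, Prod.mk_zero_zero, map_zero]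
      exact zero_mem _
    · rw [sub_zero]
      obtain ⟨m, rfl⟩ := Int.eq_ofNat_of_zero_le (not_lt.1 hn)
      exact h e m

variable (N₀ : Set Q.split.NegEnvelope)

/-- The quotient of the induced module by the submodule generated by `N₀`. -/
abbrev Quot : Type _ := Q.split.NegEnvelope ⧸ Q.split.leftIdeal N₀

variable (h : ∀ d ∈ N₀, ∀ l, Q.split.actₗ (Q.split.pos l) d ∈ Q.split.leftIdeal N₀)

/-- The field `e(z)` on the quotient. -/
def quotField (e : E) : quantumFields (Q.Quot N₀) :=
  ⟨fun n => (Q.split.leftIdeal N₀).mapQ (Q.split.leftIdeal N₀) (Q.mode e n)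
    fun _ hv => Q.split.actₗ_mem_leftIdeal N₀ h _ hv, fun v => by
      obtain ⟨u, rfl⟩ := (Q.split.leftIdeal N₀).mkQ_surjective v
      obtain ⟨N, hN⟩ := Q.mode_truncation u e
      refine ⟨N, fun n hn => ?_⟩
      exact congrArg Submodule.Quotient.mk (hN n hn)⟩

theorem quotField_mk (e : E) (n : ℤ) (u : Q.split.NegEnvelope) :
    Q.quotField N₀ h e n (Submodule.Quotient.mk u) = Submodule.Quotient.mk (Q.mode e n u) := rfl

theorem quotField_comm (e e' : E) (m n : ℤ) (v : Q.Quot N₀) :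
    Q.quotField N₀ h e m (Q.quotField N₀ h e' n v) - Q.quotField N₀ h e' n (Q.quotField N₀ h e m v) =
      Q.quotField N₀ h (Q.br e e') (m + n) v +
        (if m + n = 0 then (m : ℂ) * Q.form e e' else 0) • v := by
  obtain ⟨u, rfl⟩ := (Q.split.leftIdeal N₀).mkQ_surjective v
  simp only [Submodule.mkQ_apply, quotField_mk]
  rw [← Submodule.Quotient.mk_sub, mode_comm, Submodule.Quotient.mk_add, Submodule.Quotient.mk_smul]

/-- The fields `e(z)`, `e ∈ E`, on the quotient. -/
def generatingFields : QuantumField.GeneratingFields (Q.Quot N₀) E where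
  field := Q.quotField N₀ h
  vacuum := Submodule.Quotient.mk 1
  creative e n hn := by
    rw [quotField_mk, mode_one, ιmode_of_nonneg _ _ hn, Submodule.Quotient.mk_zero]
  isLocal e e' := by
    -- For fixed p + q the commutator is affine in p, so its second difference vanishes; this is the
    -- double pole of the operator product.
    refine ⟨2, fun v => ?_⟩
    funext p q
    have key : ∀ p q, (QuantumField.compose (Q.quotField N₀ h e) (Q.quotField N₀ h e') v -
        QuantumField.composeRev (Q.quotField N₀ h e) (Q.quotField N₀ h e') v) p q =
          Q.quotField N₀ h (Q.br e e') (p + q) v +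
        (if p + q = 0 then (p : ℂ) * Q.form e e' else 0) • v := fun p q =>
      Q.quotField_comm N₀ h e e' p q v
    rw [pow_two, Module.End.mul_apply]
    simp only [shiftDiff_apply, key]
    rw [show p + 1 + 1 + q = p + q + 2 by ring, show p + 1 + (q + 1) = p + q + 2 by ring,
      show p + (q + 1 + 1) = p + q + 2 by ring]
    split_ifs
    · push_cast
      simp only [Pi.zero_apply]
      module
    · simp
  generates T h1 hT := by
    rw [eq_top_iff]
    rintro v -
    obtain ⟨u, rfl⟩ := (Q.split.leftIdeal N₀).mkQ_surjective v
    exact Q.mode_induction (T.comap (Q.split.leftIdeal N₀).mkQ) h1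
      (fun e n u hu _ => hT e n _ hu) u

end QuadraticLie

/-! ### Functions and vector fields -/

namespace FieldsAndFunctions

variable {A : Type*} [CommRing A] [Algebra ℂ A] {𝔤 : LieSubalgebra ℂ (Derivation ℂ A A)}

/-- The semidirect product of a Lie algebra of derivations of `A` with `A`, with the form `κ`. -/
def semidirect (κ : LinearMap.BilinForm ℂ 𝔤) (hsymm : ∀ x y, κ x y = κ y x)
    (hinv : ∀ x y z, κ ⁅x, y⁆ z = κ x ⁅y, z⁆) : QuadraticLie (𝔤 × A) where
  br := LinearMap.mk₂ ℂ (fun e e' => (⁅e.1, e'.1⁆, e.1.1 e'.2 - e'.1.1 e.2))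
    (fun x y z => by
      ext1
      · simp
      · simp only [Prod.fst_add, Prod.snd_add, AddMemClass.coe_add, Derivation.add_apply, map_add]
        abel)
    (fun c x y => by
      ext1
      · simp
      · simp only [Prod.smul_fst, Prod.smul_snd, SetLike.val_smul, Derivation.smul_apply,
          Derivation.map_smul, smul_sub])
    (fun x y z => by
      ext1
      · simp
      · simp only [Prod.fst_add, Prod.snd_add, AddMemClass.coe_add, Derivation.add_apply, map_add]
        abel)
    (fun c x y => by
      ext1
      · simp
      · simp only [Prod.smul_fst, Prod.smul_snd, SetLike.val_smul, Derivation.smul_apply,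
          Derivation.map_smul, smul_sub])
  form := κ.compl₁₂ (LinearMap.fst ℂ _ _) (LinearMap.fst ℂ _ _)
  skew x y := by
    ext1
    · exact (lie_skew _ _).symm
    · simp
  jacobi x y z := by
    ext1
    · exact leibniz_lie x.1 y.1 z.1
    · simp only [LinearMap.mk₂_apply, Prod.snd_add, map_sub, LieSubalgebra.coe_bracket,
        Derivation.commutator_apply]
      abel
  symm x y := hsymm _ _
  inv x y z := hinv _ _ _

variable {κ : LinearMap.BilinForm ℂ 𝔤} {hsymm : ∀ x y, κ x y = κ y x}
  {hinv : ∀ x y z, κ ⁅x, y⁆ z = κ x ⁅y, z⁆}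

variable (κ hsymm hinv) in
/-- The enveloping algebra of the negative modes. -/
abbrev Env : Type _ := (semidirect κ hsymm hinv).split.NegEnvelope

variable (κ hsymm hinv) in
/-- The creation mode `f_n` of a function. -/
def ιfn (f : A) (n : ℤ) : Env κ hsymm hinv := (semidirect κ hsymm hinv).ιmode (0, f) n

theorem ιfn_of_nonneg (f : A) {n : ℤ} (h : 0 ≤ n) : ιfn κ hsymm hinv f n = 0 :=
  QuadraticLie.ιmode_of_nonneg _ _ h

theorem mode_fn_one (f : A) (n : ℤ) :
    (semidirect κ hsymm hinv).mode (0, f) n 1 = ιfn κ hsymm hinv f n :=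
  QuadraticLie.mode_one _ _ _

theorem br_fn (x : 𝔤) (h f : A) :
    (semidirect κ hsymm hinv).br (x, h) (0, f) = (0, x.1 f) := by
  ext1
  · exact lie_zero _
  · exact (congrArg (x.1 f - ·) (Derivation.zero_apply _)).trans (sub_zero _)

theorem form_fn (x : 𝔤) (h f : A) :
    (semidirect κ hsymm hinv).form (x, h) (0, f) = 0 := map_zero (κ x)

theorem mode_mode_fn (x : 𝔤) (h f : A) (m n : ℤ) (u : Env κ hsymm hinv) :
    (semidirect κ hsymm hinv).mode (x, h) m ((semidirect κ hsymm hinv).mode (0, f) n u) =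
      (semidirect κ hsymm hinv).mode (0, f) n ((semidirect κ hsymm hinv).mode (x, h) m u) +
      (semidirect κ hsymm hinv).mode (0, x.1 f) (m + n) u := by
  rw [← sub_eq_iff_eq_add', QuadraticLie.mode_comm, br_fn, form_fn]
  simp

theorem mode_fn_ιfn (f g : A) (m n : ℤ) (_ : n < 0) :
    (semidirect κ hsymm hinv).mode (0, f) m (ιfn κ hsymm hinv g n) =
      ιfn κ hsymm hinv f m * ιfn κ hsymm hinv g n := by
  rcases lt_or_ge m 0 with hm | hm
  · rw [QuadraticLie.mode_of_neg _ _ hm]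
    rfl
  · rw [← mode_fn_one, mode_mode_fn, mode_fn_one, ιfn_of_nonneg _ hm, map_zero, zero_mul, zero_add]
    change (semidirect κ hsymm hinv).split.actₗ (Finsupp.single (m + n) (0, (0 : 𝔤).1 g), 0) 1 = 0
    rw [show ((0 : 𝔤).1 g) = 0 from Derivation.zero_apply g, Prod.mk_zero_zero, Finsupp.single_zero,
      Prod.mk_zero_zero, map_zero, LinearMap.zero_apply]

/-- Action of a nonnegative mode on a product of two creation modes of functions. -/
theorem mode_mul (x : 𝔤) (h f g : A) {m a b : ℤ} (hm : 0 ≤ m) (ha : a < 0) (hb : b < 0) :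
    (semidirect κ hsymm hinv).mode (x, h) m (ιfn κ hsymm hinv f a * ιfn κ hsymm hinv g b) =
      ιfn κ hsymm hinv (x.1 f) (m + a) * ιfn κ hsymm hinv g b +
      ιfn κ hsymm hinv f a * ιfn κ hsymm hinv (x.1 g) (m + b) := by
  rw [← mode_fn_ιfn _ _ _ _ hb, mode_mode_fn, mode_fn_ιfn _ _ _ _ hb, ← mode_fn_one g,
    mode_mode_fn, mode_fn_one, mode_fn_one, QuadraticLie.mode_one,
    QuadraticLie.ιmode_of_nonneg _ _ hm, map_zero, zero_add, add_comm,
    QuadraticLie.mode_of_neg _ _ ha]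
  rfl

variable (κ hsymm hinv) in
/-- The coefficients of the relation between the field of a product and the product of the
fields. -/
def mulDefect (f g : A) (i : ℕ) : Env κ hsymm hinv :=
  ∑ p ∈ Finset.HasAntidiagonal.antidiagonal i, ιfn κ hsymm hinv f (-1 - p.1) * ιfn κ hsymm hinv g (-1 - p.2) -
    ιfn κ hsymm hinv (f * g) (-1 - i)

variable (κ hsymm hinv) in
/-- The coefficients of the relation between the field of `1 ∈ A` and the identity. -/
def oneDefect (i : ℕ) : Env κ hsymm hinv :=
  ιfn κ hsymm hinv 1 (-1 - i) - if i = 0 then 1 else 0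

variable (κ hsymm hinv) in
/-- The coefficients of the relations between functions. -/
def fnRel : Set (Env κ hsymm hinv) :=
  {d | (∃ f g i, mulDefect κ hsymm hinv f g i = d) ∨ ∃ i, oneDefect κ hsymm hinv i = d}

/-- Raising the first index by m kills the terms where it becomes nonnegative and leaves a
convolution of length shorter by m. -/
theorem sum_antidiagonal_shift {V : Type*} [AddCommGroup V] (G : ℤ → ℤ → V)
    (hG : ∀ a b, 0 ≤ a → G a b = 0) (m i : ℕ) :
    ∑ p ∈ Finset.HasAntidiagonal.antidiagonal i, G (m + (-1 - p.1)) (-1 - p.2) =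
      if m ≤ i then ∑ p ∈ Finset.HasAntidiagonal.antidiagonal (i - m), G (-1 - p.1) (-1 - p.2) else 0 := by
  split_ifs with h
  · obtain ⟨i, rfl⟩ := Nat.exists_eq_add_of_le h
    rw [add_tsub_cancel_left, Finset.Nat.sum_antidiagonal_eq_sum_range_succ_mk,
      Finset.Nat.sum_antidiagonal_eq_sum_range_succ_mk, Nat.succ_eq_add_one, add_assoc, Finset.sum_range_add,
      Finset.sum_eq_zero, zero_add]
    · refine Finset.sum_congr rfl fun j hj => ?_
      have := Finset.mem_range.1 hj
      congr 1
      · push_cast; ring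
      · congr 1
        omega
    · intro j hj
      have := Finset.mem_range.1 hj
      exact hG _ _ (by dsimp only; omega)
  · refine Finset.sum_eq_zero fun p hp => hG _ _ ?_
    have := Finset.HasAntidiagonal.mem_antidiagonal.1 hp
    omega

/-- By the Leibniz rule, acting on the relation for (f, g) gives the relations for (x f, g) and (f,
x g), shifted by m. The relations are thus permuted among themselves, and the left ideal they
generate is a submodule. -/
theorem mode_mulDefect (x : 𝔤) (h f g : A) (m i : ℕ) :
    (semidirect κ hsymm hinv).mode (x, h) m (mulDefect κ hsymm hinv f g i) =
      if m ≤ i then mulDefect κ hsymm hinv (x.1 f) g (i - m) + mulDefect κ hsymm hinv f (x.1 g) (i - m)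
      else 0 := by
  have e1 := sum_antidiagonal_shift (fun a b => ιfn κ hsymm hinv (x.1 f) a * ιfn κ hsymm hinv g b)
    (fun a b ha => by rw [ιfn_of_nonneg _ ha, zero_mul]) m i
  have e2 := sum_antidiagonal_shift (fun a b => ιfn κ hsymm hinv f b * ιfn κ hsymm hinv (x.1 g) a)
    (fun a b ha => by rw [ιfn_of_nonneg _ ha, mul_zero]) m i
  rw [← Finset.Nat.sum_antidiagonal_swap,
    ← Finset.Nat.sum_antidiagonal_swap (n := i - m)] at e2
  dsimp only [Prod.fst_swap, Prod.snd_swap] at e1 e2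
  rw [mulDefect, map_sub, map_sum, Finset.sum_congr rfl fun p _ => mode_mul x h f g
    (Int.natCast_nonneg m) (by omega : (-1 - (p.1 : ℤ)) < 0) (by omega : (-1 - (p.2 : ℤ)) < 0),
    Finset.sum_add_distrib, e1, e2, ← mode_fn_one, mode_mode_fn, QuadraticLie.mode_one,
    QuadraticLie.ιmode_of_nonneg _ _ (Int.natCast_nonneg m), map_zero, zero_add, mode_fn_one]
  split_ifs with hm
  · have e : (m : ℤ) + (-1 - i) = -1 - ((i - m : ℕ) : ℤ) := by omega
    have hl : ιfn κ hsymm hinv (x.1 (f * g)) (m + (-1 - i)) =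
        ιfn κ hsymm hinv (x.1 f * g) (m + (-1 - i)) + ιfn κ hsymm hinv (f * x.1 g) (m + (-1 - i)) := by
      rw [ιfn, ιfn, ιfn, QuadraticLie.ιmode, QuadraticLie.ιmode, QuadraticLie.ιmode, ← map_add,
        Prod.mk_add_mk, ← Finsupp.single_add, Prod.mk_add_mk, Derivation.leibniz, smul_eq_mul,
        smul_eq_mul, add_zero, add_zero, add_comm (f * _), mul_comm g]
    rw [hl, mulDefect, mulDefect, e]
    abel
  · rw [ιfn_of_nonneg _ (by omega), add_zero, sub_zero]

theorem mode_oneDefect (x : 𝔤) (h : A) (m i : ℕ) :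
    (semidirect κ hsymm hinv).mode (x, h) m (oneDefect κ hsymm hinv i) = 0 := by
  have h0 : (semidirect κ hsymm hinv).mode (x, h) m 1 = 0 := by
    rw [QuadraticLie.mode_one, QuadraticLie.ιmode_of_nonneg _ _ (Int.natCast_nonneg m)]
  rw [oneDefect, map_sub, ← mode_fn_one, mode_mode_fn, h0, map_zero, zero_add,
    Derivation.map_one_eq_zero, mode_fn_one, ιfn, QuadraticLie.ιmode, Prod.mk_zero_zero,
    Finsupp.single_zero, Prod.mk_zero_zero, map_zero, zero_sub]
  split_ifs
  · rw [h0, neg_zero]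
  · rw [map_zero, neg_zero]

theorem fnRel_stable : ∀ d ∈ fnRel κ hsymm hinv, ∀ l,
    (semidirect κ hsymm hinv).split.actₗ ((semidirect κ hsymm hinv).split.pos l) d ∈
      (semidirect κ hsymm hinv).split.leftIdeal (fnRel κ hsymm hinv) := by
  intro d hd l
  have hmode : ∀ (x : 𝔤) (h : A) (m : ℕ), (semidirect κ hsymm hinv).mode (x, h) m d ∈
      (semidirect κ hsymm hinv).split.leftIdeal (fnRel κ hsymm hinv) := by
    intro x h m
    rcases hd with ⟨f, g, i, rfl⟩ | ⟨i, rfl⟩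
    · rw [mode_mulDefect]
      split_ifs
      · exact add_mem (SplitLieAlgebra.subset_leftIdeal _ _ (.inl ⟨_, _, _, rfl⟩))
          (SplitLieAlgebra.subset_leftIdeal _ _ (.inl ⟨_, _, _, rfl⟩))
      · exact zero_mem _
    · rw [mode_oneDefect]
      exact zero_mem _
  exact QuadraticLie.actₗ_pos_mem _ _ (SplitLieAlgebra.subset_leftIdeal _ _ hd)
    (fun e m => hmode e.1 e.2 m) l

variable (κ hsymm hinv) in
/-- The character of the enveloping algebra given by a point of `Spec A`. -/
def pointHom (ε : A →ₐ[ℂ] ℂ) : Env κ hsymm hinv →ₐ[ℂ] ℂ :=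
  SplitLieAlgebra.lift _
    (ε.toLinearMap ∘ₗ LinearMap.snd ℂ 𝔤 A ∘ₗ Finsupp.lapply (-1 : ℤ) ∘ₗ LinearMap.fst ℂ _ _)
    (by
      rintro ⟨v, c⟩
      change ε (QuadraticLie.loopNeg v (-1)).2 = ε (v (-1)).2
      induction v using Finsupp.induction_linear with
      | zero => simp
      | add v w hv hw =>
        rw [map_add, Finsupp.add_apply, Finsupp.add_apply, Prod.snd_add, Prod.snd_add, map_add,
          map_add, hv, hw]
      | single n e =>
        rw [QuadraticLie.loopNeg_single]
        split_ifs with hn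
        · rfl
        · rw [Finsupp.single_apply, if_neg (by omega)]
          rfl)
    (by
      rintro ⟨v, c⟩ ⟨w, d⟩
      rw [mul_comm]
      refine add_eq_right.2 ?_
      change ε (((semidirect κ hsymm hinv).loopBr (QuadraticLie.loopNeg v)
        (QuadraticLie.loopNeg w)).1 (-1)).2 = 0
      induction v using Finsupp.induction_linear with
      | zero => simp
      | add v v' hv hv' =>
        rw [map_add, map_add, LinearMap.add_apply, Prod.fst_add, Finsupp.add_apply, Prod.snd_add,
          map_add, hv, hv', add_zero]
      | single n e =>
        induction w using Finsupp.induction_linear with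
        | zero => simp
        | add v v' hv hv' =>
          rw [map_add, map_add, Prod.fst_add, Finsupp.add_apply, Prod.snd_add,
            map_add, hv, hv', add_zero]
        | single m e' =>
          rw [QuadraticLie.loopNeg_single, QuadraticLie.loopNeg_single]
          split_ifs
          · rw [QuadraticLie.loopBr_single, Finsupp.single_apply, if_neg (by omega)]
            exact map_zero _
          all_goals simp)

theorem pointHom_ιfn (ε : A →ₐ[ℂ] ℂ) (f : A) (n : ℤ) :
    pointHom κ hsymm hinv ε (ιfn κ hsymm hinv f n) = if n = -1 then ε f else 0 := by
  rw [pointHom, ιfn, QuadraticLie.ιmode, SplitLieAlgebra.lift_ι]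
  change ε (Finsupp.single n ((0 : 𝔤), f) (-1)).2 = _
  rw [Finsupp.single_apply]
  split_ifs
  · rfl
  · exact map_zero _

/-- The character sending f_(-1) to ε(f) and the other function modes to 0 kills every relation
because ε is multiplicative and unital, but it sends 1 to 1. -/
theorem one_notMem_leftIdeal (ε : A →ₐ[ℂ] ℂ) :
    (1 : Env κ hsymm hinv) ∉ (semidirect κ hsymm hinv).split.leftIdeal (fnRel κ hsymm hinv) := by
  intro h
  have hle : Ideal.span (fnRel κ hsymm hinv) ≤ RingHom.ker (pointHom κ hsymm hinv ε) := by
    refine Ideal.span_le.2 ?_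
    rintro _ (⟨f, g, i, rfl⟩ | ⟨i, rfl⟩)
    · refine (RingHom.mem_ker ..).2 ?_
      rw [mulDefect, map_sub, map_sum, pointHom_ιfn, sub_eq_zero]
      simp only [map_mul, pointHom_ιfn]
      rcases i with _ | i
      · simp
      · rw [if_neg (by push_cast; omega)]
        refine Finset.sum_eq_zero fun p hp => ?_
        have := Finset.HasAntidiagonal.mem_antidiagonal.1 hp
        rcases Nat.eq_zero_or_pos p.1 with h0 | h0
        · rw [if_neg (c := -1 - (p.2 : ℤ) = -1) (by omega), mul_zero]
        · rw [if_neg (c := -1 - (p.1 : ℤ) = -1) (by omega), zero_mul]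
    · refine (RingHom.mem_ker ..).2 ?_
      rw [oneDefect, map_sub, pointHom_ιfn, map_one]
      rcases i with _ | i
      · simp
      · rw [if_neg (by push_cast; omega), if_neg (by omega), map_zero, sub_zero]
  have h1 := (RingHom.mem_ker ..).1 (hle h)
  rw [map_one] at h1
  exact one_ne_zero h1

end FieldsAndFunctions

/-! ### A commutative algebra inside a vertex algebra -/

/-- An embedding of a commutative algebra `A` in a vertex algebra as an algebra of functions. -/
structure FunctionEmbedding (A V : Type*) [CommRing A] [Algebra ℂ A] [AddCommGroup V] [Module ℂ V]
    [VertexAlgebra V] where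
  fn : A →ₗ[ℂ] V
  fn_one : fn 1 = vac
  fn_mul : ∀ a b, fn (a * b) = nprod (-1) (fn a) (fn b)
  nprod_fn : ∀ a b (n : ℤ), 0 ≤ n → nprod n (fn a) (fn b) = 0

namespace FunctionEmbedding

variable {A V : Type*} [CommRing A] [Algebra ℂ A] [AddCommGroup V] [Module ℂ V]
    [VertexAlgebra V] (F : FunctionEmbedding A V)

theorem fn_comm (a b : A) (v : V) (m n : ℤ) :
    nprod m (F.fn a) (nprod n (F.fn b) v) = nprod n (F.fn b) (nprod m (F.fn a) v) := by
  rw [VertexAlgebra.nprod_comm, binSum_eq_zero, add_zero]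
  intro j
  rw [F.nprod_fn _ _ _ (Int.natCast_nonneg j), map_zero, LinearMap.zero_apply]

/-- The subspace of vectors that are annihilated by the nonnegative modes of functions. -/
def annihilated : Submodule ℂ V where
  carrier := {v | ∀ a (n : ℤ), 0 ≤ n → nprod n (F.fn a) v = 0}
  add_mem' hu hv a n hn := by rw [map_add, hu a n hn, hv a n hn, add_zero]
  zero_mem' _ _ _ := map_zero _
  smul_mem' c v hv a n hn := by rw [map_smul, hv a n hn, smul_zero]

theorem nprod_mem_annihilated (a : A) (n : ℤ) {v : V} (hv : v ∈ F.annihilated) :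
    nprod n (F.fn a) v ∈ F.annihilated := fun b m hm => by
  rw [F.fn_comm, hv b m hm, map_zero]

theorem vac_mem_annihilated : vac ∈ F.annihilated := fun _ _ hn =>
  VertexAlgebra.nprod_vac_of_nonneg _ _ hn

/-- The products a_(-1) are not associative in general. The correction terms contain nonnegative
modes of functions applied to v, which is why v is taken in `annihilated`. -/
theorem fn_mul_nprod (a b : A) {v : V} (hv : v ∈ F.annihilated) :
    nprod (-1) (F.fn (a * b)) v = nprod (-1) (F.fn a) (nprod (-1) (F.fn b) v) := by
  rw [F.fn_mul, VertexAlgebra.neg_one_nprod_nprod, altSum_eq_single,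
    altSum_eq_zero, add_zero]
  · simp
  · intro j
    rw [hv a _ (Int.natCast_nonneg j), map_zero]
  · intro j
    rw [hv b _ (by push_cast; omega), map_zero]

/-- `annihilated` is an `A`-module under `a_(-1)`. -/
instance : Module A F.annihilated where
  smul a v := ⟨nprod (-1) (F.fn a) v, F.nprod_mem_annihilated a _ v.2⟩
  one_smul v := Subtype.ext (by
    change nprod (-1) (F.fn 1) v.1 = v.1
    rw [F.fn_one, VertexAlgebra.vac_nprod, if_pos rfl])
  mul_smul a b v := Subtype.ext (F.fn_mul_nprod a b v.2)
  smul_zero a := Subtype.ext (map_zero _)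
  smul_add a v w := Subtype.ext (map_add _ _ _)
  add_smul a b v := Subtype.ext (by
    change nprod (-1) (F.fn (a + b)) v.1 = _
    rw [map_add, map_add]
    rfl)
  zero_smul v := Subtype.ext (by
    change nprod (-1) (F.fn 0) v.1 = 0
    rw [map_zero, map_zero, LinearMap.zero_apply])

theorem coe_fn_smul (a : A) (v : F.annihilated) : ((a • v : F.annihilated) : V) =
    nprod (-1) (F.fn a) v := rfl

instance : IsScalarTower ℂ A F.annihilated where
  smul_assoc c a v := Subtype.ext (by
    rw [coe_fn_smul, map_smul, map_smul]
    rfl)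

/-- The derivation `a ↦ a_(-2) 1`. -/
def derivation : Derivation ℂ A F.annihilated :=
  Derivation.mk'
    { toFun := fun a => ⟨nprod (-2) (F.fn a) vac, F.nprod_mem_annihilated a _ F.vac_mem_annihilated⟩
      map_add' := fun a b => Subtype.ext (by
        change nprod (-2) (F.fn (a + b)) vac = _
        rw [map_add, map_add]
        rfl)
      map_smul' := fun c a => Subtype.ext (by
        change nprod (-2) (F.fn (c • a)) vac = _
        rw [map_smul, map_smul]
        rfl) }
    fun a b => Subtype.ext (by
      change nprod (-2) (F.fn (a * b)) vac = nprod (-1) (F.fn a) (nprod (-2) (F.fn b) vac) +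
        nprod (-1) (F.fn b) (nprod (-2) (F.fn a) vac)
      -- Since b_(-2+j) vac = 0 for j ≥ 2, only the terms j = 0 and j = 1 remain; they are the two
      -- terms of the Leibniz rule.
      rw [F.fn_mul, VertexAlgebra.neg_one_nprod_nprod,
        altSum_eq_zero (X := fun j : ℕ => nprod (-2 - 1 - j) (F.fn b) (nprod j (F.fn a) vac)), add_zero,
        altSum_neg_one, finsum_eq_sum_of_support_subset _ (s := Finset.range 2),
        Finset.sum_range_succ, Finset.sum_range_one, F.fn_comm b a]
      · norm_num
      · intro j hj
        by_contra hj'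
        refine hj ?_
        have : 1 < j := by simpa using hj'
        exact (congrArg _ (VertexAlgebra.nprod_vac_of_nonneg _ _ (by omega))).trans (map_zero _)
      · intro j
        rw [VertexAlgebra.nprod_vac_of_nonneg _ _ (Int.natCast_nonneg j), map_zero])

/-- The map of the `1`-forms to the vertex algebra. -/
def form : Ω[A⁄ℂ] →ₗ[A] F.annihilated := F.derivation.liftKaehlerDifferential

theorem form_D (a : A) : (F.form (KaehlerDifferential.D ℂ A a) : V) = nprod (-2) (F.fn a) vac :=
  congrArg Subtype.val (Derivation.liftKaehlerDifferential_comp_D _ a)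

theorem form_smul (a : A) (w : Ω[A⁄ℂ]) : (F.form (a • w) : V) = nprod (-1) (F.fn a) (F.form w) := by
  rw [map_smul]
  rfl

theorem form_induction (S : Submodule ℂ V)
    (h : ∀ a b, nprod (-1) (F.fn a) (nprod (-2) (F.fn b) vac) ∈ S) (w : Ω[A⁄ℂ]) :
    (F.form w : V) ∈ S := by
  have hw : w ∈ Submodule.span A (Set.range (KaehlerDifferential.D ℂ A)) := by
    rw [KaehlerDifferential.span_range_derivation]
    trivial
  induction hw using Submodule.closure_induction with
  | zero => simp
  | add x y hx hy h1 h2 =>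
    rw [map_add]
    exact add_mem h1 h2
  | smul_mem a x hx =>
    obtain ⟨b, rfl⟩ := hx
    rw [form_smul, form_D]
    exact h a b

end FunctionEmbedding

/-! ### Residue products read off from a commutator. -/

namespace QuantumField

variable {M : Type*} [AddCommGroup M] [Module ℂ M]

theorem prod_eq_zero_of_le {a b : quantumFields M} {N : ℕ}
    (h : ∀ v, (shiftDiff ^ N) (compose a b v - composeRev a b v) = 0) {n : ℤ} (hn : N ≤ n) :
    prod n a b = 0 := by
  ext k v
  rw [prod_eq_borcherdsRight, borcherdsRight_eq_zero h v 0 hn]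
  rfl

section

variable {a b c : quantumFields M} {r : ℂ}
  (h : ∀ m n v, a m (b n v) - b n (a m v) = c (m + n) v + (if m + n = 0 then (m : ℂ) * r else 0) • v)

include h

/-- The hypothesis says that a(z) b(w) has a simple pole with coefficient c and a double pole with
coefficient r. The residue products extract these, and all higher ones vanish. -/
theorem prod_zero_of_commutator : prod 0 a b = c := by
  ext k v
  rw [prod_apply, leftExpand, rightExpand, altSum_zero, altSum_zero, zpow_zero, one_smul]
  simp only [compose, composeRev, Nat.cast_zero, sub_zero, add_zero, zero_add, h]
  simp

theorem prod_one_of_commutator : prod 1 a b = r • identity M := by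
  have e : ∀ X : ℕ → M, altSum 1 X = X 0 - X 1 := fun X => by
    rw [altSum_eq_binSum, binSum_one]
    simp [sub_eq_add_neg]
  ext k v
  rw [prod_apply, leftExpand, rightExpand, e, e]
  simp only [compose, composeRev, Nat.cast_zero, sub_zero, add_zero, Nat.cast_one, sub_self,
    zpow_one, smul_apply, identity_apply]
  have h1 := h 1 k v
  have h0 := h 0 (k + 1) v
  rw [Int.cast_zero, zero_mul, ite_self, zero_smul, add_zero, zero_add] at h0
  rw [add_comm 1 k] at h1 ⊢
  rw [add_sub_cancel_right]
  have : (if k + 1 = 0 then ((1 : ℤ) : ℂ) * r else 0) • v = r • if k = -1 then v else 0 := by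
    by_cases hk : k = -1
    · rw [if_pos hk, if_pos (by omega), Int.cast_one, one_mul]
    · rw [if_neg hk, if_neg (by omega), zero_smul, smul_zero]
  rw [← this, ← add_sub_cancel_left (c (k + 1) v) (_ • v), ← h1, ← h0]
  module

theorem prod_eq_zero_of_commutator {n : ℤ} (hn : 2 ≤ n) : prod n a b = 0 := by
  refine prod_eq_zero_of_le (N := 2) (fun v => ?_) hn
  funext p q
  have key : ∀ p q, (compose a b v - composeRev a b v) p q =
      c (p + q) v + (if p + q = 0 then (p : ℂ) * r else 0) • v := fun p q => h p q v
  rw [pow_two, Module.End.mul_apply]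
  simp only [shiftDiff_apply, key]
  rw [show p + 1 + 1 + q = p + q + 2 by ring, show p + 1 + (q + 1) = p + q + 2 by ring,
    show p + (q + 1 + 1) = p + q + 2 by ring]
  split_ifs
  · push_cast
    simp only [Pi.zero_apply]
    module
  · simp

end

end QuantumField

/-! ### States of the generated vertex algebra. -/

namespace QuantumField.GeneratingFields

variable {M Y : Type*} [AddCommGroup M] [Module ℂ M] (G : GeneratingFields M Y)

/-- The vertex algebra generated by the fields. -/
def StateSpace : Type _ := G.space

instance : AddCommGroup G.StateSpace := inferInstanceAs (AddCommGroup G.space)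

instance : Module ℂ G.StateSpace := inferInstanceAs (Module ℂ G.space)

instance : VertexAlgebra G.StateSpace := inferInstanceAs (VertexAlgebra G.space)

theorem nprod_coe (n : ℤ) (a b : G.StateSpace) : (nprod n a b).1 = prod n a.1 b.1 := rfl

theorem vac_coe : (vac : G.StateSpace).1 = identity _ := rfl

theorem coe_eq_of_vacuum {a b : G.StateSpace}
    (h : ∀ i : ℕ, a.1 (-1 - i) G.vacuum = b.1 (-1 - i) G.vacuum) : a = b := by
  refine sub_eq_zero.1 (Subtype.ext (GeneratingFields.eq_zero_of_vacuum (G := G)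
    (a - b).2 fun n => ?_))
  change a.1 n G.vacuum - b.1 n G.vacuum = 0
  rcases lt_or_ge n 0 with hn | hn
  · obtain ⟨i, rfl⟩ : ∃ i : ℕ, n = -1 - i := ⟨(-1 - n).toNat, by omega⟩
    rw [h, sub_self]
  · rw [creative_of_mem a.2 hn, creative_of_mem b.2 hn, sub_self]

/-- A generating field as an element of the vertex algebra. -/
def gen (y : Y) : G.StateSpace := ⟨G.field y, field_mem y⟩

/-- On the vacuum, the modes of y_(-1) z are finite convolutions of creation modes, since
nonnegative modes kill the vacuum. Hence relations between vectors of the module suffice for an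
equality of fields. -/
theorem gen_eq_nprod {y z w : Y} (h : ∀ i : ℕ, ∑ p ∈ Finset.HasAntidiagonal.antidiagonal i,
      G.field y (-1 - p.1) (G.field z (-1 - p.2) G.vacuum) = G.field w (-1 - i) G.vacuum) :
    G.gen w = nprod (-1) (G.gen y) (G.gen z) := by
  refine G.coe_eq_of_vacuum fun i => ?_
  rw [nprod_coe, prod_apply, leftExpand, rightExpand, altSum_eq_zero (X := fun j : ℕ =>
      composeRev (G.gen y).1 (G.gen z).1 G.vacuum j (-1 + (-1 - i) - j)), smul_zero, sub_zero,
      altSum_neg_one]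
  · refine (h i).symm.trans ?_
    rw [Finset.Nat.sum_antidiagonal_eq_sum_range_succ_mk,
      finsum_eq_sum_of_support_subset _ (s := Finset.range i.succ)]
    · refine Finset.sum_congr rfl fun j hj => ?_
      have := Finset.mem_range.1 hj
      rw [compose, show -1 - (i : ℤ) + j = -1 - ((i - j : ℕ) : ℤ) by omega]
      rfl
    · intro j hj
      by_contra hj'
      have : i < j := by simpa using hj'
      refine hj ?_
      change compose _ _ _ _ _ = 0
      rw [compose, creative_of_mem (G.gen z).2 (by omega), map_zero]
  · intro j
    rw [composeRev, creative_of_mem (G.gen y).2 (by omega), map_zero]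

theorem gen_eq_vac {y : Y}
    (h : ∀ i : ℕ, G.field y (-1 - i) G.vacuum = if i = 0 then G.vacuum else 0) : G.gen y = vac := by
  refine G.coe_eq_of_vacuum fun i => ?_
  rw [vac_coe, identity_apply]
  refine (h i).trans ?_
  split_ifs <;> first | rfl | omega

theorem vac_ne_zero (h : G.vacuum ≠ 0) : (vac : G.StateSpace) ≠ 0 := by
  intro h0
  have h1 := congrArg (fun a : G.StateSpace => a.1 (-1) G.vacuum) h0
  beta_reduce at h1
  rw [vac_coe, identity_apply, if_pos rfl] at h1
  exact h h1

end QuantumField.GeneratingFields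

/-! ### Products of the generating fields of a quotient. -/

namespace QuadraticLie

open QuantumField

variable {E : Type*} [AddCommGroup E] [Module ℂ E] (Q : QuadraticLie E) (N₀ : Set Q.split.NegEnvelope)
  (h : ∀ d ∈ N₀, ∀ l, Q.split.actₗ (Q.split.pos l) d ∈ Q.split.leftIdeal N₀)

/-- The elements `e ∈ E` of the vertex algebra. -/
def gen : E →ₗ[ℂ] (Q.generatingFields N₀ h).StateSpace where
  toFun := (Q.generatingFields N₀ h).gen
  map_add' e e' := by
    refine Subtype.ext (QuantumField.ext' fun n v => ?_)
    obtain ⟨u, rfl⟩ := Submodule.Quotient.mk_surjective _ v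
    refine congrArg Submodule.Quotient.mk (?_ : Q.mode (e + e') n u =
      Q.mode e n u + Q.mode e' n u)
    rw [QuadraticLie.mode, QuadraticLie.mode, QuadraticLie.mode, Finsupp.single_add,
      ← zero_add (0 : ℂ), ← Prod.mk_add_mk, map_add, zero_add, LinearMap.add_apply]
  map_smul' c e := by
    refine Subtype.ext (QuantumField.ext' fun n v => ?_)
    obtain ⟨u, rfl⟩ := Submodule.Quotient.mk_surjective _ v
    refine congrArg Submodule.Quotient.mk (?_ : Q.mode (c • e) n u = c • Q.mode e n u)
    rw [QuadraticLie.mode, QuadraticLie.mode, ← Finsupp.smul_single, ← smul_zero c,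
      ← Prod.smul_mk, map_smul, smul_zero, LinearMap.smul_apply]

theorem nprod_zero_gen (e e' : E) : nprod 0 (Q.gen N₀ h e) (Q.gen N₀ h e') =
    Q.gen N₀ h (Q.br e e') :=
  Subtype.ext (prod_zero_of_commutator (Q.quotField_comm N₀ h e e'))

theorem nprod_one_gen (e e' : E) : nprod 1 (Q.gen N₀ h e) (Q.gen N₀ h e') =
    Q.form e e' • vac :=
  Subtype.ext (prod_one_of_commutator (Q.quotField_comm N₀ h e e'))

theorem nprod_gen_eq_zero {n : ℤ} (hn : 2 ≤ n) (e e' : E) :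
    nprod n (Q.gen N₀ h e) (Q.gen N₀ h e') = 0 :=
  Subtype.ext (prod_eq_zero_of_commutator (Q.quotField_comm N₀ h e e') hn)

theorem nprod_gen_eq_zero_of_form {n : ℤ} (hn : 1 ≤ n) {e e' : E} (hf : Q.form e e' = 0) :
    nprod n (Q.gen N₀ h e) (Q.gen N₀ h e') = 0 := by
  rcases hn.eq_or_lt with rfl | hn
  · rw [nprod_one_gen, hf, zero_smul]
  · exact Q.nprod_gen_eq_zero N₀ h hn _ _

theorem nprod_gen_eq_zero_of_comm {n : ℤ} (hn : 0 ≤ n) {e e' : E} (hf : Q.form e e' = 0)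
    (hb : Q.br e e' = 0) : nprod n (Q.gen N₀ h e) (Q.gen N₀ h e') = 0 := by
  rcases hn.eq_or_lt with rfl | hn
  · rw [nprod_zero_gen, hb, map_zero]
  · exact Q.nprod_gen_eq_zero_of_form N₀ h hn hf

theorem gen_eq_nprod {e e' e'' : E} (hd : ∀ i : ℕ, ∑ p ∈ Finset.HasAntidiagonal.antidiagonal i,
      Q.mode e (-1 - p.1) (Q.ιmode e' (-1 - p.2)) - Q.ιmode e'' (-1 - i) ∈ N₀) :
    Q.gen N₀ h e'' = nprod (-1) (Q.gen N₀ h e) (Q.gen N₀ h e') := by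
  refine (Q.generatingFields N₀ h).gen_eq_nprod fun i => ?_
  have h1 := Q.split.subset_leftIdeal N₀ (hd i)
  rw [← Submodule.Quotient.mk_eq_zero, Submodule.Quotient.mk_sub, sub_eq_zero] at h1
  simp only [← mode_one] at h1
  rw [← Submodule.mkQ_apply, map_sum] at h1
  exact h1

theorem gen_eq_vac {e : E} (hd : ∀ i : ℕ, Q.ιmode e (-1 - i) - (if i = 0 then 1 else 0) ∈ N₀) :
    Q.gen N₀ h e = vac := by
  refine (Q.generatingFields N₀ h).gen_eq_vac fun i => ?_
  have h1 := Q.split.subset_leftIdeal N₀ (hd i)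
  rw [← Submodule.Quotient.mk_eq_zero, Submodule.Quotient.mk_sub, sub_eq_zero, ← mode_one] at h1
  refine Eq.trans h1 ?_
  split_ifs <;> rfl

theorem vac_ne_zero (h1 : 1 ∉ Q.split.leftIdeal N₀) :
    (vac : (Q.generatingFields N₀ h).StateSpace) ≠ 0 :=
  (Q.generatingFields N₀ h).vac_ne_zero fun h0 => h1 ((Submodule.Quotient.mk_eq_zero _).1 h0)

end QuadraticLie

/-- A vertex algebra containing functions and a Lie algebra of vector fields with their standard
products. -/
structure VertexFields {A : Type*} [CommRing A] [Algebra ℂ A]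
    {𝔤 : LieSubalgebra ℂ (Derivation ℂ A A)} (κ : LinearMap.BilinForm ℂ 𝔤) (V : Type*)
    [AddCommGroup V] [Module ℂ V] [VertexAlgebra V] extends FunctionEmbedding A V where
  vf : 𝔤 →ₗ[ℂ] V
  nprod_zero_vf_fn : ∀ x f, nprod 0 (vf x) (fn f) = fn (x.1 f)
  nprod_zero_fn_vf : ∀ x f, nprod 0 (fn f) (vf x) = -fn (x.1 f)
  nprod_vf_fn : ∀ x f (n : ℤ), 1 ≤ n → nprod n (vf x) (fn f) = 0
  nprod_fn_vf : ∀ x f (n : ℤ), 1 ≤ n → nprod n (fn f) (vf x) = 0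
  nprod_zero_vf : ∀ x y, nprod 0 (vf x) (vf y) = vf ⁅x, y⁆
  nprod_one_vf : ∀ x y, nprod 1 (vf x) (vf y) = κ x y • vac
  nprod_vf : ∀ x y (n : ℤ), 2 ≤ n → nprod n (vf x) (vf y) = 0

/-! ### The model vertex algebra of functions and vector fields. -/

namespace FieldsAndFunctions

variable {A : Type*} [CommRing A] [Algebra ℂ A] {𝔤 : LieSubalgebra ℂ (Derivation ℂ A A)}
  (κ : LinearMap.BilinForm ℂ 𝔤) (hsymm : ∀ x y, κ x y = κ y x)
  (hinv : ∀ x y z, κ ⁅x, y⁆ z = κ x ⁅y, z⁆)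

theorem br_apply (e e' : 𝔤 × A) : (semidirect κ hsymm hinv).br e e' =
    (⁅e.1, e'.1⁆, e.1.1 e'.2 - e'.1.1 e.2) := rfl

theorem form_apply (e e' : 𝔤 × A) : (semidirect κ hsymm hinv).form e e' = κ e.1 e'.1 := rfl

theorem fnRel_one (i : ℕ) : (semidirect κ hsymm hinv).ιmode (0, 1) (-1 - i) -
    (if i = 0 then 1 else 0) ∈ fnRel κ hsymm hinv := .inr ⟨i, rfl⟩

theorem fnRel_mul (f g : A) (i : ℕ) : ∑ p ∈ Finset.HasAntidiagonal.antidiagonal i,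
      (semidirect κ hsymm hinv).mode (0, f) (-1 - p.1)
        ((semidirect κ hsymm hinv).ιmode (0, g) (-1 - p.2)) -
        (semidirect κ hsymm hinv).ιmode (0, f * g) (-1 - i) ∈ fnRel κ hsymm hinv := by
  rw [Finset.sum_congr rfl fun p _ => mode_fn_ιfn (κ := κ) (hsymm := hsymm) (hinv := hinv) f g
    (-1 - p.1) (-1 - p.2) (by omega)]
  exact .inl ⟨f, g, i, rfl⟩

/-- The vertex algebra generated by the fields. -/
abbrev FieldAlgebra : Type _ :=
  ((semidirect κ hsymm hinv).generatingFields (fnRel κ hsymm hinv) fnRel_stable).StateSpace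

/-- The functions and vector fields in `FieldAlgebra`. -/
def vertexFields : VertexFields κ (FieldAlgebra κ hsymm hinv) where
  fn := (semidirect κ hsymm hinv).gen _ fnRel_stable ∘ₗ LinearMap.inr ℂ 𝔤 A
  vf := (semidirect κ hsymm hinv).gen _ fnRel_stable ∘ₗ LinearMap.inl ℂ 𝔤 A
  fn_one := QuadraticLie.gen_eq_vac _ _ fnRel_stable (fnRel_one κ hsymm hinv)
  fn_mul f g := QuadraticLie.gen_eq_nprod _ _ fnRel_stable (fnRel_mul κ hsymm hinv f g)
  nprod_fn f g n hn := QuadraticLie.nprod_gen_eq_zero_of_comm _ _ fnRel_stable hn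
    (by rw [form_apply]; exact map_zero _) (by rw [br_apply]; ext1 <;> simp)
  nprod_zero_vf_fn x f := by
    simp only [LinearMap.comp_apply, LinearMap.inr_apply, LinearMap.inl_apply]
    rw [QuadraticLie.nprod_zero_gen, br_apply]
    simp
  nprod_zero_fn_vf x f := by
    simp only [LinearMap.comp_apply, LinearMap.inr_apply, LinearMap.inl_apply]
    rw [QuadraticLie.nprod_zero_gen, br_apply, ← map_neg]
    simp
  nprod_vf_fn x f n hn := QuadraticLie.nprod_gen_eq_zero_of_form _ _ fnRel_stable hn
    (by rw [form_apply]; exact map_zero _)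
  nprod_fn_vf x f n hn := QuadraticLie.nprod_gen_eq_zero_of_form _ _ fnRel_stable hn
    (by rw [form_apply]; exact LinearMap.map_zero₂ _ _)
  nprod_zero_vf x y := by
    simp only [LinearMap.comp_apply, LinearMap.inl_apply]
    rw [QuadraticLie.nprod_zero_gen, br_apply]
    simp
  nprod_one_vf x y := QuadraticLie.nprod_one_gen _ _ fnRel_stable _ _
  nprod_vf x y n hn := QuadraticLie.nprod_gen_eq_zero _ _ fnRel_stable hn _ _

theorem vac_ne_zero (ε : A →ₐ[ℂ] ℂ) : (vac : FieldAlgebra κ hsymm hinv) ≠ 0 :=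
  QuadraticLie.vac_ne_zero _ _ fnRel_stable (one_notMem_leftIdeal ε)

end FieldsAndFunctions

/-! ### Nontriviality of the algebra of chiral differential operators -/

namespace VertexFields

open VertexPresentation VertexAlgebra

section

variable {A : Type*} [CommRing A] [Algebra ℂ A] {𝔤 : LieSubalgebra ℂ (Derivation ℂ A A)}
  {κ : LinearMap.BilinForm ℂ 𝔤} {V : Type*} [AddCommGroup V] [Module ℂ V] [VertexAlgebra V]
  (F : VertexFields κ V)

/-- The functions and vector fields. -/
def mainGen : A ⊕ 𝔤 → V := Sum.elim F.fn F.vf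

/-- The weights of functions and vector fields. -/
def mainWt : A ⊕ 𝔤 → ℕ := Sum.elim (fun _ => 0) fun _ => 1

theorem nprod_mainGen_mem (y z : A ⊕ 𝔤) (n : ℤ) (hn : 0 ≤ n) :
    nprod n (F.mainGen y) (F.mainGen z) ∈
      generatorSpan mainWt F.mainGen ((mainWt y : ℤ) + (mainWt z : ℤ) - n - 1) := by
  have hgen : ∀ (y : A ⊕ 𝔤) (w : ℤ), (mainWt y : ℤ) = w →
      F.mainGen y ∈ generatorSpan mainWt F.mainGen w := fun y w h =>
    Submodule.subset_span (.inr ⟨y, h, rfl⟩)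
  rcases y with f | x <;> rcases z with g | y
  · change nprod n (F.fn f) (F.fn g) ∈ _
    rw [F.nprod_fn f g n hn]
    exact zero_mem _
  · change nprod n (F.fn f) (F.vf y) ∈ _
    rcases hn.eq_or_lt with rfl | hn
    · rw [F.nprod_zero_fn_vf]
      exact neg_mem (hgen (.inl (y.1 f)) _ rfl)
    · rw [F.nprod_fn_vf _ _ _ hn]
      exact zero_mem _
  · change nprod n (F.vf x) (F.fn g) ∈ _
    rcases hn.eq_or_lt with rfl | hn
    · rw [F.nprod_zero_vf_fn]
      exact hgen (.inl (x.1 g)) _ rfl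
    · rw [F.nprod_vf_fn _ _ _ hn]
      exact zero_mem _
  · change nprod n (F.vf x) (F.vf y) ∈ _
    rcases hn.eq_or_lt with rfl | hn
    · rw [F.nprod_zero_vf]
      exact hgen (.inr ⁅x, y⁆) _ rfl
    · rcases eq_or_ne n 1 with rfl | hn1
      · rw [F.nprod_one_vf]
        exact Submodule.smul_mem _ _ (Submodule.subset_span (.inl ⟨rfl, rfl⟩))
      · rw [F.nprod_vf _ _ _ (by omega)]
        exact zero_mem _

theorem fn_mem_creationSpan (f : A) : F.fn f ∈ creationSpan mainWt F.mainGen 0 :=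
  generator_mem_creationSpan (wt := mainWt) (g := F.mainGen) (.inl f)

theorem vf_mem_creationSpan (x : 𝔤) : F.vf x ∈ creationSpan mainWt F.mainGen 1 :=
  generator_mem_creationSpan (wt := mainWt) (g := F.mainGen) (.inr x)

theorem nprod_fn_mem_creationSpan (f : A) {n w : ℤ} (hn : n < 0) {v : V}
    (hv : v ∈ creationSpan mainWt F.mainGen w) :
    nprod n (F.fn f) v ∈ creationSpan mainWt F.mainGen (w - n - 1) := by
  have h := nprod_neg_mem_creationSpan (wt := mainWt) (g := F.mainGen) (.inl f) hn hv
  rwa [show (mainWt (.inl f : A ⊕ 𝔤) : ℤ) = 0 from rfl, add_zero] at h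

theorem form_mem_creationSpan (w : Ω[A⁄ℂ]) : (F.form w : V) ∈ creationSpan mainWt F.mainGen 1 :=
  F.form_induction _ (fun a b => F.nprod_fn_mem_creationSpan a (by norm_num)
    (F.nprod_fn_mem_creationSpan b (by norm_num) vac_mem_creationSpan)) w

end

section

variable {A : Type*} [CommRing A] [HopfAlgebra ℂ A]
  {κ : LinearMap.BilinForm ℂ (leftInvariantFields A)} {V : Type*} [AddCommGroup V] [Module ℂ V]
  [VertexAlgebra V] (F : VertexFields κ V) {ι : Type*} [Fintype ι] [DecidableEq ι]
  (b : Module.Basis ι ℂ (leftInvariantFields A)) (c : ι → Derivation ℂ A A →ₗ[A] A)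

/-- The image of a vector field. -/
def vfMap : Derivation ℂ A A →ₗ[ℂ] V :=
  ∑ i, (nprod (-1)).flip (F.vf (b i)) ∘ₗ F.fn ∘ₗ (c i).restrictScalars ℂ

variable {b c} (hc : ∀ i j, c i (b j) = if i = j then 1 else 0)

-- An invariant field has constant coefficients in the basis, so the constants can be moved from the
-- function to the field by ℂ-linearity; associativity of a_(-1) is not involved.
include hc in
theorem vfMap_smul (a : A) (x : leftInvariantFields A) :
    F.vfMap b c (a • (x : Derivation ℂ A A)) = nprod (-1) (F.fn a) (F.vf x) := by
  have hx : ∀ i, c i (x : Derivation ℂ A A) = b.repr x i • 1 := by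
    intro i
    have h : (x : Derivation ℂ A A) = ∑ j, b.repr x j • (b j : Derivation ℂ A A) := by
      have h := congrArg (leftInvariantFields A).toSubmodule.subtype (b.sum_repr x)
      rw [map_sum] at h
      exact h.symm
    conv_lhs => rw [h]
    rw [map_sum]
    simp only [LinearMap.map_smul_of_tower, hc]
    simp
  rw [vfMap, LinearMap.sum_apply]
  conv_rhs => rw [← b.sum_repr x]
  rw [map_sum, map_sum]
  refine Finset.sum_congr rfl fun i _ => ?_
  simp only [LinearMap.comp_apply, LinearMap.restrictScalars_apply, map_smul, smul_eq_mul, hx,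
    mul_smul_comm, mul_one, LinearMap.flip_apply]

/-- The images of the generators of chiral differential operators. -/
def cdoGen (b : Module.Basis ι ℂ (leftInvariantFields A)) (c : ι → Derivation ℂ A A →ₗ[A] A) :
    CDOGen A → V
  | .fn a => F.fn a
  | .vf x => F.vfMap b c x
  | .form w => F.form w

include hc in
theorem cdoGen_rel (r : Free (CDOGen A)) (hr : CDORel κ r) : freeEval (F.cdoGen b c) r = 0 := by
  have hvf : ∀ x : leftInvariantFields A, F.vfMap b c (x : Derivation ℂ A A) = F.vf x := by
    intro x
    rw [← one_smul A (x : Derivation ℂ A A), F.vfMap_smul hc, F.fn_one, VertexAlgebra.vac_nprod,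
      if_pos rfl]
  cases hr with
  | fn_add f g => simp [cdoGen]
  | fn_smul r f => simp [cdoGen]
  | vf_add x y => simp [cdoGen]
  | vf_smul r x => simp [cdoGen]
  | form_add w v => simp [cdoGen]
  | fn_one => simp [cdoGen, F.fn_one]
  | fn_mul f g => simp [cdoGen, F.fn_mul]
  | fn_form f w => 
    rw [map_sub, freeEval_mul, freeEval_gen, freeEval_gen, freeEval_gen, sub_eq_zero]
    exact F.form_smul f w
  | form_d f => simp [cdoGen, F.form_D]
  | fn_vf f x => simp [cdoGen, F.vfMap_smul hc, hvf, -map_smul]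
  | vf_fn x f => simp [cdoGen, hvf, F.nprod_zero_vf_fn]
  | bracket x y => simp [cdoGen, hvf, F.nprod_zero_vf, -LieSubalgebra.coe_bracket]
  | pairing x y => simp [cdoGen, hvf, F.nprod_one_vf]

omit [DecidableEq ι] in
theorem cdoGen_mem (x : CDOGen A) :
    F.cdoGen b c x ∈ creationSpan mainWt F.mainGen (CDOGen.wt x) := by
  cases x with
  | fn f => exact F.fn_mem_creationSpan f
  | vf D =>
    have h : F.vfMap b c D ∈ creationSpan mainWt F.mainGen 1 := by
      rw [vfMap, LinearMap.sum_apply]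
      refine Submodule.sum_mem _ fun i _ => ?_
      have h := F.nprod_fn_mem_creationSpan (c i D) (n := -1) (by norm_num)
        (F.vf_mem_creationSpan (b i))
      rwa [show (1 : ℤ) - -1 - 1 = 1 by norm_num] at h
    exact h
  | form w => exact F.form_mem_creationSpan w

-- The universal property supplies a morphism to V, and morphisms preserve the vacuum.
include F hc in
theorem cdo_vac_ne_zero (h : (vac : V) ≠ 0) : (vac : ChiralDiffOps κ) ≠ 0 := by
  intro h0
  have := (envelopeLift (wt := CDOGen.wt) (R := CDORel κ) (F.cdoGen b c) (F.cdoGen_rel hc)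
    (eval_eq_zero_of_deg_neg F.nprod_mainGen_mem F.cdoGen_mem)).map_vac
  rw [h0, map_zero] at this
  exact h this.symm

end

end VertexFields

/-! ### Invariant vector fields and forms -/

namespace InvariantFields

open Coalgebra

variable {A : Type*} [CommRing A] [HopfAlgebra ℂ A]

/-- The convolution `f ↦ ∑ f₁ • δ(f₂)`. -/
def conv {N : Type*} [AddCommGroup N] [Module ℂ N] [Module A N] [IsScalarTower ℂ A N]
    (δ : A →ₗ[ℂ] N) : A ⊗[ℂ] A →ₗ[ℂ] N :=
  TensorProduct.lift ((Algebra.lsmul ℂ ℂ N (A := A)).toLinearMap.compl₂ δ)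

section

variable {N : Type*} [AddCommGroup N] [Module ℂ N] [Module A N] [IsScalarTower ℂ A N]

@[simp] theorem conv_tmul (δ : A →ₗ[ℂ] N) (a b : A) : conv δ (a ⊗ₜ b) = a • δ b := rfl

end

/-- Derivations along the counit. -/
def IsPointDerivation {N : Type*} [AddCommGroup N] [Module ℂ N] (δ : A →ₗ[ℂ] N) : Prop :=
  ∀ f g, δ (f * g) = counit (R := ℂ) f • δ g + counit (R := ℂ) g • δ f

/-- The value of a vector field at the unit. -/
def atUnit (x : Derivation ℂ A A) : A →ₗ[ℂ] ℂ := counit (R := ℂ) ∘ₗ (x : A →ₗ[ℂ] A)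

/-- The operator `f ↦ ∑ f₁ ξ(f₂)`. -/
def translate (ξ : A →ₗ[ℂ] ℂ) : A ⊗[ℂ] A →ₗ[ℂ] A :=
  (TensorProduct.rid ℂ A).toLinearMap ∘ₗ ξ.lTensor A

@[simp] theorem translate_tmul (ξ : A →ₗ[ℂ] ℂ) (a b : A) : translate ξ (a ⊗ₜ b) = ξ b • a := rfl

theorem translate_counit_comul (f : A) : translate (counit (R := ℂ)) (comul (R := ℂ) f) = f := by
  rw [translate, LinearMap.comp_apply, lTensor_counit_comul]
  simp

theorem translate_mul {ξ : A →ₗ[ℂ] ℂ} (h : IsPointDerivation ξ) (s t : A ⊗[ℂ] A) :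
    translate ξ (s * t) = translate (counit (R := ℂ)) s * translate ξ t +
      translate (counit (R := ℂ)) t * translate ξ s := by
  induction s with
  | zero => simp
  | add s s' hs hs' => simp only [add_mul, map_add, hs, hs', mul_add]; ring
  | tmul a b =>
    induction t with
    | zero => simp
    | add t t' ht ht' => simp only [mul_add, map_add, ht, ht', add_mul]; ring
    | tmul c d =>
      simp only [Algebra.TensorProduct.tmul_mul_tmul, translate_tmul, h b d, smul_eq_mul,
        Algebra.smul_def, map_mul, map_add]
      ring

/-- Coassociativity: f ↦ ∑ f₁ ξ(f₂) is left invariant for every functional ξ. -/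
theorem comul_translate (ξ : A →ₗ[ℂ] ℂ) (f : A) : comul (R := ℂ) (translate ξ (comul (R := ℂ) f)) =
    (translate ξ ∘ₗ comul (R := ℂ)).lTensor A (comul (R := ℂ) f) := by
  have h1 : ∀ (s : A ⊗[ℂ] A) (b : A),
      (translate ξ).lTensor A (TensorProduct.assoc ℂ A A A (s ⊗ₜ b)) = ξ b • s := by
    intro s b
    induction s with
    | zero => simp
    | add s s' hs hs' => rw [TensorProduct.add_tmul, map_add, map_add, hs, hs', smul_add]
    | tmul c d => simp
  have h2 : ∀ t : A ⊗[ℂ] A, comul (R := ℂ) (translate ξ t) =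
      (translate ξ).lTensor A (TensorProduct.assoc ℂ A A A ((comul (R := ℂ)).rTensor A t)) := by
    intro t
    induction t with
    | zero => simp
    | add s s' hs hs' => simp only [map_add, hs, hs']
    | tmul a b => rw [LinearMap.rTensor_tmul, h1, translate_tmul, map_smul]
  rw [h2, coassoc_apply, LinearMap.lTensor_comp, LinearMap.comp_apply]

/-- The left invariant vector field with a given value at the unit. -/
def ofAtUnit {ξ : A →ₗ[ℂ] ℂ} (h : IsPointDerivation ξ) : leftInvariantFields A :=
  ⟨Derivation.mk' (translate ξ ∘ₗ comul (R := ℂ)) fun f g => by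
    simp only [LinearMap.comp_apply, Bialgebra.comul_mul, translate_mul h, translate_counit_comul,
      smul_eq_mul], fun f => comul_translate ξ f⟩

theorem eq_translate (x : leftInvariantFields A) (f : A) :
    (x : Derivation ℂ A A) f = translate (atUnit (x : Derivation ℂ A A)) (comul (R := ℂ) f) := by
  conv_lhs => rw [← translate_counit_comul ((x : Derivation ℂ A A) f), x.2 f]
  rw [translate, translate, LinearMap.comp_apply, LinearMap.comp_apply, atUnit,
    LinearMap.lTensor_comp, LinearMap.comp_apply]

theorem atUnit_ofAtUnit {ξ : A →ₗ[ℂ] ℂ} (h : IsPointDerivation ξ) :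
    atUnit (ofAtUnit h : Derivation ℂ A A) = ξ := by
  ext f
  have h1 : ∀ t : A ⊗[ℂ] A, counit (R := ℂ) (translate ξ t) =
      ξ (TensorProduct.lid ℂ A ((counit (R := ℂ)).rTensor A t)) := by
    intro t
    induction t with
    | zero => simp
    | add s s' hs hs' => simp only [map_add, hs, hs']
    | tmul a b => simp [mul_comm]
  change counit (R := ℂ) (translate ξ (comul (R := ℂ) f)) = ξ f
  rw [h1, rTensor_counit_comul]
  simp

theorem ext_atUnit {x y : leftInvariantFields A}
    (h : ∀ f, counit (R := ℂ) ((x : Derivation ℂ A A) f) = counit (R := ℂ) ((y : Derivation ℂ A A) f)) :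
    x = y := by
  have : atUnit (x : Derivation ℂ A A) = atUnit (y : Derivation ℂ A A) := LinearMap.ext h
  exact Subtype.ext (Derivation.ext fun f => by rw [eq_translate, eq_translate, this])

/-- By the Leibniz rule at the unit, an invariant field is determined by its values there on
finitely many algebra generators. -/
instance [Algebra.FiniteType ℂ A] : Module.Finite ℂ (leftInvariantFields A) := by
  obtain ⟨s, hs⟩ := Algebra.FiniteType.out (R := ℂ) (A := A)
  let φ : leftInvariantFields A →ₗ[ℂ] (s → ℂ) := LinearMap.pi fun a =>
    { toFun := fun x => counit (R := ℂ) ((x : Derivation ℂ A A) a)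
      map_add' := fun x y => by simp
      map_smul' := fun c x => by simp }
  refine Module.Finite.of_injective φ fun x y hxy => ext_atUnit fun f => ?_
  have hf : f ∈ Algebra.adjoin ℂ (s : Set A) := by rw [hs]; trivial
  induction hf using Algebra.adjoin_induction with
  | mem a ha => exact congrFun hxy ⟨a, ha⟩
  | algebraMap r => simp
  | add a b _ _ ha hb => rw [map_add, map_add, map_add, map_add, ha, hb]
  | mul a b _ _ ha hb => simp [ha, hb]

/-- The Maurer–Cartan form `f ↦ ∑ S(f₁) d f₂`. -/
def invariantForm : A →ₗ[ℂ] Ω[A⁄ℂ] :=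
  conv (KaehlerDifferential.D ℂ A : A →ₗ[ℂ] Ω[A⁄ℂ]) ∘ₗ
    (HopfAlgebra.antipode ℂ (A := A)).rTensor A ∘ₗ comul (R := ℂ)

/-- The antipode is multiplicative on a commutative Hopf algebra, and ∑ S(f₁) f₂ = ε(f). -/
theorem isPointDerivation_invariantForm : IsPointDerivation (invariantForm (A := A)) := by
  intro f g
  have h : ∀ s t : A ⊗[ℂ] A,
      conv (KaehlerDifferential.D ℂ A : A →ₗ[ℂ] Ω[A⁄ℂ])
        ((HopfAlgebra.antipode ℂ (A := A)).rTensor A (s * t)) =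
      LinearMap.mul' ℂ A ((HopfAlgebra.antipode ℂ (A := A)).rTensor A s) •
        conv (KaehlerDifferential.D ℂ A : A →ₗ[ℂ] Ω[A⁄ℂ])
          ((HopfAlgebra.antipode ℂ (A := A)).rTensor A t) +
      LinearMap.mul' ℂ A ((HopfAlgebra.antipode ℂ (A := A)).rTensor A t) •
        conv (KaehlerDifferential.D ℂ A : A →ₗ[ℂ] Ω[A⁄ℂ])
          ((HopfAlgebra.antipode ℂ (A := A)).rTensor A s) := by
    intro s t
    induction s with
    | zero => simp
    | add s s' hs hs' => simp only [add_mul, map_add, hs, hs', add_smul, smul_add]; abel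
    | tmul a b =>
      induction t with
      | zero => simp
      | add t t' ht ht' => simp only [mul_add, map_add, ht, ht', add_smul, smul_add]; abel
      | tmul c d =>
        simp only [Algebra.TensorProduct.tmul_mul_tmul, LinearMap.rTensor_tmul, conv_tmul,
          LinearMap.mul'_apply, HopfAlgebra.antipode_mul_distrib, Derivation.coeFn_coe,
          Derivation.leibniz, smul_add, smul_smul]
        congr 2 <;> ring
  simp only [invariantForm, LinearMap.comp_apply, Bialgebra.comul_mul, h,
    HopfAlgebra.mul_antipode_rTensor_comul_apply, algebraMap_smul]

/-- ∑ f₁ S(f₂) df₃ = df, by coassociativity and the antipode axiom: every differential is an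
A-combination of Maurer–Cartan forms. -/
theorem conv_invariantForm (f : A) :
    conv (invariantForm (A := A)) (comul (R := ℂ) f) = KaehlerDifferential.D ℂ A f := by
  set d : A →ₗ[ℂ] Ω[A⁄ℂ] := (KaehlerDifferential.D ℂ A : A →ₗ[ℂ] Ω[A⁄ℂ]) with hd
  let ψ : A ⊗[ℂ] (A ⊗[ℂ] A) →ₗ[ℂ] Ω[A⁄ℂ] :=
    TensorProduct.lift ((Algebra.lsmul ℂ ℂ Ω[A⁄ℂ] (A := A)).toLinearMap.compl₂
      (conv d ∘ₗ (HopfAlgebra.antipode ℂ (A := A)).rTensor A))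
  have h1 : ∀ t, conv (invariantForm (A := A)) t = ψ ((comul (R := ℂ)).lTensor A t) := by
    intro t
    induction t with
    | zero => simp
    | add s s' hs hs' => simp only [map_add, hs, hs']
    | tmul a b => rfl
  have h2 : ∀ (s : A ⊗[ℂ] A) (b : A), ψ (TensorProduct.assoc ℂ A A A (s ⊗ₜ b)) =
      LinearMap.mul' ℂ A ((HopfAlgebra.antipode ℂ (A := A)).lTensor A s) • d b := by
    intro s b
    induction s with
    | zero => simp
    | add s s' hs hs' => rw [TensorProduct.add_tmul, map_add, map_add, hs, hs', map_add, map_add, add_smul]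
    | tmul c e => 
      change c • (HopfAlgebra.antipode ℂ e • d b) = (c * HopfAlgebra.antipode ℂ e) • d b
      rw [smul_smul]
  have h3 : ∀ t, ψ (TensorProduct.assoc ℂ A A A ((comul (R := ℂ)).rTensor A t)) =
      d (TensorProduct.lid ℂ A ((counit (R := ℂ)).rTensor A t)) := by
    intro t
    induction t with
    | zero => simp
    | add s s' hs hs' => simp only [map_add, hs, hs']
    | tmul a b =>
      rw [LinearMap.rTensor_tmul, h2, HopfAlgebra.mul_antipode_lTensor_comul_apply]
      simp
  rw [h1, ← coassoc_apply, h3, rTensor_counit_comul]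
  simp [hd]

/-- By left invariance ∑ S(f₁) x(f₂) = ∑ S((xf)₁) (xf)₂, which is the constant ε(xf). -/
theorem lift_invariantForm (x : leftInvariantFields A) (f : A) :
    (x : Derivation ℂ A A).liftKaehlerDifferential (invariantForm f) =
      algebraMap ℂ A (counit (R := ℂ) ((x : Derivation ℂ A A) f)) := by
  have h : ∀ t : A ⊗[ℂ] A, (x : Derivation ℂ A A).liftKaehlerDifferential
      (conv (KaehlerDifferential.D ℂ A : A →ₗ[ℂ] Ω[A⁄ℂ])
        ((HopfAlgebra.antipode ℂ (A := A)).rTensor A t)) =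
      LinearMap.mul' ℂ A ((HopfAlgebra.antipode ℂ (A := A)).rTensor A
        ((x : A →ₗ[ℂ] A).lTensor A t)) := by
    intro t
    induction t with
    | zero => simp
    | add s s' hs hs' => simp only [map_add, hs, hs']
    | tmul a b => simp
  rw [invariantForm, LinearMap.comp_apply, LinearMap.comp_apply, h]
  erw [← x.2 f]
  rw [HopfAlgebra.mul_antipode_rTensor_comul_apply]

end InvariantFields

open Coalgebra in
/-- A basis of the invariant vector fields with functions whose differentials at the unit form the
dual basis. -/
structure InvariantFrame (A : Type*) [CommRing A] [HopfAlgebra ℂ A] (ι : Type*) [DecidableEq ι] where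
  basis : Module.Basis ι ℂ (leftInvariantFields A)
  coord : ι → A
  counit_basis_coord : ∀ i j, counit (R := ℂ) ((basis i : Derivation ℂ A A) (coord j)) =
    if i = j then 1 else 0

namespace InvariantFrame

open Coalgebra InvariantFields

variable {A : Type*} [CommRing A] [HopfAlgebra ℂ A]

/-- The map f ↦ (x_i f)(e) is onto: a functional vanishing on its range is a linear combination of
the x_i that vanishes at the unit, hence zero. -/
theorem exists_frame [Algebra.FiniteType ℂ A] :
    Nonempty (InvariantFrame A (Module.Free.ChooseBasisIndex ℂ (leftInvariantFields A))) := by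
  set b := Module.Free.chooseBasis ℂ (leftInvariantFields A)
  let φ : A →ₗ[ℂ] (Module.Free.ChooseBasisIndex ℂ (leftInvariantFields A) → ℂ) :=
    LinearMap.pi fun i => atUnit (b i : Derivation ℂ A A)
  have hφ : LinearMap.range φ = ⊤ := by
    by_contra h
    obtain ⟨f, hf0, hf⟩ := Submodule.exists_le_ker_of_lt_top _ (lt_top_iff_ne_top.2 h)
    refine hf0 ?_
    have hx : ∑ i, f (Pi.single i 1) • b i = 0 := ext_atUnit fun a => by
      have ha : f (φ a) = 0 := hf ⟨a, rfl⟩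
      rw [← LinearMap.sum_single_apply (fun _ => ℂ) (φ a), map_sum] at ha
      have h1 : ((∑ i, f (Pi.single i 1) • b i : leftInvariantFields A) : Derivation ℂ A A) =
          ∑ i, f (Pi.single i 1) • (b i : Derivation ℂ A A) :=
        map_sum (leftInvariantFields A).toSubmodule.subtype _ _
      have h2 : ((0 : leftInvariantFields A) : Derivation ℂ A A) = 0 := rfl
      rw [h1, h2, ← Derivation.coeFnAddMonoidHom_apply, map_sum, Finset.sum_apply, map_sum,
        Derivation.zero_apply, map_zero, ← ha]
      refine Finset.sum_congr rfl fun i _ => ?_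
      rw [Derivation.coeFnAddMonoidHom_apply, Derivation.smul_apply, map_smul,
        show (Pi.single i (φ a i) : Module.Free.ChooseBasisIndex ℂ (leftInvariantFields A) → ℂ) =
          φ a i • Pi.single i 1 by rw [← Pi.single_smul, smul_eq_mul, mul_one], map_smul,
        smul_eq_mul, smul_eq_mul, mul_comm]
      rfl
    have hc := Fintype.linearIndependent_iff.1 b.linearIndependent _ hx
    refine LinearMap.pi_ext' fun i => LinearMap.ext_ring ?_
    simpa using hc i
  choose t ht using fun j => LinearMap.range_eq_top.1 hφ (Pi.single j 1)
  refine ⟨⟨b, t, fun i j => ?_⟩⟩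
  have := congrFun (ht j) i
  rw [Pi.single_apply] at this
  exact this

variable {ι : Type*} [Fintype ι] [DecidableEq ι] (F : InvariantFrame A ι)

theorem coe_eq_sum (x : leftInvariantFields A) :
    (x : Derivation ℂ A A) = ∑ i, F.basis.repr x i • (F.basis i : Derivation ℂ A A) := by
  have h := congrArg (leftInvariantFields A).toSubmodule.subtype (F.basis.sum_repr x)
  rw [map_sum] at h
  exact h.symm

theorem counit_coord (x : leftInvariantFields A) (j : ι) :
    counit (R := ℂ) ((x : Derivation ℂ A A) (F.coord j)) = F.basis.repr x j := by
  rw [F.coe_eq_sum, ← Derivation.coeFnAddMonoidHom_apply, map_sum, Finset.sum_apply, map_sum]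
  simp [F.counit_basis_coord]

/-- After composition with a functional on N, a point derivation is the value at the unit of an
invariant field, which can be expanded in the basis. -/
theorem pointDerivation_eq_sum {N : Type*} [AddCommGroup N] [Module ℂ N] {δ : A →ₗ[ℂ] N}
    (h : IsPointDerivation δ) (f : A) :
    δ f = ∑ i, counit (R := ℂ) ((F.basis i : Derivation ℂ A A) f) • δ (F.coord i) := by
  rw [← sub_eq_zero, ← Module.forall_dual_apply_eq_zero_iff ℂ]
  intro l
  have hl : IsPointDerivation (l ∘ₗ δ) := fun f g => by
    simp only [LinearMap.comp_apply, h f g, map_add, map_smul]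
  have h1 : ∀ f, l (δ f) = counit (R := ℂ) ((ofAtUnit hl : Derivation ℂ A A) f) := fun f =>
    (LinearMap.congr_fun (atUnit_ofAtUnit hl) f).symm
  rw [map_sub, map_sum, sub_eq_zero]
  simp only [map_smul, h1, F.counit_coord]
  conv_lhs => rw [F.coe_eq_sum (ofAtUnit hl), ← Derivation.coeFnAddMonoidHom_apply, map_sum,
    Finset.sum_apply, map_sum]
  simp [mul_comm]

/-- The basis of invariant forms. -/
def form (i : ι) : Ω[A⁄ℂ] := invariantForm (F.coord i)

/-- Expand the Maurer–Cartan form in df = ∑ f₁ ω(f₂). From this formula follow the expansions of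
arbitrary fields and forms in the frame, with A-linear coefficients. -/
theorem D_eq_sum (f : A) : KaehlerDifferential.D ℂ A f =
    ∑ i, (F.basis i : Derivation ℂ A A) f • F.form i := by
  have h : ∀ t : A ⊗[ℂ] A, conv (invariantForm (A := A)) t =
      ∑ i, translate (atUnit (F.basis i : Derivation ℂ A A)) t • F.form i := by
    intro t
    induction t with
    | zero => simp
    | add s s' hs hs' => simp only [map_add, hs, hs', add_smul, Finset.sum_add_distrib]
    | tmul a b =>
      rw [conv_tmul, F.pointDerivation_eq_sum isPointDerivation_invariantForm b, Finset.smul_sum]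
      refine Finset.sum_congr rfl fun i _ => ?_
      rw [translate_tmul, smul_assoc, smul_comm]
      rfl
  rw [← conv_invariantForm, h]
  simp only [eq_translate]

/-- The coefficients of a vector field. -/
def coeff (D : Derivation ℂ A A) (i : ι) : A := D.liftKaehlerDifferential (F.form i)

theorem apply_eq_sum (D : Derivation ℂ A A) (f : A) :
    D f = ∑ i, F.coeff D i * (F.basis i : Derivation ℂ A A) f := by
  rw [← D.liftKaehlerDifferential_comp_D f, F.D_eq_sum, map_sum]
  refine Finset.sum_congr rfl fun i _ => ?_
  rw [map_smul, smul_eq_mul, mul_comm]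
  rfl

theorem eq_sum (D : Derivation ℂ A A) :
    D = ∑ i, F.coeff D i • (F.basis i : Derivation ℂ A A) := by
  ext f
  rw [F.apply_eq_sum D f, ← Derivation.coeFnAddMonoidHom_apply, map_sum, Finset.sum_apply]
  rfl

theorem coeff_invariant (x : leftInvariantFields A) (i : ι) :
    F.coeff (x : Derivation ℂ A A) i = algebraMap ℂ A (F.basis.repr x i) := by
  rw [coeff, form, lift_invariantForm, counit_coord]

theorem coeff_basis (i j : ι) :
    F.coeff (F.basis j : Derivation ℂ A A) i = if i = j then 1 else 0 := by
  rw [coeff_invariant, Module.Basis.repr_self, Finsupp.single_apply]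
  simp [eq_comm]

/-- The coefficients as linear functions of the vector field. -/
def coeffHom (i : ι) : Derivation ℂ A A →ₗ[A] A :=
  LinearMap.applyₗ (F.form i) ∘ₗ
    (KaehlerDifferential.linearMapEquivDerivation ℂ A (M := A)).symm.toLinearMap

omit [Fintype ι] in
theorem coeffHom_apply (i : ι) (D : Derivation ℂ A A) : F.coeffHom i D = F.coeff D i := rfl

omit [Fintype ι] in
theorem coeff_add (D D' : Derivation ℂ A A) (i : ι) :
    F.coeff (D + D') i = F.coeff D i + F.coeff D' i := map_add (F.coeffHom i) D D'

omit [Fintype ι] in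
theorem coeff_smul (a : A) (D : Derivation ℂ A A) (i : ι) :
    F.coeff (a • D) i = a * F.coeff D i := map_smul (F.coeffHom i) a D

theorem coeff_sum_smul (a : ι → A) (i : ι) :
    F.coeff (∑ j, a j • (F.basis j : Derivation ℂ A A)) i = a i := by
  rw [← coeffHom_apply, map_sum]
  simp [coeffHom_apply, coeff_basis]

theorem form_eq_sum (w : Ω[A⁄ℂ]) :
    w = ∑ i, (F.basis i : Derivation ℂ A A).liftKaehlerDifferential w • F.form i := by
  have hw : w ∈ Submodule.span A (Set.range (KaehlerDifferential.D ℂ A)) := by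
    rw [KaehlerDifferential.span_range_derivation]
    trivial
  induction hw using Submodule.closure_induction with
  | zero => simp
  | add x y hx hy h1 h2 =>
    conv_lhs => rw [h1, h2]
    simp only [map_add, add_smul, Finset.sum_add_distrib]
  | smul_mem a x hx =>
    obtain ⟨b, rfl⟩ := hx
    conv_lhs => rw [F.D_eq_sum]
    simp [Finset.smul_sum, smul_smul]

include F in
/-- A form is determined by its values on the invariant fields. -/
theorem form_ext {w w' : Ω[A⁄ℂ]} (h : ∀ x : leftInvariantFields A,
    (x : Derivation ℂ A A).liftKaehlerDifferential w =
      (x : Derivation ℂ A A).liftKaehlerDifferential w') : w = w' := by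
  rw [F.form_eq_sum w, F.form_eq_sum w']
  simp only [h]

theorem lift_form (x : leftInvariantFields A) (i : ι) :
    (x : Derivation ℂ A A).liftKaehlerDifferential (F.form i) = algebraMap ℂ A (F.basis.repr x i) :=
  F.coeff_invariant x i

end InvariantFrame

/-! ### Ideals stable under invariant vector fields -/

theorem IsIdempotentElem.eq_zero_or_eq_one_of_connected {R : Type*} [CommRing R]
    [ConnectedSpace (PrimeSpectrum R)] {e : R} (he : IsIdempotentElem e) : e = 0 ∨ e = 1 := by
  have key : ∀ f : R, IsIdempotentElem f →
      (PrimeSpectrum.basicOpen f : Set (PrimeSpectrum R)) = ∅ → f = 0 := by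
    intro f hf h
    have h' : PrimeSpectrum.basicOpen f = ⊥ := TopologicalSpace.Opens.ext h
    obtain ⟨n, hn⟩ := (PrimeSpectrum.basicOpen_eq_bot_iff f).1 h'
    have := hf.pow_succ_eq n
    rw [pow_succ, hn, zero_mul] at this
    exact this.symm
  rcases isClopen_iff.1 (PrimeSpectrum.isClopen_iff.2 ⟨e, he, rfl⟩) with h | h
  · exact .inl (key e he h)
  · refine .inr (sub_eq_zero.1 (key _ he.one_sub ?_)).symm
    rw [PrimeSpectrum.basicOpen_eq_zeroLocus_compl, Set.compl_univ_iff] at h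
    rw [← PrimeSpectrum.zeroLocus_eq_basicOpen_of_isIdempotentElem e he, h]

section Point

variable {A : Type*} [CommRing A] [Algebra ℂ A] (p : A →ₐ[ℂ] ℂ)

/-- The differential of functions at a point, as a derivation to the cotangent space. -/
def cotangentDerivation : Derivation ℂ A (RingHom.ker p).Cotangent :=
  Derivation.mk'
    ((RingHom.ker p).toCotangent.restrictScalars ℂ ∘ₗ
      LinearMap.codRestrict ((RingHom.ker p).restrictScalars ℂ)
        (LinearMap.id - Algebra.linearMap ℂ A ∘ₗ p.toLinearMap) fun f => by
        change f - algebraMap ℂ A (p f) ∈ RingHom.ker p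
        simp [RingHom.mem_ker])
    fun f g => by
      have hm : ∀ f, f - algebraMap ℂ A (p f) ∈ RingHom.ker p := fun f => by simp [RingHom.mem_ker]
      have key : (RingHom.ker p).toCotangent ⟨f * g - algebraMap ℂ A (p (f * g)), hm _⟩ =
          f • (RingHom.ker p).toCotangent ⟨g - algebraMap ℂ A (p g), hm _⟩ +
          g • (RingHom.ker p).toCotangent ⟨f - algebraMap ℂ A (p f), hm _⟩ := by
        rw [← map_smul, ← map_smul, ← map_add, Ideal.toCotangent_eq]
        have := Ideal.mul_mem_mul (hm f) (hm g)
        rw [← pow_two] at this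
        convert neg_mem this using 1
        simp only [Submodule.coe_add, Submodule.coe_smul, smul_eq_mul, map_mul]
        ring
      exact key

theorem cotangentDerivation_apply {f : A} (hf : f ∈ RingHom.ker p) :
    cotangentDerivation p f = (RingHom.ker p).toCotangent ⟨f, hf⟩ := by
  refine congrArg (RingHom.ker p).toCotangent (Subtype.ext ?_)
  change f - algebraMap ℂ A (p f) = f
  rw [RingHom.mem_ker.1 hf, map_zero, sub_zero]

/-- The Leibniz rule: a field that is the identity on m / m² acts as n on m^n / m^(n+1). -/
theorem euler_pow {E : Derivation ℂ A A} {m : Ideal A} (hE : ∀ f, E f ∈ m)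
    (hE' : ∀ f ∈ m, E f - f ∈ m ^ 2) (n : ℕ) : ∀ f ∈ m ^ n, E f - n • f ∈ m ^ (n + 1) := by
  induction n with
  | zero => 
    intro f _
    simpa using hE f
  | succ n ih =>
    intro f hf
    rw [pow_succ] at hf
    induction hf using Submodule.mul_induction_on' with
    | mem_mul_mem g hg h hh =>
      have h1 := Ideal.mul_mem_mul hg (hE' h hh)
      have h2 := Ideal.mul_mem_mul hh (ih g hg)
      rw [← pow_add] at h1
      rw [← pow_succ'] at h2
      convert add_mem h1 h2 using 1
      simp only [Derivation.leibniz, smul_eq_mul, nsmul_eq_mul]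
      push_cast
      ring
    | add f _ g _ hf hg =>
      convert add_mem hf hg using 1
      rw [map_add, smul_add]
      abel

theorem exists_algHom_ker_eq [Algebra.FiniteType ℂ A] (m : Ideal A) [m.IsMaximal] :
    ∃ p : A →ₐ[ℂ] ℂ, RingHom.ker p = m := by
  let _ := Ideal.Quotient.field m
  have : Module.Finite ℂ (A ⧸ m) := finite_of_finite_type_of_isJacobsonRing ℂ (A ⧸ m)
  have hb := IsAlgClosed.algebraMap_bijective_of_isIntegral (k := ℂ) (K := A ⧸ m)
  let e := AlgEquiv.ofBijective (Algebra.ofId ℂ (A ⧸ m)) hb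
  refine ⟨e.symm.toAlgHom.comp (Ideal.Quotient.mkₐ ℂ m), ?_⟩
  ext f
  rw [RingHom.mem_ker]
  change e.symm (Ideal.Quotient.mk m f) = 0 ↔ _
  rw [EmbeddingLike.map_eq_zero_iff, Ideal.Quotient.eq_zero_iff_mem]

end Point

namespace InvariantFrame

open Coalgebra InvariantFields

variable {A : Type*} [CommRing A] [HopfAlgebra ℂ A] {ι : Type*} [Fintype ι] [DecidableEq ι]
  (F : InvariantFrame A ι)

include F in
/-- At every point there is an Euler vector field to first order. -/
theorem exists_euler (p : A →ₐ[ℂ] ℂ) : ∃ s : ι → A, (∀ i, s i ∈ RingHom.ker p) ∧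
    ∀ f ∈ RingHom.ker p, (∑ i, s i • (F.basis i : Derivation ℂ A A)) f - f ∈ RingHom.ker p ^ 2 := by
  choose s hs using fun i => (RingHom.ker p).toCotangent_surjective
    ((cotangentDerivation p).liftKaehlerDifferential (F.form i))
  refine ⟨fun i => s i, fun i => (s i).2, fun f hf => ?_⟩
  have h := (cotangentDerivation p).liftKaehlerDifferential_comp_D f
  rw [cotangentDerivation_apply p hf, F.D_eq_sum, map_sum] at h
  simp only [map_smul, ← hs] at h
  simp only [← map_smul, ← map_sum, Ideal.toCotangent_eq] at h
  convert h using 1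
  rw [← Derivation.coeFnAddMonoidHom_apply, map_sum, Finset.sum_apply,
    ← Submodule.subtype_apply, map_sum]
  simp [mul_comm]

-- If I ⊆ m^n with n ≥ 1 and f is in I, the Euler field E sends f into m · m^n by stability, while E
-- f ≡ n f modulo m^(n+1). In characteristic zero f is then in m^(n+1). So I lies in all powers of
-- m, and Krull's intersection theorem provides r.
include F in
theorem exists_mul_eq_self [Algebra.FiniteType ℂ A] {I : Ideal A}
    (hI : ∀ (x : leftInvariantFields A), ∀ f ∈ I, (x : Derivation ℂ A A) f ∈ I)
    {m : Ideal A} [m.IsMaximal] (hm : I ≤ m) {f : A} (hf : f ∈ I) : ∃ r ∈ m, r * f = f := by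
  obtain ⟨p, rfl⟩ := exists_algHom_ker_eq m
  obtain ⟨s, hs, hE⟩ := F.exists_euler p
  set E := ∑ i, s i • (F.basis i : Derivation ℂ A A) with hEdef
  have hEf : ∀ g, E g = ∑ i, s i * (F.basis i : Derivation ℂ A A) g := fun g => by
    rw [hEdef, ← Derivation.coeFnAddMonoidHom_apply, map_sum, Finset.sum_apply]
    rfl
  have hE1 : ∀ g, E g ∈ RingHom.ker p := fun g => by
    rw [hEf]
    exact sum_mem fun i _ => Ideal.mul_mem_right _ _ (hs i)
  have hpow : ∀ n, I ≤ RingHom.ker p ^ (n + 1) := by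
    intro n
    induction n with
    | zero => rwa [zero_add, pow_one]
    | succ n ih =>
      intro g hg
      have h1 := euler_pow hE1 hE (n + 1) g (ih hg)
      have h2 : E g ∈ RingHom.ker p ^ (n + 1 + 1) := by
        rw [hEf]
        refine sum_mem fun i _ => ?_
        rw [pow_succ']
        exact Ideal.mul_mem_mul (hs i) (ih (hI _ _ hg))
      have h3 := sub_mem h2 h1
      rw [sub_sub_cancel] at h3
      have h4 := Ideal.mul_mem_left _ (algebraMap ℂ A ((n + 1 : ℕ) : ℂ)⁻¹) h3
      rwa [nsmul_eq_mul, ← mul_assoc, ← map_natCast (algebraMap ℂ A) (n + 1), ← map_mul,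
        inv_mul_cancel₀ (by exact_mod_cast n.succ_ne_zero), map_one, one_mul] at h4
  have := Algebra.FiniteType.isNoetherianRing ℂ A
  obtain ⟨r, hr⟩ := (Ideal.mem_iInf_smul_pow_eq_bot_iff (M := A) (RingHom.ker p) f).1 (by
    rw [Submodule.mem_iInf]
    intro i
    rw [smul_eq_mul, Ideal.mul_top]
    exact Ideal.pow_le_pow_right (Nat.le_succ i) (hpow i hf))
  exact ⟨r, r.2, hr⟩

include F in
/-- An ideal stable under the invariant vector fields is trivial. -/
theorem eq_bot_or_eq_top [Algebra.FiniteType ℂ A] [ConnectedSpace (PrimeSpectrum A)] {I : Ideal A}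
    (hI : ∀ (x : leftInvariantFields A), ∀ f ∈ I, (x : Derivation ℂ A A) f ∈ I) :
    I = ⊥ ∨ I = ⊤ := by
  have hid : IsIdempotentElem I := by
    refine le_antisymm Ideal.mul_le_right fun f hf => ?_
    -- A maximal ideal containing I and the annihilator of f would contain both r and 1 - r. So i +
    -- a = 1 with i in I and a f = 0, whence f = i f lies in I².
    have hJ : I ⊔ (Submodule.span A {f}).annihilator = ⊤ := by
      by_contra hJ
      obtain ⟨m, hm, hle⟩ := Ideal.exists_le_maximal _ hJ
      obtain ⟨r, hr, hrf⟩ := F.exists_mul_eq_self hI (le_sup_left.trans hle) hf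
      refine hm.ne_top ((Ideal.eq_top_iff_one m).2 ?_)
      have : 1 - r ∈ m := hle (le_sup_right (a := I) (Submodule.mem_annihilator_span_singleton _ _
        |>.2 (by rw [smul_eq_mul, sub_mul, one_mul, hrf, sub_self])))
      simpa using add_mem this hr
    obtain ⟨i, hi, a, ha, h1⟩ := Submodule.mem_sup.1 ((Ideal.eq_top_iff_one _).1 hJ)
    have haf : a * f = 0 := (Submodule.mem_annihilator_span_singleton _ _).1 ha
    have : f = i * f := by rw [← add_zero (i * f), ← haf, ← add_mul, h1, one_mul]
    rw [this]
    exact Ideal.mul_mem_mul hi hf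
  have := Algebra.FiniteType.isNoetherianRing ℂ A
  -- A finitely generated idempotent ideal is generated by an idempotent, and a connected spectrum
  -- allows only 0 and 1.
  obtain ⟨e, he, rfl⟩ := (Ideal.isIdempotentElem_iff_of_fg I (IsNoetherian.noetherian I)).1 hid
  rcases he.eq_zero_or_eq_one_of_connected with rfl | rfl
  · exact .inl (by simp)
  · exact .inr (Ideal.span_singleton_one)

-- With its value at the unit subtracted, f is still killed by 𝔤 and generates a stable ideal of
-- functions vanishing at the unit, which must be zero.
include F in
theorem eq_counit [Algebra.FiniteType ℂ A] [ConnectedSpace (PrimeSpectrum A)] {f : A}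
    (hf : ∀ x : leftInvariantFields A, (x : Derivation ℂ A A) f = 0) :
    f = algebraMap ℂ A (counit (R := ℂ) f) := by
  set h := f - algebraMap ℂ A (counit (R := ℂ) f) with hh
  have hx : ∀ x : leftInvariantFields A, (x : Derivation ℂ A A) h = 0 := fun x => by
    rw [hh, map_sub, hf, Derivation.map_algebraMap, sub_zero]
  rcases F.eq_bot_or_eq_top (I := Ideal.span {h}) (fun x g hg => by
    obtain ⟨a, rfl⟩ := Ideal.mem_span_singleton'.1 hg
    rw [Derivation.leibniz, hx, smul_zero, zero_add, smul_eq_mul, mul_comm]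
    exact Ideal.mul_mem_left _ _ (Ideal.mem_span_singleton_self h)) with h1 | h1
  · exact sub_eq_zero.1 (Ideal.span_singleton_eq_bot.1 h1)
  · obtain ⟨a, ha⟩ := Ideal.mem_span_singleton'.1 ((Ideal.eq_top_iff_one _).1 h1)
    have := congrArg (counit (R := ℂ)) ha
    simp [hh] at this

include F in
theorem ideal_eq_bot_of_counit [Algebra.FiniteType ℂ A] [ConnectedSpace (PrimeSpectrum A)]
    {I : Ideal A} (hI : ∀ (x : leftInvariantFields A), ∀ f ∈ I, (x : Derivation ℂ A A) f ∈ I)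
    (h0 : ∀ f ∈ I, counit (R := ℂ) f = 0) : I = ⊥ := by
  refine (F.eq_bot_or_eq_top hI).resolve_right fun h => ?_
  have := h0 1 (h ▸ trivial)
  simp at this

end InvariantFrame

/-! ### Right invariant vector fields -/

section RightFields

open Coalgebra InvariantFields

variable {A : Type*} [CommRing A] [HopfAlgebra ℂ A]

theorem rightField_apply (y : leftInvariantFields A) (f : A) :
    rightField A y f = -evalFst A (y : Derivation ℂ A A) (comul (R := ℂ) f) := rfl

/-- The right invariant vector fields as a linear map. -/
def rightFieldHom : leftInvariantFields A →ₗ[ℂ] Derivation ℂ A A where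
  toFun y := rightField A y
  map_add' y z := by
    ext f
    have h : ∀ t : A ⊗[ℂ] A, evalFst A ((y + z : leftInvariantFields A) : Derivation ℂ A A) t =
        evalFst A (y : Derivation ℂ A A) t + evalFst A (z : Derivation ℂ A A) t := by
      intro t
      induction t with
      | zero => simp
      | add s t hs ht => simp only [map_add, hs, ht]; abel
      | tmul a b => simp [evalFst, add_smul]
    rw [Derivation.add_apply, rightField_apply, rightField_apply, rightField_apply, h, neg_add]
  map_smul' c y := by
    ext f
    have h : ∀ t : A ⊗[ℂ] A, evalFst A ((c • y : leftInvariantFields A) : Derivation ℂ A A) t =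
        c • evalFst A (y : Derivation ℂ A A) t := by
      intro t
      induction t with
      | zero => simp
      | add s t hs ht => simp only [map_add, hs, ht, smul_add]
      | tmul a b => simp [evalFst, mul_smul]
    rw [RingHom.id_apply, Derivation.smul_apply, rightField_apply, rightField_apply, h, smul_neg]

theorem counit_rightField (y : leftInvariantFields A) (f : A) :
    counit (R := ℂ) (rightField A y f) = -counit (R := ℂ) ((y : Derivation ℂ A A) f) := by
  have h : ∀ t : A ⊗[ℂ] A, counit (R := ℂ) (evalFst A (y : Derivation ℂ A A) t) =
      counit (R := ℂ) ((y : Derivation ℂ A A)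
        (TensorProduct.rid ℂ A ((counit (R := ℂ)).lTensor A t))) := by
    intro t
    induction t with
    | zero => simp
    | add s t hs ht => simp only [map_add, hs, ht]
    | tmul a b => simp [evalFst, mul_comm]
  rw [rightField_apply, map_neg, h, lTensor_counit_comul]
  simp

/-- Right invariant fields commute with left invariant ones. -/
theorem comm_rightField (x y : leftInvariantFields A) (f : A) :
    (x : Derivation ℂ A A) (rightField A y f) = rightField A y ((x : Derivation ℂ A A) f) := by
  have h : ∀ t : A ⊗[ℂ] A, (x : Derivation ℂ A A) (evalFst A (y : Derivation ℂ A A) t) =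
      evalFst A (y : Derivation ℂ A A) (((x : Derivation ℂ A A) : A →ₗ[ℂ] A).lTensor A t) := by
    intro t
    induction t with
    | zero => simp
    | add s t hs ht => simp only [map_add, hs, ht]
    | tmul a b => simp [evalFst]
  rw [rightField_apply, rightField_apply, map_neg, h, x.2 f]

theorem lie_rightField (x y : leftInvariantFields A) :
    ⁅(x : Derivation ℂ A A), rightField A y⁆ = 0 := by
  ext f
  rw [Derivation.commutator_apply, comm_rightField, sub_self, Derivation.zero_apply]

theorem rightField_injective : Function.Injective (rightField A) := fun x y h =>
  ext_atUnit fun f => by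
    have := congrArg (counit (R := ℂ)) (congrArg (fun D : Derivation ℂ A A => D f) h)
    simpa only [counit_rightField, neg_inj] using this

end RightFields

namespace InvariantFrame

open Coalgebra InvariantFields

variable {A : Type*} [CommRing A] [HopfAlgebra ℂ A] {ι : Type*} [Fintype ι] [DecidableEq ι]
  (F : InvariantFrame A ι)

/-- The action of invariant fields on the coefficients of a field commuting with them. -/
theorem apply_coeff {D : Derivation ℂ A A} {x : leftInvariantFields A}
    (hD : ⁅(x : Derivation ℂ A A), D⁆ = 0) (k : ι) : (x : Derivation ℂ A A) (F.coeff D k) =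
      -∑ i, F.basis.repr ⁅x, F.basis i⁆ k • F.coeff D i := by
  have h : ∀ (a : A) (z : leftInvariantFields A),
      ⁅(x : Derivation ℂ A A), a • (z : Derivation ℂ A A)⁆ =
      (x : Derivation ℂ A A) a • (z : Derivation ℂ A A) +
        a • ((⁅x, z⁆ : leftInvariantFields A) : Derivation ℂ A A) := by
    intro a z
    ext f
    simp only [Derivation.commutator_apply, Derivation.smul_apply, Derivation.add_apply,
      LieSubalgebra.coe_bracket, Derivation.leibniz, smul_eq_mul]
    ring
  have h1 := congrArg (F.coeffHom k) hD
  rw [F.eq_sum D, lie_sum, map_sum, map_zero] at h1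
  simp only [h, map_add, Finset.sum_add_distrib, map_smul, coeffHom_apply,
    coeff_invariant] at h1
  rw [eq_neg_iff_add_eq_zero, ← h1]
  congr 1
  · simp [Finsupp.single_apply, apply_ite (algebraMap ℂ A)]
  · refine Finset.sum_congr rfl fun i _ => ?_
    rw [Algebra.smul_def, smul_eq_mul, mul_comm]

-- By `apply_coeff` the coefficients of D generate an ideal stable under 𝔤, and they vanish at the
-- unit.
include F in
theorem eq_zero_of_commute [Algebra.FiniteType ℂ A] [ConnectedSpace (PrimeSpectrum A)]
    {D : Derivation ℂ A A} (hD : ∀ x : leftInvariantFields A, ⁅(x : Derivation ℂ A A), D⁆ = 0)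
    (h0 : ∀ f, counit (R := ℂ) (D f) = 0) : D = 0 := by
  have hε : ∀ i, counit (R := ℂ) (F.coeff D i) = 0 := by
    intro i
    have := h0 (F.coord i)
    rw [F.apply_eq_sum, map_sum] at this
    simpa [F.counit_basis_coord] using this
  have hI := F.ideal_eq_bot_of_counit (I := Ideal.span (Set.range (F.coeff D))) (fun x f hf => by
    induction hf using Submodule.span_induction with
    | zero => rw [map_zero]; exact zero_mem _
    | add f g _ _ hf hg => rw [map_add]; exact add_mem hf hg
    | mem f hf =>
      obtain ⟨i, rfl⟩ := hf
      rw [F.apply_coeff (hD x)]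
      refine neg_mem (sum_mem fun j _ => ?_)
      rw [Algebra.smul_def]
      exact Ideal.mul_mem_left _ _ (Ideal.subset_span ⟨j, rfl⟩)
    | smul a f hf' hf =>
      rw [smul_eq_mul, Derivation.leibniz]
      exact add_mem (Ideal.mul_mem_left _ _ hf) (Ideal.mul_mem_right _ _ hf'))
    (fun f hf => by
    induction hf using Submodule.span_induction with
    | zero => simp
    | add f g _ _ hf hg => rw [map_add, hf, hg, add_zero]
    | mem f hf =>
      obtain ⟨i, rfl⟩ := hf
      exact hε i
    | smul a f _ hf => rw [smul_eq_mul, Bialgebra.counit_mul, hf, mul_zero])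
  rw [F.eq_sum D]
  refine Finset.sum_eq_zero fun i _ => ?_
  have : F.coeff D i ∈ (⊥ : Ideal A) := hI ▸ Ideal.subset_span ⟨i, rfl⟩
  rw [(Submodule.mem_bot A).1 this, zero_smul]

-- Both sides commute with 𝔤, so it is enough to compare them at the unit; there i_R(y) is -y, and
-- right fields can be moved past functions by commuting them with left ones.
include F in
theorem rightField_lie [Algebra.FiniteType ℂ A] [ConnectedSpace (PrimeSpectrum A)]
    (y z : leftInvariantFields A) : ⁅rightField A y, rightField A z⁆ = rightField A ⁅y, z⁆ := by
  rw [← sub_eq_zero]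
  refine F.eq_zero_of_commute (fun x => ?_) fun f => ?_
  · rw [lie_sub, lie_rightField, sub_zero, leibniz_lie, lie_rightField, lie_rightField]
    simp
  · rw [Derivation.sub_apply, Derivation.commutator_apply, map_sub, map_sub, counit_rightField,
      counit_rightField, counit_rightField, comm_rightField, comm_rightField, counit_rightField,
      counit_rightField, LieSubalgebra.coe_bracket, Derivation.commutator_apply, map_sub]
    ring

end InvariantFrame

/-! ### Vector fields acting on functions and forms in a vertex algebra -/

theorem KaehlerDifferential.induction_smul_D {R S : Type*} [CommRing R] [CommRing S] [Algebra R S]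
    {P : Ω[S⁄R] → Prop} (zero : P 0) (add : ∀ v w, P v → P w → P (v + w))
    (smul : ∀ a b : S, P (a • KaehlerDifferential.D R S b)) (w : Ω[S⁄R]) : P w := by
  have hw : w ∈ Submodule.span S (Set.range (KaehlerDifferential.D R S)) := by
    rw [KaehlerDifferential.span_range_derivation]
    trivial
  induction hw using Submodule.closure_induction with
  | zero => exact zero
  | add x y hx hy h1 h2 => exact add _ _ h1 h2
  | smul_mem a x hx =>
    obtain ⟨b, rfl⟩ := hx
    exact smul a b

namespace FunctionEmbedding

variable {A V : Type*} [CommRing A] [Algebra ℂ A] [AddCommGroup V] [Module ℂ V]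
    [VertexAlgebra V] (F : FunctionEmbedding A V)

theorem form_smul_D (a b : A) : (F.form (a • KaehlerDifferential.D ℂ A b) : V) =
    nprod (-1) (F.fn a) (nprod (-2) (F.fn b) vac) := by
  rw [form_smul, form_D]

/-- The map of `1`-forms to the vertex algebra as a complex linear map. -/
def formHom : Ω[A⁄ℂ] →ₗ[ℂ] V := F.annihilated.subtype ∘ₗ F.form.restrictScalars ℂ

theorem formHom_apply (w : Ω[A⁄ℂ]) : F.formHom w = F.form w := rfl

theorem nprod_fn_formHom (a : A) (w : Ω[A⁄ℂ]) {n : ℤ} (hn : 0 ≤ n) :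
    nprod n (F.fn a) (F.formHom w) = 0 := (F.form w).2 a n hn

theorem nprod_neg_one_fn_vac (a : A) : nprod (-1) (F.fn a) vac = F.fn a :=
  VertexAlgebra.nprod_vac _

/-- An element `u` whose modes act on functions by the derivation `δ`. -/
def ActsBy (u : V) (δ : Derivation ℂ A A) : Prop :=
  (∀ a, nprod 0 u (F.fn a) = F.fn (δ a)) ∧ ∀ a (n : ℤ), 1 ≤ n → nprod n u (F.fn a) = 0

variable {F} {u : V} {δ : Derivation ℂ A A}

namespace ActsBy

variable (h : F.ActsBy u δ)

include h

theorem nprod_nprod_fn (a : A) (m n : ℤ) (v : V) : nprod m u (nprod n (F.fn a) v) =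
    nprod n (F.fn a) (nprod m u v) + nprod (m + n) (F.fn (δ a)) v := by
  rw [VertexAlgebra.nprod_comm, binSum_eq_single]
  · rw [Nat.cast_zero, sub_zero, h.1]
  · intro j
    rw [h.2 a _ (by push_cast; omega), map_zero, LinearMap.zero_apply]

theorem nprod_nonneg_form (n : ℤ) (hn : 0 ≤ n) (a b : A) :
    nprod n u (F.formHom (a • KaehlerDifferential.D ℂ A b)) =
      nprod (-1) (F.fn a) (nprod (n - 2) (F.fn (δ b)) vac) +
        nprod (n - 1) (F.fn (δ a)) (nprod (-2) (F.fn b) vac) := by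
  rw [F.formHom_apply, F.form_smul_D, h.nprod_nprod_fn, h.nprod_nprod_fn,
    VertexAlgebra.nprod_vac_of_nonneg _ _ hn, map_zero, zero_add]
  rfl

theorem nprod_zero_form_mem (w : Ω[A⁄ℂ]) : nprod 0 u (F.formHom w) ∈ LinearMap.range F.formHom := by
  induction w using KaehlerDifferential.induction_smul_D with
  | zero => rw [map_zero, map_zero]; exact zero_mem _
  | add v w hv hw => rw [map_add, map_add]; exact add_mem hv hw
  | smul a b =>
    rw [h.nprod_nonneg_form 0 le_rfl, zero_sub, zero_sub, ← F.form_smul_D, ← F.form_smul_D]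
    exact add_mem ⟨a • KaehlerDifferential.D ℂ A (δ b), rfl⟩ ⟨δ a • KaehlerDifferential.D ℂ A b, rfl⟩

theorem nprod_one_form (w : Ω[A⁄ℂ]) :
    nprod 1 u (F.formHom w) = F.fn (δ.liftKaehlerDifferential w) := by
  induction w using KaehlerDifferential.induction_smul_D with
  | zero => simp
  | add v w hv hw => simp only [map_add, hv, hw]
  | smul a b =>
    rw [h.nprod_nonneg_form 1 zero_le_one, sub_self,
      F.nprod_mem_annihilated b (-2) F.vac_mem_annihilated _ 0 le_rfl, add_zero,
      map_smul, δ.liftKaehlerDifferential_comp_D, smul_eq_mul, F.fn_mul]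
    norm_num [VertexAlgebra.nprod_vac]

end ActsBy

end FunctionEmbedding

namespace VertexFields

variable {A V : Type*} [CommRing A] [Algebra ℂ A] [AddCommGroup V] [Module ℂ V]
  [VertexAlgebra V] {𝔤 : LieSubalgebra ℂ (Derivation ℂ A A)} {κ : LinearMap.BilinForm ℂ 𝔤}
  (F : VertexFields κ V)

theorem actsBy_vf (x : 𝔤) : F.ActsBy (F.vf x) x :=
  ⟨F.nprod_zero_vf_fn x, fun a n hn => F.nprod_vf_fn x a n hn⟩

theorem nprod_zero_vf_smul (x z : 𝔤) (a : A) :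
    nprod 0 (F.vf x) (nprod (-1) (F.fn a) (F.vf z)) =
      nprod (-1) (F.fn a) (F.vf ⁅x, z⁆) + nprod (-1) (F.fn (x.1 a)) (F.vf z) := by
  rw [(F.actsBy_vf x).nprod_nprod_fn, F.nprod_zero_vf, zero_add]

/-- The term -z(x(a)) comes from (x a)_(0) z. It is the quantum correction that produces the Killing
form in the dual level. -/
theorem nprod_one_vf_smul (x z : 𝔤) (a : A) :
    nprod 1 (F.vf x) (nprod (-1) (F.fn a) (F.vf z)) = F.fn (κ x z • a - z.1 (x.1 a)) := by
  rw [(F.actsBy_vf x).nprod_nprod_fn, F.nprod_one_vf, map_smul, F.nprod_neg_one_fn_vac,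
    add_neg_cancel, F.nprod_zero_fn_vf, map_sub, map_smul, sub_eq_add_neg]

end VertexFields

/-! ### Products in the algebra of chiral differential operators -/

namespace CDO

open VertexPresentation InvariantFields Coalgebra

variable {A : Type*} [CommRing A] [HopfAlgebra ℂ A]
  (κ : LinearMap.BilinForm ℂ (leftInvariantFields A))

variable {κ} in
theorem mk_eq_zero_of_rel {r : Free (CDOGen A)} (h : CDORel κ r) : mk CDOGen.wt (CDORel κ) r = 0 :=
  mk_rel (Rel.base _ h)

theorem of_form_zero : of CDOGen.wt (CDORel κ) (.form 0) = 0 := by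
  simpa using of_smul_form κ 0 0

theorem of_vf_zero : of CDOGen.wt (CDORel κ) (.vf 0) = 0 := by
  have h := mk_eq_zero_of_rel (CDORel.vf_smul (κ := κ) 0 0)
  rw [smul_zero, zero_smul, sub_zero] at h
  exact h

theorem weightOne_inl (D : Derivation ℂ A A) :
    weightOne κ (D, 0) = of CDOGen.wt (CDORel κ) (.vf D) := by
  change of CDOGen.wt (CDORel κ) (.vf D) + of CDOGen.wt (CDORel κ) (.form 0) = _
  rw [of_form_zero, add_zero]

theorem weightOne_inr (w : Ω[A⁄ℂ]) :
    weightOne κ (0, w) = of CDOGen.wt (CDORel κ) (.form w) := by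
  change of CDOGen.wt (CDORel κ) (.vf 0) + of CDOGen.wt (CDORel κ) (.form w) = _
  rw [of_vf_zero, zero_add]

theorem weightOne_mk (D : Derivation ℂ A A) (w : Ω[A⁄ℂ]) :
    weightOne κ (D, w) = weightOne κ (D, 0) + weightOne κ (0, w) := by
  rw [weightOne_inl, weightOne_inr]
  rfl

theorem weightOne_mem (p : Derivation ℂ A A × Ω[A⁄ℂ]) :
    weightOne κ p ∈ weightSpace CDOGen.wt (CDORel κ) 1 :=
  add_mem (of_mem_weightSpace (wt := CDOGen.wt) (R := CDORel κ) (.vf p.1))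
    (of_mem_weightSpace (wt := CDOGen.wt) (R := CDORel κ) (.form p.2))

theorem nprod_weightOne_eq_zero (p q : Derivation ℂ A A × Ω[A⁄ℂ]) {n : ℤ} (hn : 2 ≤ n) :
    nprod n (weightOne κ p) (weightOne κ q) = 0 :=
  nprod_eq_zero_of_weight (weightOne_mem κ p) (weightOne_mem κ q) hn

/-- Functions in the algebra of chiral differential operators. -/
def functions : FunctionEmbedding A (ChiralDiffOps κ) where
  fn :=
    { toFun := fun a => of CDOGen.wt (CDORel κ) (.fn a)
      map_add' := fun a b => by
        have h := mk_eq_zero_of_rel (CDORel.fn_add (κ := κ) a b)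
        rw [map_sub, sub_eq_zero, map_add] at h
        exact h
      map_smul' := fun c a => by
        have h := mk_eq_zero_of_rel (CDORel.fn_smul (κ := κ) c a)
        rw [map_sub, sub_eq_zero, map_smul] at h
        exact h }
  fn_one := by
    have h := mk_eq_zero_of_rel (CDORel.fn_one (κ := κ))
    rw [map_sub, sub_eq_zero] at h
    exact h
  fn_mul a b := by
    have h := mk_eq_zero_of_rel (CDORel.fn_mul (κ := κ) a b)
    rw [map_sub, sub_eq_zero] at h
    exact h
  nprod_fn a b n hn := nprod_eq_zero_of_weight
    (of_mem_weightSpace (wt := CDOGen.wt) (R := CDORel κ) (.fn a))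
    (of_mem_weightSpace (wt := CDOGen.wt) (R := CDORel κ) (.fn b)) hn

theorem functions_mem (a : A) : (functions κ).fn a ∈ weightSpace CDOGen.wt (CDORel κ) 0 :=
  of_mem_weightSpace (wt := CDOGen.wt) (R := CDORel κ) (.fn a)

theorem weightOne_leftMap (x : leftInvariantFields A) :
    weightOne κ (leftMap A x) = of CDOGen.wt (CDORel κ) (.vf x) := weightOne_inl κ x

theorem nprod_zero_vf_fn (x : leftInvariantFields A) (a : A) :
    nprod 0 (weightOne κ (leftMap A x)) ((functions κ).fn a) =
      (functions κ).fn ((x : Derivation ℂ A A) a) := by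
  have h := mk_eq_zero_of_rel (CDORel.vf_fn (κ := κ) x a)
  rw [map_sub, sub_eq_zero] at h
  rw [weightOne_leftMap]
  exact h

theorem nprod_vf_fn (p : Derivation ℂ A A × Ω[A⁄ℂ]) (a : A) (n : ℤ) (hn : 1 ≤ n) :
    nprod n (weightOne κ p) ((functions κ).fn a) = 0 :=
  nprod_eq_zero_of_weight (weightOne_mem κ p) (functions_mem κ a) (by omega)

theorem nprod_fn_vf (p : Derivation ℂ A A × Ω[A⁄ℂ]) (a : A) (n : ℤ) (hn : 1 ≤ n) :
    nprod n ((functions κ).fn a) (weightOne κ p) = 0 :=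
  nprod_eq_zero_of_weight (functions_mem κ a) (weightOne_mem κ p) (by omega)

theorem nprod_zero_fn_vf {p : Derivation ℂ A A × Ω[A⁄ℂ]} {a b : A}
    (h : nprod 0 (weightOne κ p) ((functions κ).fn a) = (functions κ).fn b) :
    nprod 0 ((functions κ).fn a) (weightOne κ p) = -(functions κ).fn b := by
  rw [VertexAlgebra.nprod_zero_skew, binSum_eq_single]
  · rw [Nat.cast_zero, h, sub_zero, VertexAlgebra.nprod_vac]
  · intro j
    rw [nprod_vf_fn _ _ _ _ (by push_cast; omega), map_zero, LinearMap.zero_apply]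

/-- Functions and left invariant fields in the algebra of chiral differential operators. -/
def fields : VertexFields κ (ChiralDiffOps κ) where
  toFunctionEmbedding := functions κ
  vf := weightOne κ ∘ₗ leftMap A
  nprod_zero_vf_fn := nprod_zero_vf_fn κ
  nprod_zero_fn_vf x a := nprod_zero_fn_vf κ (nprod_zero_vf_fn κ x a)
  nprod_vf_fn x a n hn := nprod_vf_fn κ _ a n hn
  nprod_fn_vf x a n hn := nprod_fn_vf κ _ a n hn
  nprod_zero_vf x y := by
    have h := mk_eq_zero_of_rel (CDORel.bracket (κ := κ) x y)
    rw [map_sub, sub_eq_zero] at h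
    rw [LinearMap.comp_apply, LinearMap.comp_apply, LinearMap.comp_apply, weightOne_leftMap,
      weightOne_leftMap, weightOne_leftMap]
    exact h
  nprod_one_vf x y := by
    have h := mk_eq_zero_of_rel (CDORel.pairing (κ := κ) x y)
    rw [map_sub, sub_eq_zero, map_smul] at h
    rw [LinearMap.comp_apply, LinearMap.comp_apply, weightOne_leftMap, weightOne_leftMap]
    exact h
  nprod_vf x y n hn := nprod_weightOne_eq_zero κ _ _ hn

theorem weightOne_form (w : Ω[A⁄ℂ]) : weightOne κ (0, w) = (functions κ).formHom w := by
  induction w using KaehlerDifferential.induction_smul_D with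
  | zero => rw [map_zero]; exact map_zero _
  | add v w hv hw =>
    rw [map_add, ← hv, ← hw, ← map_add, Prod.mk_add_mk, add_zero]
  | smul a b =>
    rw [FunctionEmbedding.formHom_apply, FunctionEmbedding.form_smul_D, weightOne_inr]
    have h := mk_eq_zero_of_rel (CDORel.fn_form (κ := κ) a (KaehlerDifferential.D ℂ A b))
    have h' := mk_eq_zero_of_rel (CDORel.form_d (κ := κ) b)
    rw [map_sub, sub_eq_zero] at h h'
    exact h.trans (congrArg (nprod (-1) ((functions κ).fn a)) h')

theorem weightOne_smul (a : A) (x : leftInvariantFields A) :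
    weightOne κ (a • (x : Derivation ℂ A A), 0) =
      nprod (-1) ((fields κ).fn a) ((fields κ).vf x) := by
  have h := mk_eq_zero_of_rel (CDORel.fn_vf (κ := κ) a x)
  rw [map_sub, sub_eq_zero] at h
  rw [weightOne_inl]
  refine h.trans ?_
  rw [show (fields κ).vf x = of CDOGen.wt (CDORel κ) (.vf x) from weightOne_leftMap κ x]
  rfl

section

variable {κ} {ι : Type*} [Fintype ι] [DecidableEq ι] (b : InvariantFrame A ι)

theorem weightOne_eq_sum (D : Derivation ℂ A A) : weightOne κ (D, 0) =
    ∑ i, nprod (-1) ((fields κ).fn (b.coeff D i)) ((fields κ).vf (b.basis i)) := by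
  have h : ((D, 0) : Derivation ℂ A A × Ω[A⁄ℂ]) =
      ∑ i, (b.coeff D i • (b.basis i : Derivation ℂ A A), 0) := by
    conv_lhs => rw [b.eq_sum D]
    exact map_sum (LinearMap.inl ℂ _ (Ω[A⁄ℂ])) _ _
  rw [h, map_sum]
  simp only [weightOne_smul]

-- The mode x_(0) satisfies the Leibniz rule on a_(-1) z, so in the frame it reproduces the
-- commutator with no form component.
include b in
theorem nprod_zero_weightOne (x : leftInvariantFields A) (D : Derivation ℂ A A) :
    nprod 0 ((fields κ).vf x) (weightOne κ (D, 0)) =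
      weightOne κ (⁅(x : Derivation ℂ A A), D⁆, 0) := by
  have h : ⁅(x : Derivation ℂ A A), D⁆ = ∑ i,
      (b.coeff D i • ((⁅x, b.basis i⁆ : leftInvariantFields A) : Derivation ℂ A A) +
        (x : Derivation ℂ A A) (b.coeff D i) • (b.basis i : Derivation ℂ A A)) := by
    conv_lhs => rw [b.eq_sum D]
    rw [lie_sum]
    refine Finset.sum_congr rfl fun i _ => ?_
    ext f
    simp only [Derivation.commutator_apply, Derivation.smul_apply, Derivation.add_apply,
      LieSubalgebra.coe_bracket, Derivation.leibniz, smul_eq_mul]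
    ring
  have h' : ((⁅(x : Derivation ℂ A A), D⁆, 0) : Derivation ℂ A A × Ω[A⁄ℂ]) = ∑ i,
      ((b.coeff D i • ((⁅x, b.basis i⁆ : leftInvariantFields A) : Derivation ℂ A A), 0) +
        ((x : Derivation ℂ A A) (b.coeff D i) • (b.basis i : Derivation ℂ A A), 0)) := by
    rw [h]
    simp only [Prod.mk_add_mk, add_zero]
    exact map_sum (LinearMap.inl ℂ _ (Ω[A⁄ℂ])) _ _
  rw [weightOne_eq_sum b D, h', map_sum, map_sum]
  refine Finset.sum_congr rfl fun i _ => ?_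
  rw [map_add, weightOne_smul, weightOne_smul, (fields κ).nprod_zero_vf_smul]

/-- The function with `x_(1) D = f` for a vector field `D`. -/
theorem nprod_one_weightOne (x : leftInvariantFields A) (D : Derivation ℂ A A) :
    nprod 1 ((fields κ).vf x) (weightOne κ (D, 0)) =
      (fields κ).fn (∑ i, (κ x (b.basis i) • b.coeff D i -
        (b.basis i : Derivation ℂ A A) ((x : Derivation ℂ A A) (b.coeff D i)))) := by
  rw [weightOne_eq_sum b D, map_sum, map_sum]
  refine Finset.sum_congr rfl fun i _ => ?_
  rw [(fields κ).nprod_one_vf_smul]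

end

section Injectivity

variable {κ} {ι : Type*} [Fintype ι] [DecidableEq ι] (b : InvariantFrame A ι)
  (hsymm : ∀ x y, κ x y = κ y x) (hinv : ∀ x y z, κ ⁅x, y⁆ z = κ x ⁅y, z⁆)

include b hsymm hinv in
theorem vac_ne_zero : (vac : ChiralDiffOps κ) ≠ 0 :=
  (FieldsAndFunctions.vertexFields κ hsymm hinv).cdo_vac_ne_zero (b := b.basis) (c := b.coeffHom)
    (fun i j => b.coeff_basis i j)
    (FieldsAndFunctions.vac_ne_zero κ hsymm hinv (Bialgebra.counitAlgHom ℂ A))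

-- The kernel is an ideal stable under 𝔤, because x_(0) acts on functions as x, and it does not
-- contain 1, because the vacuum is nonzero.
include b in
theorem fn_injective [Algebra.FiniteType ℂ A] [ConnectedSpace (PrimeSpectrum A)]
    (h0 : (vac : ChiralDiffOps κ) ≠ 0) : Function.Injective (functions κ).fn := by
  let I : Ideal A :=
    { carrier := {a | (functions κ).fn a = 0}
      add_mem' := fun {a c} ha hc => by
        change (functions κ).fn (a + c) = 0
        rw [map_add, show (functions κ).fn a = 0 from ha, show (functions κ).fn c = 0 from hc,
          add_zero]
      zero_mem' := map_zero _
      smul_mem' := fun a c hc => by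
        change (functions κ).fn (a * c) = 0
        rw [(functions κ).fn_mul, show (functions κ).fn c = 0 from hc, map_zero] }
  have hI := (b.eq_bot_or_eq_top (I := I) fun x a ha => by
    change (functions κ).fn _ = 0
    rw [← nprod_zero_vf_fn, show (functions κ).fn a = 0 from ha, map_zero]).resolve_right
    fun h => by
      have : (functions κ).fn 1 = 0 := (Ideal.eq_top_iff_one I).1 h
      rw [(functions κ).fn_one] at this
      exact h0 this
  rw [injective_iff_map_eq_zero]
  intro a ha
  have : a ∈ (⊥ : Ideal A) := hI ▸ (show a ∈ I from ha)
  exact (Submodule.mem_bot A).1 this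

end Injectivity

end CDO

/-! ### The dual embedding -/

theorem VertexAlgebra.nprod_eq_zero_of_skew {V : Type*} [AddCommGroup V] [Module ℂ V]
    [VertexAlgebra V] {a b : V} (h : ∀ n : ℤ, 0 ≤ n → nprod n a b = 0) {n : ℤ} (hn : 0 ≤ n) :
    nprod n b a = 0 := by
  have key := VertexAlgebra.nprod_skew a b n
  rw [binSum_eq_zero, neg_zero] at key
  · exact (smul_eq_zero.1 key).resolve_left (zpow_ne_zero _ (by norm_num))
  · intro j
    rw [h _ (by omega), map_zero, LinearMap.zero_apply]

namespace InvariantFrame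

open Coalgebra InvariantFields

variable {A : Type*} [CommRing A] [HopfAlgebra ℂ A] {ι : Type*} [Fintype ι] [DecidableEq ι]
  (b : InvariantFrame A ι)

theorem counit_coeff (D : Derivation ℂ A A) (i : ι) :
    counit (R := ℂ) (b.coeff D i) = counit (R := ℂ) (D (b.coord i)) := by
  rw [b.apply_eq_sum, map_sum]
  simp [b.counit_basis_coord]

/-- At a point g, the coefficients of i_R(y) in the left frame are those of -Ad(g⁻¹) y. This is the
value at the unit; `counit_apply_coeff_rightField` and `counit_apply_apply_coeff_rightField` give
the first and second derivatives there. -/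
theorem counit_coeff_rightField (y : leftInvariantFields A) (i : ι) :
    counit (R := ℂ) (b.coeff (rightField A y) i) = -b.basis.repr y i := by
  rw [counit_coeff, counit_rightField, counit_coord]

theorem sum_repr_lie (x y : leftInvariantFields A) (k : ι) :
    ∑ i, b.basis.repr ⁅x, b.basis i⁆ k * b.basis.repr y i = b.basis.repr ⁅x, y⁆ k := by
  conv_rhs => rw [← b.basis.sum_repr y, lie_sum, map_sum, Finsupp.finsetSum_apply]
  refine Finset.sum_congr rfl fun i _ => ?_
  rw [lie_smul, map_smul, Finsupp.smul_apply, smul_eq_mul, mul_comm]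

theorem counit_apply_coeff_rightField (x y : leftInvariantFields A) (k : ι) :
    counit (R := ℂ) ((x : Derivation ℂ A A) (b.coeff (rightField A y) k)) =
      b.basis.repr ⁅x, y⁆ k := by
  rw [b.apply_coeff (lie_rightField x y), map_neg, map_sum, ← b.sum_repr_lie,
    ← Finset.sum_neg_distrib]
  refine Finset.sum_congr rfl fun i _ => ?_
  rw [map_smul, counit_coeff_rightField, smul_eq_mul, mul_neg, neg_neg]

theorem counit_apply_apply_coeff_rightField (x z y : leftInvariantFields A) (k : ι) :
    counit (R := ℂ) ((x : Derivation ℂ A A) ((z : Derivation ℂ A A)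
      (b.coeff (rightField A y) k))) = -b.basis.repr ⁅z, ⁅x, y⁆⁆ k := by
  rw [b.apply_coeff (lie_rightField z y), map_neg, map_sum, map_neg, map_sum, ← b.sum_repr_lie]
  congr 1
  refine Finset.sum_congr rfl fun i _ => ?_
  rw [Derivation.map_smul, map_smul, counit_apply_coeff_rightField, smul_eq_mul]

theorem trace_eq_sum (f : Module.End ℂ (leftInvariantFields A)) :
    LinearMap.trace ℂ _ f = ∑ i, b.basis.repr (f (b.basis i)) i := by
  rw [LinearMap.trace_eq_matrix_trace ℂ b.basis, Matrix.trace]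
  simp only [Matrix.diag_apply, LinearMap.toMatrix_apply]

-- The endomorphism ad [x, y] is a commutator, so its trace vanishes.
include b in
theorem trace_ad_lie (x y : leftInvariantFields A) :
    ∑ i, b.basis.repr ⁅b.basis i, ⁅x, y⁆⁆ i = 0 := by
  have h0 : LieAlgebra.ad ℂ (leftInvariantFields A) ⁅x, y⁆ =
      LieAlgebra.ad ℂ _ x * LieAlgebra.ad ℂ _ y - LieAlgebra.ad ℂ _ y * LieAlgebra.ad ℂ _ x := by
    ext1 z
    exact lie_lie x y z
  have h := b.trace_eq_sum (LieAlgebra.ad ℂ _ ⁅x, y⁆)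
  rw [h0, map_sub, LinearMap.trace_mul_comm, sub_self] at h
  have h' : ∀ i, b.basis.repr ⁅b.basis i, ⁅x, y⁆⁆ i =
      -b.basis.repr ((LieAlgebra.ad ℂ _ x * LieAlgebra.ad ℂ _ y -
        LieAlgebra.ad ℂ _ y * LieAlgebra.ad ℂ _ x) (b.basis i)) i := fun i => by
    rw [← lie_skew, map_neg, Finsupp.neg_apply, LinearMap.sub_apply, Module.End.mul_apply,
      Module.End.mul_apply, LieAlgebra.ad_apply, LieAlgebra.ad_apply, LieAlgebra.ad_apply,
      LieAlgebra.ad_apply, lie_lie]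
  simp only [h', Finset.sum_neg_distrib]
  rw [← h, neg_zero]

theorem sum_repr_eq_killingForm (x y : leftInvariantFields A) :
    ∑ i, b.basis.repr ⁅x, ⁅b.basis i, y⁆⁆ i = -killingForm ℂ _ x y := by
  rw [LieModule.traceForm_apply_apply, b.trace_eq_sum, ← Finset.sum_neg_distrib]
  refine Finset.sum_congr rfl fun i _ => ?_
  rw [← lie_skew (b.basis i) y, lie_neg, map_neg, Finsupp.neg_apply]
  rfl

theorem lie_eq_sum_of_commute {D E : Derivation ℂ A A}
    (h : ∀ (x : leftInvariantFields A) f, (x : Derivation ℂ A A) (D f) = D ((x : Derivation ℂ A A) f)) :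
    ⁅D, E⁆ = ∑ i, D (b.coeff E i) • (b.basis i : Derivation ℂ A A) := by
  conv_lhs => rw [b.eq_sum E, lie_sum]
  refine Finset.sum_congr rfl fun i _ => ?_
  ext f
  simp only [Derivation.commutator_apply, Derivation.smul_apply, Derivation.leibniz, smul_eq_mul, h]
  ring

end InvariantFrame

namespace CDO

open VertexPresentation InvariantFields Coalgebra

variable {A : Type*} [CommRing A] [HopfAlgebra ℂ A]
  {κ : LinearMap.BilinForm ℂ (leftInvariantFields A)}
  {ι : Type*} [Fintype ι] [DecidableEq ι] (b : InvariantFrame A ι)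

/-- The function `f` with `x_(1) D = -f` for a vector field `D`. -/
def pairingDefect (κ : LinearMap.BilinForm ℂ (leftInvariantFields A)) (D : Derivation ℂ A A) :
    leftInvariantFields A →ₗ[ℂ] A where
  toFun x := ∑ i, ((b.basis i : Derivation ℂ A A) ((x : Derivation ℂ A A) (b.coeff D i)) -
    κ x (b.basis i) • b.coeff D i)
  map_add' x y := by
    rw [← Finset.sum_add_distrib]
    refine Finset.sum_congr rfl fun i _ => ?_
    rw [AddMemClass.coe_add, Derivation.add_apply, map_add, map_add, LinearMap.add_apply]
    module
  map_smul' c x := by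
    rw [Finset.smul_sum]
    refine Finset.sum_congr rfl fun i _ => ?_
    rw [SetLike.val_smul, Derivation.smul_apply, Derivation.map_smul, map_smul,
      LinearMap.smul_apply, RingHom.id_apply, smul_eq_mul]
    module

theorem pairingDefect_apply (D : Derivation ℂ A A) (x : leftInvariantFields A) :
    pairingDefect b κ D x = ∑ i, ((b.basis i : Derivation ℂ A A)
      ((x : Derivation ℂ A A) (b.coeff D i)) - κ x (b.basis i) • b.coeff D i) := rfl

theorem sum_repr_pairingDefect (D : Derivation ℂ A A) (x : leftInvariantFields A) :
    ∑ k, b.basis.repr x k • pairingDefect b κ D (b.basis k) = pairingDefect b κ D x := by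
  conv_rhs => rw [← b.basis.sum_repr x, map_sum]
  simp only [map_smul]

theorem nprod_one_weightOne_mk (x : leftInvariantFields A) (D : Derivation ℂ A A) (w : Ω[A⁄ℂ]) :
    nprod 1 (weightOne κ (leftMap A x)) (weightOne κ (D, w)) = (functions κ).fn
      ((x : Derivation ℂ A A).liftKaehlerDifferential w - pairingDefect b κ D x) := by
  rw [weightOne_mk κ D, map_add, weightOne_form, map_sub, sub_eq_add_neg, add_comm]
  refine congrArg₂ _ (((fields κ).actsBy_vf x).nprod_one_form w) ?_
  refine (nprod_one_weightOne b x D).trans ?_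
  rw [pairingDefect_apply, ← map_neg, ← Finset.sum_neg_distrib]
  simp only [neg_sub]
  rfl

/-- The `1`-form that corrects a vector field to one with vanishing pairings with the left
invariant fields. -/
def dualForm (κ : LinearMap.BilinForm ℂ (leftInvariantFields A)) :
    Derivation ℂ A A →ₗ[ℂ] Ω[A⁄ℂ] where
  toFun D := ∑ k, pairingDefect b κ D (b.basis k) • b.form k
  map_add' D E := by
    rw [← Finset.sum_add_distrib]
    refine Finset.sum_congr rfl fun k _ => ?_
    rw [← add_smul]
    congr 1
    simp only [pairingDefect_apply, b.coeff_add, map_add, smul_add]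
    rw [← Finset.sum_add_distrib]
    refine Finset.sum_congr rfl fun i _ => ?_
    abel
  map_smul' c D := by
    rw [Finset.smul_sum]
    refine Finset.sum_congr rfl fun k _ => ?_
    rw [RingHom.id_apply, ← smul_assoc]
    congr 1
    have h : ∀ i, b.coeff (c • D) i = c • b.coeff D i := fun i => by
      rw [← algebraMap_smul A c D, b.coeff_smul, Algebra.smul_def]
    simp only [pairingDefect_apply, h, Derivation.map_smul]
    rw [Finset.smul_sum]
    refine Finset.sum_congr rfl fun i _ => ?_
    module

theorem lift_dualForm (D : Derivation ℂ A A) (x : leftInvariantFields A) :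
    (x : Derivation ℂ A A).liftKaehlerDifferential (dualForm b κ D) = pairingDefect b κ D x := by
  change (x : Derivation ℂ A A).liftKaehlerDifferential
    (∑ k, pairingDefect b κ D (b.basis k) • b.form k) = _
  rw [map_sum, ← sum_repr_pairingDefect]
  refine Finset.sum_congr rfl fun k _ => ?_
  rw [map_smul, b.lift_form, smul_eq_mul, mul_comm, Algebra.smul_def]

-- By skew symmetry it suffices to compute a_(0) on weight one. It kills forms and commutes with the
-- coefficient functions, so only a_(0) on the invariant basis enters.
include b in
theorem actsBy_weightOne (p : Derivation ℂ A A × Ω[A⁄ℂ]) :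
    (functions κ).ActsBy (weightOne κ p) p.1 := by
  refine ⟨fun a => ?_, fun a n hn => nprod_vf_fn κ p a n hn⟩
  have h : nprod 0 ((functions κ).fn a) (weightOne κ p) = -(functions κ).fn (p.1 a) := by
    rw [← Prod.mk.eta (p := p), weightOne_mk, map_add, weightOne_form,
      (functions κ).nprod_fn_formHom _ _ le_rfl, add_zero, weightOne_eq_sum b, map_sum,
      b.apply_eq_sum, map_sum, ← Finset.sum_neg_distrib]
    refine Finset.sum_congr rfl fun i _ => ?_
    rw [(functions κ).fn_mul, ← map_neg]
    refine ((functions κ).fn_comm a _ _ 0 (-1)).trans (congrArg _ ?_)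
    exact (fields κ).nprod_zero_fn_vf (b.basis i) a
  rw [VertexAlgebra.nprod_zero_skew, binSum_eq_single]
  · rw [Nat.cast_zero, h, sub_zero, VertexAlgebra.nprod_vac, neg_neg]
  · intro j
    rw [nprod_fn_vf κ _ _ _ (by push_cast; omega), map_zero, LinearMap.zero_apply]

variable [Algebra.FiniteType ℂ A] [ConnectedSpace (PrimeSpectrum A)]
  (h0 : (vac : ChiralDiffOps κ) ≠ 0)

section

include b h0

/-- The product x_(1)(D, w) is the function ⟨x, w⟩ minus `pairingDefect`; since A embeds, its
vanishing prescribes ⟨x, w⟩. -/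
theorem lift_eq_of_commute {D : Derivation ℂ A A} {w : Ω[A⁄ℂ]}
    (h : ∀ x, nprod 1 (weightOne κ (leftMap A x)) (weightOne κ (D, w)) = 0)
    (x : leftInvariantFields A) :
    (x : Derivation ℂ A A).liftKaehlerDifferential w = pairingDefect b κ D x := by
  have := h x
  rw [nprod_one_weightOne_mk b, ← map_zero (functions κ).fn] at this
  exact sub_eq_zero.1 (fn_injective b h0 this)

/-- A form is determined by its pairings with 𝔤. Hence, in weight one, commuting with j_L determines
the form part from the vector field part; uniqueness of j_R and the bracket relation of its image
both rest on this. -/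
theorem eq_of_commute {D : Derivation ℂ A A} {w w' : Ω[A⁄ℂ]}
    (h : ∀ x, nprod 1 (weightOne κ (leftMap A x)) (weightOne κ (D, w)) = 0)
    (h' : ∀ x, nprod 1 (weightOne κ (leftMap A x)) (weightOne κ (D, w')) = 0) : w = w' :=
  b.form_ext fun x => by rw [lift_eq_of_commute b h0 h, lift_eq_of_commute b h0 h']

end

/-- The dual embedding. -/
def dualEmbedding (κ : LinearMap.BilinForm ℂ (leftInvariantFields A)) :
    leftInvariantFields A →ₗ[ℂ] Derivation ℂ A A × Ω[A⁄ℂ] :=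
  (LinearMap.id.prod (dualForm b κ)) ∘ₗ rightFieldHom

-- The product with n = 1 vanishes by the choice of the form, and those with n ≥ 2 vanish by weight.
-- For n = 0 the result is a form η, since x commutes with i_R(y); the commutator formula gives
-- z_(1) η = 0 for all z in 𝔤, so η = 0 by `eq_of_commute`.
include h0 in
theorem isDualEmbedding_dualEmbedding : IsDualEmbedding κ (dualEmbedding b κ) where
  injective x y h := rightField_injective (congrArg Prod.fst h)
  proj x := rfl
  commute x y n hn := by
    have h1 : ∀ x, nprod 1 (weightOne κ (leftMap A x)) (weightOne κ (dualEmbedding b κ y)) = 0 := by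
      intro x
      change nprod 1 _ (weightOne κ (rightField A y, dualForm b κ (rightField A y))) = 0
      rw [nprod_one_weightOne_mk b, lift_dualForm, sub_self, map_zero]
    rcases hn.eq_or_lt with rfl | hn
    · obtain ⟨η, hη⟩ := ((fields κ).actsBy_vf x).nprod_zero_form_mem (dualForm b κ (rightField A y))
      have h2 : nprod 0 (weightOne κ (leftMap A x)) (weightOne κ (dualEmbedding b κ y)) =
          weightOne κ (0, η) := by
        change nprod 0 _ (weightOne κ (rightField A y, dualForm b κ (rightField A y))) = _
        rw [weightOne_mk κ (rightField A y), map_add, weightOne_form, weightOne_form]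
        refine (congrArg₂ _ (nprod_zero_weightOne b x (rightField A y)) hη.symm).trans ?_
        rw [lie_rightField]
        exact (congrArg (· + _) (map_zero (weightOne κ))).trans (zero_add _)
      have h3 : η = 0 := eq_of_commute b h0 (D := 0) (fun z => by
        rw [← h2, VertexAlgebra.nprod_comm, h1, map_zero, zero_add, binSum_one]
        have e0 : nprod 0 (weightOne κ (leftMap A z)) (weightOne κ (leftMap A x)) =
          weightOne κ (leftMap A ⁅z, x⁆) := (fields κ).nprod_zero_vf z x
        have e1 : nprod 1 (weightOne κ (leftMap A z)) (weightOne κ (leftMap A x)) =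
          κ z x • vac := (fields κ).nprod_one_vf z x
        simp only [Nat.cast_zero, Nat.cast_one, add_zero, sub_zero, sub_self, e0, e1, h1, map_smul,
          LinearMap.smul_apply, VertexAlgebra.vac_nprod]
        norm_num) fun z => by
        rw [show ((0, 0) : Derivation ℂ A A × Ω[A⁄ℂ]) = 0 from rfl, map_zero, map_zero]
      rw [h2, h3, show ((0, 0) : Derivation ℂ A A × Ω[A⁄ℂ]) = 0 from rfl, map_zero]
    · rcases eq_or_ne n 1 with rfl | hn1
      · exact h1 x
      · exact nprod_weightOne_eq_zero κ _ _ (by omega)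

section Products

variable {j : leftInvariantFields A →ₗ[ℂ] Derivation ℂ A A × Ω[A⁄ℂ]} (hj : IsDualEmbedding κ j)

include b h0 hj

theorem eq_dualEmbedding : j = dualEmbedding b κ := by
  have hd := isDualEmbedding_dualEmbedding b h0
  refine LinearMap.ext fun y => Prod.ext (hj.proj y) (eq_of_commute b h0 (D := (j y).1)
    (fun x => hj.commute x y 1 zero_le_one) fun x => ?_)
  rw [hj.proj y, ← hd.proj y]
  exact hd.commute x y 1 zero_le_one

omit [Algebra.FiniteType ℂ A] [ConnectedSpace (PrimeSpectrum A)] h0 in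
theorem actsBy_dual (y : leftInvariantFields A) :
    (functions κ).ActsBy (weightOne κ (j y)) (rightField A y) := by
  rw [← hj.proj]
  exact actsBy_weightOne b _

omit b h0 [DecidableEq ι] [Fintype ι] [Algebra.FiniteType ℂ A] [ConnectedSpace (PrimeSpectrum A)] in
theorem nprod_dual_leftMap (x y : leftInvariantFields A) {n : ℤ} (hn : 0 ≤ n) :
    nprod n (weightOne κ (j y)) (weightOne κ (leftMap A x)) = 0 :=
  VertexAlgebra.nprod_eq_zero_of_skew (hj.commute x y) hn

omit [Algebra.FiniteType ℂ A] [ConnectedSpace (PrimeSpectrum A)] h0 in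
theorem nprod_dual_smul (x y : leftInvariantFields A) (a : A) {n : ℤ} (hn : 0 ≤ n) :
    nprod n (weightOne κ (j y)) (nprod (-1) ((fields κ).fn a) ((fields κ).vf x)) =
      nprod (n - 1) ((fields κ).fn (rightField A y a)) ((fields κ).vf x) := by
  refine ((actsBy_dual b hj y).nprod_nprod_fn a n (-1) _).trans ?_
  rw [show nprod n (weightOne κ (j y)) ((fields κ).vf x) = 0 from nprod_dual_leftMap hj x y hn,
    map_zero, zero_add]
  rfl

/-- Both sides have the vector field [i_R(y), i_R(z)], and both commute with j_L because commutants
are closed under products, so `eq_of_commute` identifies their forms. -/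
theorem nprod_zero_dual (y z : leftInvariantFields A) :
    nprod 0 (weightOne κ (j y)) (weightOne κ (j z)) = weightOne κ (j ⁅y, z⁆) := by
  obtain ⟨η, hη⟩ := (actsBy_dual b hj y).nprod_zero_form_mem (j z).2
  have h2 : nprod 0 (weightOne κ (j y)) (weightOne κ (j z)) =
      weightOne κ (rightField A ⁅y, z⁆, η) := by
    conv_lhs => rw [← Prod.mk.eta (p := j z)]
    rw [weightOne_mk κ (j z).1, map_add, weightOne_form, ← hη, weightOne_mk κ _ η, weightOne_form, hj.proj]
    congr 1
    rw [← b.rightField_lie, b.lie_eq_sum_of_commute (fun x f => comm_rightField x y f),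
      weightOne_eq_sum b, map_sum, weightOne_eq_sum b]
    refine Finset.sum_congr rfl fun i _ => ?_
    rw [nprod_dual_smul b hj _ _ _ le_rfl, zero_sub, b.coeff_sum_smul]
  have h3 : η = (j ⁅y, z⁆).2 := eq_of_commute b h0 (D := rightField A ⁅y, z⁆) (fun x => by
    rw [← h2]
    exact VertexAlgebra.nprod_nprod_eq_zero (hj.commute x y) (hj.commute x z) 0 1 zero_le_one)
    fun x => by
      rw [← hj.proj, Prod.mk.eta]
      exact hj.commute x _ 1 zero_le_one
  rw [h2, h3, ← hj.proj]

/-- The product is a function h commuting with j_L, so x(h) = 0 for all x in 𝔤 and h is constant by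
`eq_counit`. It is then enough to compute h at the unit. -/
theorem nprod_one_dual (y z : leftInvariantFields A) :
    nprod 1 (weightOne κ (j y)) (weightOne κ (j z)) = dualLevel κ y z • vac := by
  set h : A := (rightField A y).liftKaehlerDifferential (j z).2 -
    ∑ i, (b.basis i : Derivation ℂ A A) (rightField A y (b.coeff (rightField A z) i)) with hh
  have h1 : nprod 1 (weightOne κ (j y)) (weightOne κ (j z)) = (functions κ).fn h := by
    conv_lhs => rw [← Prod.mk.eta (p := j z)]
    rw [weightOne_mk κ (j z).1, map_add, weightOne_form, (actsBy_dual b hj y).nprod_one_form, hh, map_sub,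
      sub_eq_add_neg, add_comm, hj.proj]
    congr 1
    rw [weightOne_eq_sum b, map_sum, map_sum, ← Finset.sum_neg_distrib]
    refine Finset.sum_congr rfl fun i _ => ?_
    rw [nprod_dual_smul b hj _ _ _ zero_le_one, sub_self, (fields κ).nprod_zero_fn_vf]
    rfl
  have h2 : h = algebraMap ℂ A (counit (R := ℂ) h) := b.eq_counit fun x => by
    refine fn_injective b h0 ?_
    rw [map_zero, ← nprod_zero_vf_fn, ← h1]
    exact VertexAlgebra.nprod_nprod_eq_zero (hj.commute x y) (hj.commute x z) 1 0 le_rfl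
  have h3 : counit (R := ℂ) h = dualLevel κ y z := by
    have e1 : ∑ i, counit (R := ℂ) ((b.basis i : Derivation ℂ A A)
        (rightField A y (b.coeff (rightField A z) i))) = 0 := by
      rw [← b.trace_ad_lie y z]
      refine Finset.sum_congr rfl fun i _ => ?_
      rw [comm_rightField, counit_rightField, b.counit_apply_apply_coeff_rightField, neg_neg]
    have hlift : ∀ x : leftInvariantFields A, (x : Derivation ℂ A A).liftKaehlerDifferential
        (j z).2 = pairingDefect b κ (rightField A z) x := fun x => by
      refine lift_eq_of_commute b h0 (fun x => ?_) x
      rw [← hj.proj, Prod.mk.eta]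
      exact hj.commute x _ 1 zero_le_one
    -- At the unit i_R(y) equals -y, so the pairing with the form of j(z) is minus the known pairing
    -- with the left invariant field y.
    have e2 : counit (R := ℂ) ((rightField A y).liftKaehlerDifferential (j z).2) =
        -counit (R := ℂ) (pairingDefect b κ (rightField A z) y) := by
      rw [b.form_eq_sum (j z).2, map_sum, map_sum, ← sum_repr_pairingDefect, map_sum,
        ← Finset.sum_neg_distrib]
      refine Finset.sum_congr rfl fun k _ => ?_
      rw [map_smul, hlift, smul_eq_mul, Bialgebra.counit_mul, map_smul, smul_eq_mul,
        show (rightField A y).liftKaehlerDifferential (b.form k) = b.coeff (rightField A y) k from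
        rfl, b.counit_coeff_rightField]
      ring
    have e3 : ∑ i, κ y (b.basis i) * b.basis.repr z i = κ y z := by
      conv_rhs => rw [← b.basis.sum_repr z, map_sum]
      simp only [map_smul, smul_eq_mul, mul_comm]
    -- In `pairingDefect` the second derivatives of the coefficients give the Killing form and the
    -- undifferentiated terms give κ; `e2` reverses both signs.
    rw [hh, map_sub, map_sum, e1, sub_zero, e2, pairingDefect_apply, map_sum]
    simp only [map_sub, b.counit_apply_apply_coeff_rightField, map_smul, b.counit_coeff_rightField,
      smul_eq_mul, mul_neg, sub_neg_eq_add, Finset.sum_add_distrib, Finset.sum_neg_distrib, e3,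
      b.sum_repr_eq_killingForm]
    simp only [dualLevel, LinearMap.sub_apply, LinearMap.neg_apply]
    ring
  rw [h1, h2, h3, Algebra.algebraMap_eq_smul_one, map_smul, (functions κ).fn_one]

/-- The extension of the dual embedding to the vertex algebra of the dual level. -/
theorem exists_dualHom : ∃ J : VertexAlgebraHom (AffineVertexAlgebra (dualLevel κ)) (ChiralDiffOps κ),
    ∀ x, J.toFun (affineOf (dualLevel κ) x) = weightOne κ (j x) := by
  refine ⟨envelopeLift (fun y => weightOne κ (j y)) (fun r hr => ?_)
    (eval_eq_zero_of_deg_neg (wt' := fun _ : leftInvariantFields A => 1)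
      (g' := fun y => weightOne κ (j y)) (fun y z n hn => ?_) fun y =>
      VertexAlgebra.generator_mem_creationSpan (wt := fun _ : leftInvariantFields A => 1)
        (g := fun y => weightOne κ (j y)) y), fun x => envelopeLift_of _ _ _ x⟩
  · cases hr with
    | add x y => simp
    | smul c x => simp
    | bracket x y => simp [nprod_zero_dual b h0 hj]
    | form x y => simp [nprod_one_dual b h0 hj]
  · rcases hn.eq_or_lt with rfl | hn
    · rw [nprod_zero_dual b h0 hj]
      exact Submodule.subset_span (.inr ⟨⁅y, z⁆, by norm_num, rfl⟩)
    · rcases eq_or_ne n 1 with rfl | hn1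
      · rw [nprod_one_dual b h0 hj]
        exact Submodule.smul_mem _ _ (Submodule.subset_span (.inl ⟨by norm_num, rfl⟩))
      · rw [nprod_weightOne_eq_zero κ _ _ (by omega)]
        exact zero_mem _

end Products

end CDO

/-! ### Detection of creation words by functions -/

namespace VertexAlgebra

variable {V : Type*} [AddCommGroup V] [Module ℂ V] [VertexAlgebra V] {ι : Type*}

/-- The vector `(u_1)_(-1-n_1) … (u_k)_(-1-n_k) 1`. -/
def creationWord (u : ι → V) : List (ι × ℕ) → V
  | [] => VertexAlgebra.vac
  | p :: w => nprod (-1 - p.2) (u p.1) (creationWord u w)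

end VertexAlgebra

open VertexAlgebra (creationWord)

/-- The number of ways to match the letters of two words. -/
def matchings {α : Type*} [DecidableEq α] : List α → List α → ℕ
  | [], [] => 1
  | [], _ :: _ => 0
  | a :: v, w => ∑ i : Fin w.length, if w[i] = a then matchings v (w.eraseIdx i) else 0

/-- The count is a sum of natural numbers, so there is no cancellation and one complete matching is
enough. -/
theorem matchings_ne_zero_iff {α : Type*} [DecidableEq α] (v w : List α) :
    matchings v w ≠ 0 ↔ v.Perm w := by
  induction v generalizing w with
  | nil => cases w <;> simp [matchings]
  | cons a v ih =>
    rw [matchings, Ne, Finset.sum_eq_zero_iff, not_forall]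
    constructor
    · rintro ⟨i, hi⟩
      rw [Classical.not_imp] at hi
      have hi := hi.2
      split_ifs at hi with h
      · have h1 := (ih _).1 hi
        subst h
        exact (h1.cons _).trans (List.getElem_cons_eraseIdx_perm i.2)
      · exact absurd rfl hi
    · intro h
      obtain ⟨i, hi, rfl⟩ := List.getElem_of_mem (h.subset (List.mem_cons_self))
      refine ⟨⟨i, hi⟩, ?_⟩
      rw [Classical.not_imp]
      refine ⟨Finset.mem_univ _, ?_⟩
      rw [if_pos (show w[(⟨i, hi⟩ : Fin w.length)] = w[i] from rfl)]
      exact (ih _).2 ((h.trans (List.getElem_cons_eraseIdx_perm hi).symm).cons_inv)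

/-- The total mode of a word. -/
def wordWeight {ι : Type*} (w : List (ι × ℕ)) : ℕ := (w.map Prod.snd).sum

theorem wordWeight_eraseIdx {ι : Type*} (w : List (ι × ℕ)) (i : Fin w.length) :
    w[i].2 + wordWeight (w.eraseIdx i) = wordWeight w :=
  ((List.getElem_cons_eraseIdx_perm i.2).map Prod.snd).sum_eq

namespace FunctionEmbedding

variable {A V : Type*} [CommRing A] [Algebra ℂ A] [AddCommGroup V] [Module ℂ V]
    [VertexAlgebra V] (F : FunctionEmbedding A V)

/-- The vectors annihilated by all products of `r` nonnegative modes of functions. -/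
def annihilatedBy : ℕ → Submodule ℂ V
  | 0 => ⊥
  | r + 1 => ⨅ a : A, ⨅ n : ℕ, (annihilatedBy r).comap (nprod n (F.fn a))

theorem mem_annihilatedBy_succ {r : ℕ} {v : V} : v ∈ F.annihilatedBy (r + 1) ↔
    ∀ a (n : ℕ), nprod n (F.fn a) v ∈ F.annihilatedBy r := by
  simp [annihilatedBy]

theorem mem_annihilatedBy_zero {v : V} : v ∈ F.annihilatedBy 0 ↔ v = 0 := Iff.rfl

theorem nprod_fn_mem_annihilatedBy (f : A) (p : ℤ) {r : ℕ} {v : V} (hv : v ∈ F.annihilatedBy r) :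
    nprod p (F.fn f) v ∈ F.annihilatedBy r := by
  induction r generalizing v with
  | zero =>
    rw [mem_annihilatedBy_zero] at hv ⊢
    rw [hv, map_zero]
  | succ r ih =>
    rw [mem_annihilatedBy_succ] at hv ⊢
    intro a n
    rw [F.fn_comm]
    exact ih (hv a n)

variable {F} in
theorem ActsBy.nprod_fn_nprod {u : V} {δ : Derivation ℂ A A} (h : F.ActsBy u δ) (a : A) (m n : ℤ)
    (v : V) : nprod n (F.fn a) (nprod m u v) =
      nprod m u (nprod n (F.fn a) v) - nprod (m + n) (F.fn (δ a)) v := by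
  rw [h.nprod_nprod_fn, add_sub_cancel_right]

-- Moving a function mode past a mode of u leaves only another function mode, so one more
-- nonnegative mode suffices to annihilate.
variable {F} in
theorem ActsBy.nprod_mem_annihilatedBy {u : V} {δ : Derivation ℂ A A} (h : F.ActsBy u δ) (p : ℤ)
    {r : ℕ} {v : V} (hv : v ∈ F.annihilatedBy r) : nprod p u v ∈ F.annihilatedBy (r + 1) := by
  induction r generalizing v with
  | zero =>
    rw [mem_annihilatedBy_zero] at hv
    rw [hv, map_zero]
    exact zero_mem _
  | succ r ih =>
    rw [mem_annihilatedBy_succ]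
    intro a n
    rw [h.nprod_fn_nprod]
    exact sub_mem (ih ((F.mem_annihilatedBy_succ).1 hv a n)) (F.nprod_fn_mem_annihilatedBy _ _ hv)

section Words

variable {ι : Type*} {u : ι → V} {δ : ι → Derivation ℂ A A} (h : ∀ c, F.ActsBy (u c) (δ c))

include h in
theorem creationWord_mem_annihilatedBy (w : List (ι × ℕ)) :
    creationWord u w ∈ F.annihilatedBy (w.length + 1) := by
  induction w with
  | nil =>
    rw [mem_annihilatedBy_succ]
    intro a n
    exact (F.mem_annihilatedBy_zero).2 (VertexAlgebra.nprod_vac_of_nonneg _ _ (by omega))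
  | cons p w ih => exact (h p.1).nprod_mem_annihilatedBy _ ih

include h in
/-- A mode of a function contracts the letters of a word, up to shorter words. -/
theorem nprod_fn_creationWord (f : A) (m : ℤ) (hm : 0 ≤ m) (w : List (ι × ℕ)) :
    nprod m (F.fn f) (creationWord u w) + ∑ i : Fin w.length, nprod (m - 1 - w[i].2)
      (F.fn (δ w[i].1 f)) (creationWord u (w.eraseIdx i)) ∈ F.annihilatedBy (w.length - 1) := by
  induction w with
  | nil =>
    refine (F.mem_annihilatedBy_zero).2 ?_
    simpa [creationWord] using VertexAlgebra.nprod_vac_of_nonneg m (F.fn f) hm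
  | cons p w ih =>
    set x := nprod m (F.fn f) (creationWord u w) + ∑ i : Fin w.length, nprod (m - 1 - w[i].2)
      (F.fn (δ w[i].1 f)) (creationWord u (w.eraseIdx i)) with hx
    have h1 : nprod (-1 - p.2) (u p.1) x ∈ F.annihilatedBy w.length := by
      -- The index in `ih` is a truncated difference: for the empty word the error x is zero
      -- outright, and otherwise u raises the index by one.
      rcases Nat.eq_zero_or_pos w.length with h0 | h0
      · rw [h0, Nat.zero_sub] at ih
        rw [(F.mem_annihilatedBy_zero).1 ih, map_zero]
        exact zero_mem _
      · have := (h p.1).nprod_mem_annihilatedBy (-1 - p.2) ih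
        rwa [Nat.sub_add_cancel h0] at this
    -- These are the commutators of the first letter with the functions in the contraction terms.
    -- They carry words two letters shorter than the full word, hence belong to the error.
    have h2 : ∑ i : Fin w.length, nprod (-1 - p.2 + (m - 1 - w[i].2))
        (F.fn (δ p.1 (δ w[i].1 f))) (creationWord u (w.eraseIdx i)) ∈ F.annihilatedBy w.length := by
      refine sum_mem fun i _ => F.nprod_fn_mem_annihilatedBy _ _ ?_
      have := F.creationWord_mem_annihilatedBy h (w.eraseIdx i)
      rwa [List.length_eraseIdx_of_lt i.2, Nat.sub_add_cancel (by have := i.2; omega)] at this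
    change _ ∈ F.annihilatedBy w.length
    convert sub_mem h1 h2 using 1
    rw [hx, map_add, map_sum]
    simp only [(h p.1).nprod_nprod_fn, Finset.sum_add_distrib, List.length_cons,
      Fin.sum_univ_succ, creationWord]
    rw [show -1 - (p.2 : ℤ) + m = m - 1 - p.2 by ring]
    simp only [Fin.getElem_fin, Fin.val_zero, Fin.val_succ, List.getElem_cons_zero,
      List.getElem_cons_succ, List.eraseIdx_cons_zero, List.eraseIdx_cons_succ, creationWord]
    abel

/-- A product of nonnegative modes of functions. -/
def detect (t : ι → A) : List (ι × ℕ) → V →ₗ[ℂ] V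
  | [] => LinearMap.id
  | q :: Q => detect t Q ∘ₗ nprod q.2 (F.fn (t q.1))

variable (t : ι → A)

theorem detect_nprod_fn (Q : List (ι × ℕ)) (f : A) (n : ℤ) (v : V) :
    F.detect t Q (nprod n (F.fn f) v) = nprod n (F.fn f) (F.detect t Q v) := by
  induction Q generalizing v with
  | nil => rfl
  | cons q Q ih =>
    rw [detect, LinearMap.comp_apply, LinearMap.comp_apply, F.fn_comm, ih]

theorem detect_mem_annihilatedBy (Q : List (ι × ℕ)) (r : ℕ) {v : V}
    (hv : v ∈ F.annihilatedBy (r + Q.length)) : F.detect t Q v ∈ F.annihilatedBy r := by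
  induction Q generalizing v with
  | nil => exact hv
  | cons q Q ih => exact ih ((F.mem_annihilatedBy_succ).1 hv _ _)

theorem detect_eq_zero (Q : List (ι × ℕ)) {r : ℕ} (hr : r ≤ Q.length) {v : V}
    (hv : v ∈ F.annihilatedBy r) : F.detect t Q v = 0 := by
  induction Q generalizing v r with
  | nil =>
    obtain rfl : r = 0 := Nat.le_zero.1 hr
    exact hv
  | cons q Q ih =>
    cases r with
    | zero => rw [(F.mem_annihilatedBy_zero).1 hv, map_zero]
    | succ r => exact ih (Nat.le_of_succ_le_succ hr) ((F.mem_annihilatedBy_succ).1 hv _ _)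

include h

/-- The error of the first contraction lies in `annihilatedBy` of an index at most the number of
modes still to be applied, so `detect` removes it. -/
theorem detect_cons_creationWord (q : ι × ℕ) (Q w : List (ι × ℕ)) (hl : Q.length + 1 = w.length) :
    F.detect t (q :: Q) (creationWord u w) = -∑ i : Fin w.length, nprod (q.2 - 1 - w[i].2)
      (F.fn (δ w[i].1 (t q.1))) (F.detect t Q (creationWord u (w.eraseIdx i))) := by
  have h1 := F.detect_eq_zero t Q (by omega)
    (F.nprod_fn_creationWord h (t q.1) q.2 (Int.natCast_nonneg _) w)
  rw [map_add, map_sum] at h1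
  rw [eq_neg_iff_add_eq_zero, ← h1]
  simp only [detect_nprod_fn]
  congr 1
  exact F.detect_nprod_fn t Q _ _ _

/-- After as many function modes as the word has letters, what remains is killed by one more
nonnegative mode, as a function would be. -/
theorem nprod_fn_detect_eq_zero (Q w : List (ι × ℕ)) (hl : Q.length = w.length) (f : A) (n : ℕ) :
    nprod n (F.fn f) (F.detect t Q (creationWord u w)) = 0 := by
  have := F.detect_mem_annihilatedBy t Q 1 (by
    rw [hl, add_comm]
    exact F.creationWord_mem_annihilatedBy h w)
  exact (F.mem_annihilatedBy_succ).1 this f n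

/-- Contracting the letter (c, n) with the mode q leaves a function mode of index q - 1 - n, which
kills the rest when n < q. A surviving chain of contractions would need the total mode of w to be at
least that of Q. -/
theorem detect_creationWord_eq_zero (Q w : List (ι × ℕ)) (hl : Q.length = w.length)
    (hw : wordWeight w < wordWeight Q) : F.detect t Q (creationWord u w) = 0 := by
  induction Q generalizing w with
  | nil => exact absurd hw (Nat.not_lt_zero _)
  | cons q Q ih =>
    rw [F.detect_cons_creationWord h t q Q w hl, Finset.sum_eq_zero, neg_zero]
    intro i _
    have hli : Q.length = (w.eraseIdx i).length := by
      rw [List.length_eraseIdx_of_lt i.2, ← hl]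
      rfl
    have hwi := wordWeight_eraseIdx w i
    have hq : wordWeight (q :: Q) = q.2 + wordWeight Q := rfl
    rcases lt_or_ge w[i].2 q.2 with hi | hi
    · obtain ⟨n, hn⟩ := Int.eq_ofNat_of_zero_le (show (0 : ℤ) ≤ q.2 - 1 - w[i].2 by omega)
      rw [hn]
      exact F.nprod_fn_detect_eq_zero h t Q _ hli _ n
    · rw [ih _ hli (by omega), map_zero]

/-- At equal total mode only contractions with n = q survive, since n > q makes the remaining modes
too small. Each leaves the function δ_c(t_a) at index -1; its value -1 on a match cancels the sign
of the contraction. -/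
theorem detect_creationWord [DecidableEq ι] (ε : A →ₐ[ℂ] ℂ)
    (hε : ∀ c a, ε (δ c (t a)) = if c = a then -1 else 0) (Q w : List (ι × ℕ))
    (hl : Q.length = w.length) (hw : wordWeight w = wordWeight Q) :
    ∃ g, F.detect t Q (creationWord u w) = F.fn g ∧ ε g = matchings Q w := by
  induction Q generalizing w with
  | nil =>
    obtain rfl : w = [] := List.length_eq_zero_iff.1 hl.symm
    exact ⟨1, F.fn_one.symm, by simp [matchings]⟩
  | cons q Q ih =>
    have key : ∀ i : Fin w.length, ∃ g, nprod (q.2 - 1 - w[i].2)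
      (F.fn (δ w[i].1 (t q.1))) (F.detect t Q (creationWord u (w.eraseIdx i))) = F.fn g ∧
        ε g = -((if w[i] = q then matchings Q (w.eraseIdx i) else 0 : ℕ) : ℂ) := by
      intro i
      have hli : Q.length = (w.eraseIdx i).length := by
        rw [List.length_eraseIdx_of_lt i.2, ← hl]
        rfl
      have hwi := wordWeight_eraseIdx w i
      have hq : wordWeight (q :: Q) = q.2 + wordWeight Q := rfl
      rcases lt_trichotomy w[i].2 q.2 with hi | hi | hi
      · obtain ⟨n, hn⟩ := Int.eq_ofNat_of_zero_le (show (0 : ℤ) ≤ q.2 - 1 - w[i].2 by omega)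
        refine ⟨0, ?_, ?_⟩
        · rw [hn, map_zero]
          exact F.nprod_fn_detect_eq_zero h t Q _ hli _ n
        · rw [if_neg fun e => hi.ne (congrArg Prod.snd e)]
          simp
      · obtain ⟨g, hg, hg'⟩ := ih _ hli (by omega)
        refine ⟨δ w[i].1 (t q.1) * g, ?_, ?_⟩
        · rw [hg, F.fn_mul, hi, show (q.2 : ℤ) - 1 - q.2 = -1 by ring]
        · rw [map_mul, hε, hg']
          by_cases hc : w[i].1 = q.1
          · rw [if_pos hc, if_pos (Prod.ext hc hi), neg_one_mul]
          · rw [if_neg hc, if_neg fun e => hc (congrArg Prod.fst e)]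
            simp
      · refine ⟨0, ?_, ?_⟩
        · rw [F.detect_creationWord_eq_zero h t Q _ hli (by omega), map_zero, map_zero]
        · rw [if_neg fun e => hi.ne' (congrArg Prod.snd e)]
          simp
    choose g hg hg' using key
    refine ⟨-∑ i, g i, ?_, ?_⟩
    · rw [F.detect_cons_creationWord h t q Q w hl, map_neg, map_sum]
      simp only [hg]
    · rw [map_neg, map_sum, matchings]
      simp only [hg', Finset.sum_neg_distrib, neg_neg, Nat.cast_sum]

/-- Linear combinations of creation words, one for each multiset of letters, are nonzero. -/
theorem linearIndependent_creationWord [DecidableEq ι] (ε : A →ₐ[ℂ] ℂ)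
    (hε : ∀ c a, ε (δ c (t a)) = if c = a then -1 else 0) (hinj : Function.Injective F.fn) :
    LinearIndependent ℂ fun μ : Multiset (ι × ℕ) => creationWord u μ.toList := by
  rw [linearIndependent_iff]
  intro c hc
  by_contra hne
  have hs : c.support.Nonempty := Finsupp.support_nonempty_iff.2 hne
  -- A leading word: longest, and among the longest of greatest total mode. Detection by μ kills
  -- shorter words and words of smaller total mode, and at ε it distinguishes μ from the remaining
  -- multisets.
  obtain ⟨μ, hμ, hmax⟩ := c.support.exists_max_image
    (fun μ => toLex (Multiset.card μ, wordWeight μ.toList)) hs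
  have key : ∀ ν ∈ c.support, ∃ g, F.detect t μ.toList (creationWord u ν.toList) = F.fn g ∧
      ε g = if ν = μ then (matchings μ.toList μ.toList : ℂ) else 0 := by
    intro ν hν
    rcases Prod.Lex.le_iff.1 (hmax ν hν) with hlt | ⟨heq, hle⟩
    · refine ⟨0, ?_, ?_⟩
      · rw [map_zero]
        refine F.detect_eq_zero t _ ?_ (F.creationWord_mem_annihilatedBy h _)
        simpa using hlt
      · rw [map_zero, if_neg]
        rintro rfl
        exact lt_irrefl _ hlt
    · have hl : μ.toList.length = ν.toList.length := by simpa using heq.symm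
      rcases hle.lt_or_eq with hlt | hw
      · refine ⟨0, ?_, ?_⟩
        · rw [map_zero]
          exact F.detect_creationWord_eq_zero h t _ _ hl hlt
        · rw [map_zero, if_neg]
          rintro rfl
          exact lt_irrefl _ hlt
      · obtain ⟨g, hg, hg'⟩ := F.detect_creationWord h t ε hε _ _ hl hw
        refine ⟨g, hg, ?_⟩
        split_ifs with he
        · rw [hg', he]
        · rw [hg', Nat.cast_eq_zero]
          by_contra hm
          refine he ?_
          have := Multiset.coe_eq_coe.2 ((matchings_ne_zero_iff _ _).1 hm)
          simpa using this.symm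
  choose! g hg hg' using key
  have h1 : F.fn (∑ ν ∈ c.support, c ν • g ν) = 0 := by
    have h2 := congrArg (F.detect t μ.toList) hc
    rw [Finsupp.linearCombination_apply, Finsupp.sum, map_sum, map_zero] at h2
    rw [map_sum, ← h2]
    refine Finset.sum_congr rfl fun ν hν => ?_
    rw [map_smul, map_smul, hg ν hν]
  have h2 : ε (∑ ν ∈ c.support, c ν • g ν) = 0 := by
    rw [hinj (h1.trans (map_zero F.fn).symm), map_zero]
  rw [map_sum, Finset.sum_eq_single_of_mem μ hμ fun ν hν hne => by
    rw [map_smul, hg' ν hν, if_neg hne, smul_zero], map_smul, hg' μ hμ, if_pos rfl,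
    smul_eq_mul] at h2
  refine (mul_ne_zero (Finsupp.mem_support_iff.1 hμ) ?_) h2
  exact Nat.cast_ne_zero.2 ((matchings_ne_zero_iff _ _).2 (List.Perm.refl _))

end Words

end FunctionEmbedding

open VertexAlgebra (creationWord)

/-! ### Spanning words in the vacuum module -/

namespace AffineVertexAlgebra

open VertexPresentation VertexAlgebra

variable {𝔤 : Type*} [LieRing 𝔤] [LieAlgebra ℂ 𝔤] (κ : LinearMap.BilinForm ℂ 𝔤)

/-- The generators as a linear map. -/
def generator : 𝔤 →ₗ[ℂ] AffineVertexAlgebra κ where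
  toFun := affineOf κ
  map_add' x y := by
    have h := mk_rel (wt := fun _ : 𝔤 => 1) (Rel.base _ (AffineRel.add (κ := κ) x y))
    rw [map_sub, sub_eq_zero, map_add] at h
    exact h
  map_smul' c x := by
    have h := mk_rel (wt := fun _ : 𝔤 => 1) (Rel.base _ (AffineRel.smul (κ := κ) c x))
    rw [map_sub, sub_eq_zero, map_smul] at h
    exact h

theorem generator_apply (x : 𝔤) : generator κ x = affineOf κ x := rfl

theorem nprod_zero_generator (x y : 𝔤) :
    nprod 0 (generator κ x) (generator κ y) = generator κ ⁅x, y⁆ := by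
  have h := mk_rel (wt := fun _ : 𝔤 => 1) (Rel.base _ (AffineRel.bracket (κ := κ) x y))
  rw [map_sub, sub_eq_zero] at h
  exact h

theorem nprod_one_generator (x y : 𝔤) :
    nprod 1 (generator κ x) (generator κ y) = κ x y • vac := by
  have h := mk_rel (wt := fun _ : 𝔤 => 1) (Rel.base _ (AffineRel.form (κ := κ) x y))
  rw [map_sub, sub_eq_zero, map_smul] at h
  exact h

theorem nprod_generator_eq_zero (x y : 𝔤) {n : ℤ} (hn : 2 ≤ n) :
    nprod n (generator κ x) (generator κ y) = 0 :=
  nprod_eq_zero_of_weight (of_mem_weightSpace (wt := fun _ : 𝔤 => 1) (R := AffineRel κ) x)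
    (of_mem_weightSpace (wt := fun _ : 𝔤 => 1) (R := AffineRel κ) y) hn

/-- The central term of the commutator is a mode of the vacuum of index at most -3, which is zero;
so creation modes commute up to a single creation mode. -/
theorem nprod_comm_generator (x y : 𝔤) (m n : ℕ) (v : AffineVertexAlgebra κ) :
    nprod (-1 - m) (generator κ x) (nprod (-1 - n) (generator κ y) v) =
      nprod (-1 - n) (generator κ y) (nprod (-1 - m) (generator κ x) v) +
        nprod (-1 - (m + n + 1 : ℕ)) (generator κ ⁅x, y⁆) v := by
  rw [nprod_comm, binSum_eq_single]
  · rw [Nat.cast_zero, nprod_zero_generator,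
      show -1 - (m : ℤ) + (-1 - n) - 0 = -1 - (m + n + 1 : ℕ) by push_cast; ring]
  · intro j
    rcases j with _ | j
    · rw [zero_add, Nat.cast_one, nprod_one_generator, map_smul, LinearMap.smul_apply, vac_nprod,
        if_neg (by omega), smul_zero]
    · rw [nprod_generator_eq_zero _ _ _ (by push_cast; omega), map_zero, LinearMap.zero_apply]

variable {ι : Type*} (b : Module.Basis ι ℂ 𝔤)

/-- The span of the creation words of length less than `k`. -/
def shortWords (k : ℕ) : Submodule ℂ (AffineVertexAlgebra κ) :=
  Submodule.span ℂ {v | ∃ w : List (ι × ℕ), w.length < k ∧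
    creationWord (fun i => generator κ (b i)) w = v}

theorem nprod_basis_mem_shortWords (i : ι) (n k : ℕ) {v : AffineVertexAlgebra κ}
    (hv : v ∈ shortWords κ b k) :
    nprod (-1 - n) (generator κ (b i)) v ∈ shortWords κ b (k + 1) := by
  refine (Submodule.span_le (p := (shortWords κ b (k + 1)).comap
    (nprod (-1 - n) (generator κ (b i))))).2 ?_ hv
  rintro _ ⟨w, hw, rfl⟩
  exact Submodule.subset_span ⟨(i, n) :: w, Nat.succ_lt_succ hw, rfl⟩

theorem nprod_generator_mem_shortWords (x : 𝔤) (n k : ℕ) {v : AffineVertexAlgebra κ}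
    (hv : v ∈ shortWords κ b k) :
    nprod (-1 - n) (generator κ x) v ∈ shortWords κ b (k + 1) := by
  rw [← b.linearCombination_repr x, Finsupp.linearCombination_apply, Finsupp.sum, map_sum, map_sum,
    LinearMap.sum_apply]
  refine sum_mem fun i _ => ?_
  rw [map_smul, map_smul, LinearMap.smul_apply]
  exact Submodule.smul_mem _ _ (nprod_basis_mem_shortWords κ b i n k hv)

/-- Up to shorter words, the order of the letters does not matter. -/
theorem creationWord_sub_mem {w w' : List (ι × ℕ)} (h : w.Perm w') :
    creationWord (fun i => generator κ (b i)) w - creationWord (fun i => generator κ (b i)) w' ∈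
      shortWords κ b w.length := by
  induction h with
  | nil => rw [sub_self]; exact zero_mem _
  | cons p _ ih =>
    rw [creationWord, creationWord, ← map_sub]
    exact nprod_basis_mem_shortWords κ b _ _ _ ih
  | swap p q w =>
    simp only [creationWord]
    rw [nprod_comm_generator, add_sub_cancel_left]
    exact nprod_generator_mem_shortWords κ b _ _ _ (Submodule.subset_span ⟨w, Nat.lt_succ_self _, rfl⟩)
  | trans h1 _ ih1 ih2 =>
    rw [← h1.length_eq] at ih2
    have := add_mem ih1 ih2
    rwa [sub_add_sub_cancel] at this

/-- Sort the word into the order chosen for its multiset of letters; the error consists of shorter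
words, handled by induction on the length. -/
theorem creationWord_mem_span (w : List (ι × ℕ)) :
    creationWord (fun i => generator κ (b i)) w ∈ Submodule.span ℂ
      (Set.range fun μ : Multiset (ι × ℕ) => creationWord (fun i => generator κ (b i)) μ.toList) := by
  induction hk : w.length using Nat.strong_induction_on generalizing w with
  | _ k ih =>
    subst hk
    have h1 := creationWord_sub_mem κ b (w := w) (w' := (w : Multiset (ι × ℕ)).toList)
      (Multiset.coe_eq_coe.1 (by simp))
    have h2 : shortWords κ b w.length ≤ Submodule.span ℂ (Set.range fun μ : Multiset (ι × ℕ) =>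
        creationWord (fun i => generator κ (b i)) μ.toList) := by
      refine Submodule.span_le.2 ?_
      rintro _ ⟨w', hw', rfl⟩
      exact ih _ hw' w' rfl
    have h3 := add_mem (h2 h1) (Submodule.subset_span ⟨(w : Multiset (ι × ℕ)), rfl⟩)
    rwa [sub_add_cancel] at h3

theorem generator_mem_generatorSpan (x : 𝔤) : generator κ x ∈ generatorSpan
    (fun _ : ι => 1) (fun i => generator κ (b i)) 1 := by
  rw [← b.linearCombination_repr x, Finsupp.linearCombination_apply, Finsupp.sum, map_sum]
  refine sum_mem fun i _ => ?_
  rw [map_smul]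
  exact Submodule.smul_mem _ _ (Submodule.subset_span (.inr ⟨i, rfl, rfl⟩))

theorem mem_span_creationMonomial (v : AffineVertexAlgebra κ) :
    v ∈ Submodule.span ℂ {v | ∃ w, CreationMonomial (fun _ : ι => 1)
      (fun i => generator κ (b i)) w v} := by
  set S := Submodule.span ℂ {v | ∃ w, CreationMonomial (fun _ : ι => 1)
      (fun i => generator κ (b i)) w v}
  have hle : ∀ w, creationSpan (fun _ : ι => 1) (fun i => generator κ (b i)) w ≤ S := fun w =>
    Submodule.span_mono fun v hv => ⟨w, hv⟩
  have hg : ∀ i j (n : ℤ), 0 ≤ n → nprod n (generator κ (b i)) (generator κ (b j)) ∈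
      generatorSpan (fun _ : ι => 1) (fun i => generator κ (b i))
        (((1 : ℕ) : ℤ) + ((1 : ℕ) : ℤ) - n - 1) := by
    intro i j n hn
    rcases hn.eq_or_lt with rfl | hn
    · rw [nprod_zero_generator]
      exact generator_mem_generatorSpan κ b _
    · rcases eq_or_ne n 1 with rfl | hn1
      · rw [nprod_one_generator]
        exact Submodule.smul_mem _ _ (Submodule.subset_span (.inl ⟨by norm_num, rfl⟩))
      · rw [nprod_generator_eq_zero _ _ _ (by omega)]
        exact zero_mem _
  refine envelope_induction S (Submodule.subset_span ⟨0, .vac⟩) (fun x => ?_)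
    (fun n u v hu hv => ?_) v
  · change generator κ x ∈ S
    rw [← b.linearCombination_repr x, Finsupp.linearCombination_apply, Finsupp.sum, map_sum]
    refine sum_mem fun i _ => ?_
    rw [map_smul]
    exact Submodule.smul_mem _ _ (hle 1 (generator_mem_creationSpan (wt := fun _ : ι => 1)
      (g := fun i => generator κ (b i)) i))
  · refine (Submodule.span_le (p := S.comap ((nprod n).flip v))).2 ?_ hu
    rintro u ⟨w, hu⟩
    refine (Submodule.span_le (p := S.comap (nprod n u))).2 ?_ hv
    rintro v ⟨w', hv⟩
    exact hle _ (nprod_mem_creationSpan (wt := fun _ : ι => 1) hg n (Submodule.subset_span hu)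
      (Submodule.subset_span hv))

/-- The creation words with letters in a fixed order span the vacuum module. -/
theorem span_creationWord : Submodule.span ℂ (Set.range fun μ : Multiset (ι × ℕ) =>
    creationWord (fun i => generator κ (b i)) μ.toList) = ⊤ := by
  refine eq_top_iff.2 fun v _ => ?_
  refine (Submodule.span_le.2 ?_) (mem_span_creationMonomial κ b v)
  rintro v ⟨w, hv⟩
  suffices h : ∃ l : List (ι × ℕ), creationWord (fun i => generator κ (b i)) l = v by
    obtain ⟨l, rfl⟩ := h
    exact creationWord_mem_span κ b l
  induction hv with
  | vac => exact ⟨[], rfl⟩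
  | cons i n w v _ ih =>
    obtain ⟨l, rfl⟩ := ih
    exact ⟨(i, n) :: l, rfl⟩

end AffineVertexAlgebra

theorem VertexAlgebraHom.map_creationWord {V W : Type*} [AddCommGroup V] [Module ℂ V]
    [VertexAlgebra V] [AddCommGroup W] [Module ℂ W] [VertexAlgebra W] (J : VertexAlgebraHom V W)
    {ι : Type*} (u : ι → V) (w : List (ι × ℕ)) :
    J.toFun (creationWord u w) = creationWord (fun i => J.toFun (u i)) w := by
  induction w with
  | nil => exact J.map_vac
  | cons p w ih => rw [creationWord, creationWord, J.map_nprod, ih]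

/-! ### Injectivity of the dual morphism and commutation with the left one. -/

namespace CDO

open VertexPresentation InvariantFields Coalgebra

variable {A : Type*} [CommRing A] [HopfAlgebra ℂ A]
  {κ : LinearMap.BilinForm ℂ (leftInvariantFields A)}
  {ι : Type*} [Fintype ι] [DecidableEq ι] (b : InvariantFrame A ι)
  [Algebra.FiniteType ℂ A] [ConnectedSpace (PrimeSpectrum A)]
  (h0 : (vac : ChiralDiffOps κ) ≠ 0)
  {j : leftInvariantFields A →ₗ[ℂ] Derivation ℂ A A × Ω[A⁄ℂ]} (hj : IsDualEmbedding κ j)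

-- A spanning family of the source has linearly independent image. The level of the source plays no
-- role here, only its spanning words. The functions t_i detect the letters, since i_R(x_i) t_k at
-- the unit is -1 for i = k and 0 otherwise.
include b h0 hj in
theorem dualHom_injective {κ' : LinearMap.BilinForm ℂ (leftInvariantFields A)}
    (J : VertexAlgebraHom (AffineVertexAlgebra κ') (ChiralDiffOps κ))
    (hJ : ∀ x, J.toFun (affineOf κ' x) = weightOne κ (j x)) : Function.Injective J.toFun := by
  have hli := (functions κ).linearIndependent_creationWord
    (fun i => actsBy_dual b hj (b.basis i)) b.coord (Bialgebra.counitAlgHom ℂ A)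
    (fun i k => by
      rw [Bialgebra.counitAlgHom_apply, counit_rightField, b.counit_basis_coord]
      split_ifs <;> simp) (fn_injective b h0)
  have hw : (fun μ : Multiset (ι × ℕ) => creationWord (fun i => weightOne κ (j (b.basis i)))
      μ.toList) = J.toFun ∘ fun μ : Multiset (ι × ℕ) =>
        creationWord (fun i => AffineVertexAlgebra.generator κ' (b.basis i)) μ.toList := by
    funext μ
    rw [Function.comp_apply, J.map_creationWord]
    simp only [AffineVertexAlgebra.generator_apply, hJ]
  rw [hw] at hli
  rw [← LinearMap.ker_eq_bot, eq_bot_iff]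
  intro v hv
  have hspan : v ∈ Submodule.span ℂ (Set.range fun μ : Multiset (ι × ℕ) =>
      creationWord (fun i => AffineVertexAlgebra.generator κ' (b.basis i)) μ.toList) := by
    rw [AffineVertexAlgebra.span_creationWord]
    trivial
  obtain ⟨c, rfl⟩ := (Finsupp.mem_span_range_iff_exists_finsupp).1 hspan
  have hc : c = 0 := by
    refine (linearIndependent_iff.1 hli) c ?_
    rw [← LinearMap.mem_ker.1 hv, Finsupp.linearCombination_apply, Finsupp.sum, Finsupp.sum, map_sum]
    simp only [map_smul, Function.comp_apply]
  rw [hc, Finsupp.sum_zero_index]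
  exact zero_mem _

-- Commutants are closed under products in either argument, so the relation extends from generators
-- first in the right-hand factor, then in the left-hand one.
omit [Fintype ι] [DecidableEq ι] [Algebra.FiniteType ℂ A] [ConnectedSpace (PrimeSpectrum A)] in
include hj in
theorem nprod_leftHom_dualHom {κ' : LinearMap.BilinForm ℂ (leftInvariantFields A)}
    (J : VertexAlgebraHom (AffineVertexAlgebra κ') (ChiralDiffOps κ))
    (hJ : ∀ x, J.toFun (affineOf κ' x) = weightOne κ (j x)) (u : AffineVertexAlgebra κ)
    (v : AffineVertexAlgebra κ') (n : ℤ) (hn : 0 ≤ n) :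
    nprod n ((leftHom κ).toFun u) (J.toFun v) = 0 := by
  let S : Submodule ℂ (AffineVertexAlgebra κ) :=
    ⨅ m : ℕ, ⨅ v, LinearMap.ker ((nprod m).flip (J.toFun v) ∘ₗ (leftHom κ).toFun)
  have hS : ∀ u, u ∈ S ↔ ∀ (m : ℕ) v, nprod m ((leftHom κ).toFun u) (J.toFun v) = 0 := fun u => by
    simp [S, Submodule.mem_iInf]
  have hu : u ∈ S := by
    refine envelope_induction S ?_ (fun x => ?_) (fun k u u' hu hu' => ?_) u
    · rw [hS]
      intro m v
      rw [(leftHom κ).map_vac, VertexAlgebra.vac_nprod, if_neg (by omega)]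
    · rw [hS]
      let T : Submodule ℂ (AffineVertexAlgebra κ') :=
        ⨅ m : ℕ, LinearMap.ker (nprod m ((leftHom κ).toFun (affineOf κ x)) ∘ₗ J.toFun)
      have hT : ∀ v, v ∈ T ↔ ∀ m : ℕ, nprod m ((leftHom κ).toFun (affineOf κ x)) (J.toFun v) = 0 :=
        fun v => by simp [T, Submodule.mem_iInf]
      have key : ∀ v, v ∈ T := by
        refine envelope_induction T ?_ (fun y => ?_) (fun k v v' hv hv' => ?_)
        · rw [hT]
          intro m
          rw [J.map_vac]
          exact VertexAlgebra.nprod_vac_of_nonneg _ _ (Int.natCast_nonneg m)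
        · rw [hT]
          intro m
          rw [leftHom_affineOf]
          refine (congrArg _ (hJ y)).trans (hj.commute x y m (Int.natCast_nonneg m))
        · rw [hT] at hv hv' ⊢
          intro m
          rw [J.map_nprod]
          refine VertexAlgebra.nprod_nprod_eq_zero (fun n hn => ?_) (fun n hn => ?_) k m
            (Int.natCast_nonneg m)
          · obtain ⟨n, rfl⟩ := Int.eq_ofNat_of_zero_le hn
            exact hv n
          · obtain ⟨n, rfl⟩ := Int.eq_ofNat_of_zero_le hn
            exact hv' n
      exact fun m v => (hT v).1 (key v) m
    · rw [hS] at hu hu' ⊢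
      intro m v
      rw [(leftHom κ).map_nprod]
      refine VertexAlgebra.nprod_nprod_left_eq_zero (fun n hn => ?_) (fun n hn => ?_) k m
        (Int.natCast_nonneg m)
      · obtain ⟨n, rfl⟩ := Int.eq_ofNat_of_zero_le hn
        exact hu n v
      · obtain ⟨n, rfl⟩ := Int.eq_ofNat_of_zero_le hn
        exact hu' n v
  obtain ⟨m, rfl⟩ := Int.eq_ofNat_of_zero_le hn
  exact (hS u).1 hu m v

end CDO

end

theorem corollary2p6 (A : Type*) [CommRing A] [HopfAlgebra ℂ A] [Algebra.Smooth ℂ A]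
    [ConnectedSpace (PrimeSpectrum A)]
    (κ : LinearMap.BilinForm ℂ (leftInvariantFields A))
    (hsymm : ∀ x y, κ x y = κ y x) (hinv : ∀ x y z, κ ⁅x, y⁆ z = κ x ⁅y, z⁆) :
    (∃! j : leftInvariantFields A →ₗ[ℂ] Derivation ℂ A A × Ω[A⁄ℂ], IsDualEmbedding κ j) ∧
    ∀ j : leftInvariantFields A →ₗ[ℂ] Derivation ℂ A A × Ω[A⁄ℂ], IsDualEmbedding κ j →
      ∃ J : VertexAlgebraHom (AffineVertexAlgebra (dualLevel κ)) (ChiralDiffOps κ),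
        (∀ x, J.toFun (affineOf (dualLevel κ) x) = weightOne κ (j x)) ∧
        (∀ J' : VertexAlgebraHom (AffineVertexAlgebra (dualLevel κ)) (ChiralDiffOps κ),
          (∀ x, J'.toFun (affineOf (dualLevel κ) x) = weightOne κ (j x)) → J' = J) ∧
        Function.Injective J.toFun ∧
        ∀ (u : AffineVertexAlgebra κ) (v : AffineVertexAlgebra (dualLevel κ)) (n : ℤ), 0 ≤ n →
          VertexAlgebra.nprod n ((leftHom κ).toFun u) (J.toFun v) = 0 := by
  classical
  obtain ⟨b⟩ := InvariantFrame.exists_frame (A := A)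
  have h0 := CDO.vac_ne_zero b hsymm hinv
  refine ⟨⟨CDO.dualEmbedding b κ, CDO.isDualEmbedding_dualEmbedding b h0,
    fun j hj => CDO.eq_dualEmbedding b h0 hj⟩, fun j hj => ?_⟩
  obtain ⟨J, hJ⟩ := CDO.exists_dualHom b h0 hj
  exact ⟨J, hJ, fun J' hJ' => VertexPresentation.envelope_hom_ext fun x =>
    (hJ' x).trans (hJ x).symm, CDO.dualHom_injective b h0 hj J hJ,
    CDO.nprod_leftHom_dualHom hj J hJ⟩
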